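/- Let $m\ge 2$ and let $(W,S)$ be a Coxeter system of type $I_2(2m)$, $S=\{s_1,s_2\}$, where $s_1s_2$ has order $2m$; let $\ell$ be the length function and let $w\mapsto w^\diamond$ be the automorphism of $W$ with $s_1^\diamond=s_2$, $s_2^\diamond=s_1$. *Notation.* Let $\Phi$ be the root system of $W$ (all roots of the same length), with positive roots determined by $S$ and with the map $\alpha\mapsto\alpha^\diamond$ induced by the permutation of the two simple roots. Call $w,w'$ $\diamond$-conjugate if $w'=x^\diamond wx^{-1}$ for some $x\in W$, and call $w$ a $\diamond$-twisted involution if $w^\diamond=w^{-1}$. For such $w$ put $C_W^\diamond(w)=\{x\in W\mid x^\diamond w=wx\}$, $\Phi_w=\{\alpha\in\Phi\mid w(\alpha)=-\alpha^\diamond\}$, $\varepsilon_w(x)=(-1)^k$ for $x\in C_W^\diamond(w)$, where $k$ is the number of positive $\alpha\in\Phi_w$ with $x(\alpha)$ negative, and $\Upsilon_w^\diamond=\operatorname{Ind}_{C_W^\diamond(w)}^W(\varepsilon_w)$. Let $\mathbf H$ be the generic Iwahori–Hecke algebra of $(W,S)$ over $\mathbb Z[v,v^{-1}]$, with basis $T_w$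 and $T_sT_w=T_{sw}$ if $\ell(sw)>\ell(w)$, $T_sT_w=T_{sw}+(v-v^{-1})T_w$ otherwise. Let $\mathbf C_w=\sum_{y\le w}(-1)^{\ell(w)+\ell(y)}v^{\ell(w)-\ell(y)}P_{y,w}(v^{-2})\,T_y$ be its Kazhdan–Lusztig basis ($P_{y,w}(q)$ being the Kazhdan–Lusztig polynomials and $\le$ the Bruhat order), and write $\mathbf C_x\mathbf C_y=\sum_z h_{x,y,z}\mathbf C_z$. For a left cell $\Gamma$ (an equivalence class for the Kazhdan–Lusztig left preorder $\le_L$), $[\Gamma]_1$ denotes the character of the $\mathbb Q[W]$-module obtained, by $v\mapsto 1$, from the $\mathbf H$-module with basis $(e_x)_{x\in\Gamma}$ and action $\mathbf C_x.e_y=\sum_{z\in\Gamma}h_{x,y,z}e_z$. Write $1_k=s_1s_2s_1\cdots$ and $2_k=s_2s_1s_2\cdots$ ($k$ factors each). Let $\langle\ ,\ \rangle_W$ be the usual scalar product of class functions. Then the following hold. 1. $1_{2m}=2_{2m}$ is the longest element of $W$. Up to $\diamond$-conjugacy, $1$ is the only $\diamond$-twisted involution; let $C_1$ be its $\diamond$-conjugacy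 class. 2. $\operatorname{Irr}(W)=\{1,\varepsilon,\varepsilon_1,\varepsilon_2,\chi_1,\dots,\chi_{m-1}\}$ (with $m+3$ distinct elements), where $1$ is the trivial and $\varepsilon$ the sign character, $\varepsilon_1,\varepsilon_2$ are of degree $1$ with $\varepsilon_1(s_1)=\varepsilon_2(s_2)=1$ and $\varepsilon_1(s_2)=\varepsilon_2(s_1)=-1$, and $\chi_j$ is the unique irreducible character of degree $2$ with $\chi_j(1_2)=2\cos(\pi j/m)$. 3. $C_W^\diamond(1)=\{x\in W\mid x^\diamond=x\}=\{1,1_{2m}\}$, $\Phi_1=\varnothing$, the character $\varepsilon_w$ for $w=1$ is trivial, and $$\Upsilon_1^\diamond=\operatorname{Ind}_{C_W^\diamond(1)}^W(1)=\begin{cases}1+\varepsilon+\varepsilon_1+\varepsilon_2+\sum_{1\le j\le (m-2)/2}2\chi_{2j}& (m\text{ even}),\\ 1+\varepsilon+\sum_{1\le j\le (m-1)/2}2\chi_{2j}&(m\text{ odd}).\end{cases}$$ 4. $W$ has exactly four left cells: $\Gamma_0=\{1\}$, $\Gamma_1=\{1_1,2_2,1_3,\dots,1_{2m-1}\}$,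 $\Gamma_2=\{2_1,1_2,2_3,\dots,2_{2m-1}\}$, $\Gamma_{2m}=\{1_{2m}\}$. We have $|C_1\cap\Gamma_i|=1$ for $i\in\{0,2m\}$ and $|C_1\cap\Gamma_i|=m-1$ for $i\in\{1,2\}$. 5. $[\Gamma_0]_1=1$, $[\Gamma_1]_1=\varepsilon_2+\sum_{1\le j\le m-1}\chi_j$, $[\Gamma_2]_1=\varepsilon_1+\sum_{1\le j\le m-1}\chi_j$, $[\Gamma_{2m}]_1=\varepsilon$. 6. $\langle\Upsilon_1^\diamond,[\Gamma_i]_1\rangle_W=1$ for $i\in\{0,2m\}$ and $=m-1$ for $i\in\{1,2\}$. Hence Kottwitz' conjecture holds for $(W,\diamond)$: for every $\diamond$-twisted involution $w$ with $\diamond$-conjugacy class $C$ and every left cell $\Gamma$ of $W$, $\langle\Upsilon_w^\diamond,[\Gamma]_1\rangle_W=|C\cap\Gamma|$. -/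

import Mathlib

namespace TwistedInv

noncomputable section

/-- The set of irreducible complex characters of `G`. -/
def irrChars (G : Type*) [Group G] : Set (G → ℂ) :=
  {χ | ∃ (n : ℕ) (ρ : Representation ℂ G (Fin n → ℂ)), ρ.IsIrreducible ∧ χ = ρ.character}

/-- The scalar product `⟨φ, ψ⟩ = |G|⁻¹ ∑ φ(g) conj(ψ(g))` of class functions. -/
def classInner {G : Type*} [Group G] [Fintype G] (φ ψ : G → ℂ) : ℂ :=
  (Fintype.card G : ℂ)⁻¹ * ∑ g, φ g * (starRingEnd ℂ) (ψ g)

open scoped Classical in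
/-- The induced class function `Ind_H^G(ψ)(g) = |H|⁻¹ ∑_{x ∈ G, x⁻¹gx ∈ H} ψ(x⁻¹gx)`. -/
def induced {G : Type*} [Group G] [Fintype G] (H : Subgroup G) (ψ : H → ℂ) : G → ℂ :=
  fun g => (Nat.card H : ℂ)⁻¹ *
    ∑ x : G, if h : x⁻¹ * g * x ∈ H then ψ ⟨x⁻¹ * g * x, h⟩ else 0

/-! ### Roots: the geometric representation on the space with basis the simple roots -/

section Roots

variable {B : Type*} (M : CoxeterMatrix B)

/-- The linear form `2 (α_i, ·)`, where `(α_i, α_j) = -cos (π / M i j)`. (An entry `M i j = 0`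
stands for `∞`, and then the value is `-1`, as it should be.) -/
def simpleCoroot (i : B) : Module.Dual ℝ (B →₀ ℝ) :=
  Finsupp.linearCombination ℝ (fun j => -2 * Real.cos (Real.pi / (M i j : ℝ)))

/-- The simple root `α_i`. -/
def simpleRoot (i : B) : B →₀ ℝ := Finsupp.single i 1

theorem simpleCoroot_simpleRoot (i j : B) :
    simpleCoroot M i (simpleRoot j) = -2 * Real.cos (Real.pi / (M i j : ℝ)) := by
  simp [simpleCoroot, simpleRoot]

theorem simpleCoroot_self (i : B) : simpleCoroot M i (simpleRoot i) = 2 := by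
  rw [simpleCoroot_simpleRoot]; simp

/-- The reflection `v ↦ v - 2 (α_i, v) α_i`. -/
def simpleReflection (i : B) : (B →₀ ℝ) ≃ₗ[ℝ] (B →₀ ℝ) :=
  Module.reflection (simpleCoroot_self M i)

theorem simpleReflection_liftable :
    M.IsLiftable (fun i => simpleReflection M i) := by
  intro i i'
  by_cases hii : i = i'
  · subst hii
    rw [M.diagonal, pow_one]
    exact LinearEquiv.ext (Module.involutive_reflection (simpleCoroot_self M i))
  have hm1 : M i i' ≠ 1 := M.off_diagonal i i' hii
  have hfy := simpleCoroot_simpleRoot M i i'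
  have hgx := simpleCoroot_simpleRoot M i' i
  rw [M.symmetric i' i] at hgx
  generalize M i i' = m at hfy hgx hm1
  rcases Nat.eq_zero_or_pos m with rfl | hpos
  · simp
  refine LinearEquiv.ext fun z => ?_
  unfold simpleReflection
  rw [Module.reflection_mul_reflection_pow_apply _ _ m z
    (2 * Real.cos (2 * (Real.pi / m))) (by rw [hfy, hgx, Real.cos_two_mul]; ring)]
  have hS := fun n : ℤ => Polynomial.Chebyshev.S_two_mul_real_cos (2 * (Real.pi / (m : ℝ))) n
  rcases Nat.lt_or_ge m 3 with h3 | h3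
  · obtain rfl : m = 2 := by omega
    have hc : Real.cos (Real.pi / ((2 : ℕ) : ℝ)) = 0 := by
      rw [Nat.cast_ofNat]; exact Real.cos_pi_div_two
    have ht : 2 * Real.cos (2 * (Real.pi / ((2 : ℕ) : ℝ))) = -2 := by
      rw [Real.cos_two_mul, hc]; norm_num
    rw [hc, mul_zero] at hfy hgx
    rw [ht, hfy, hgx]
    norm_num
    module
  have hmR : (3 : ℝ) ≤ m := by exact_mod_cast h3
  have hm0 : (m : ℝ) ≠ 0 := by positivity
  have hsin : Real.sin (2 * (Real.pi / (m : ℝ))) ≠ 0 := by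
    refine (Real.sin_pos_of_pos_of_lt_pi (by positivity) ?_).ne'
    rw [← mul_div_assoc, div_lt_iff₀ (by positivity)]
    nlinarith [Real.pi_pos]
  rcases Nat.even_or_odd' m with ⟨k, hk | hk⟩
  · have h0 : (Polynomial.Chebyshev.S ℝ ((k : ℤ) - 1)).eval
        (2 * Real.cos (2 * (Real.pi / (m : ℝ)))) = 0 := by
      have h := hS ((k : ℤ) - 1)
      have he : (((k : ℤ) - 1 : ℤ) + 1 : ℝ) * (2 * (Real.pi / (m : ℝ))) = Real.pi := by
        rw [hk] at hm0 ⊢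
        push_cast at hm0 ⊢
        have hk0 : (k : ℝ) ≠ 0 := fun h => hm0 (by rw [h, mul_zero])
        field_simp
        ring
      rw [he, Real.sin_pi] at h
      exact (mul_eq_zero.mp h).resolve_right hsin
    have e1 : ((m : ℤ) - 2) / 2 = (k : ℤ) - 1 := by omega
    have e2 : ((m : ℤ) - 1) / 2 = (k : ℤ) - 1 := by omega
    rw [e1, e2, h0]
    simp
  · have h0 : (Polynomial.Chebyshev.S ℝ (k : ℤ)).eval (2 * Real.cos (2 * (Real.pi / (m : ℝ)))) +
        (Polynomial.Chebyshev.S ℝ ((k : ℤ) - 1)).eval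
          (2 * Real.cos (2 * (Real.pi / (m : ℝ)))) = 0 := by
      have ha := hS (k : ℤ)
      have hb := hS ((k : ℤ) - 1)
      have he : ((k : ℤ) + 1 : ℝ) * (2 * (Real.pi / (m : ℝ))) =
          2 * Real.pi - (((k : ℤ) - 1 : ℤ) + 1 : ℝ) * (2 * (Real.pi / (m : ℝ))) := by
        rw [hk] at hm0 ⊢
        push_cast at hm0 ⊢
        field_simp
        ring
      rw [he, Real.sin_two_pi_sub, ← hb] at ha
      refine (mul_eq_zero.mp ?_).resolve_right hsin
      rw [add_mul, ha, neg_add_cancel]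
    have e1 : ((m : ℤ) - 2) / 2 = (k : ℤ) - 1 := by omega
    have e2 : ((m : ℤ) - 1) / 2 = (k : ℤ) := by omega
    have e3 : ((m : ℤ) - 3) / 2 = (k : ℤ) - 1 := by omega
    have e4 : (m : ℤ) / 2 = (k : ℤ) := by omega
    rw [e1, e2, e3, e4, h0]
    simp

variable {M} {W : Type*} [Group W] (cs : CoxeterSystem M W)

/-- The geometric representation of a Coxeter group. -/
def geomRep : W →* ((B →₀ ℝ) ≃ₗ[ℝ] (B →₀ ℝ)) :=
  cs.lift ⟨simpleReflection M, simpleReflection_liftable M⟩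

/-- The root system `Φ`: all `w(α_i)`. -/
def roots : Set (B →₀ ℝ) := {α | ∃ (w : W) (i : B), α = geomRep cs w (simpleRoot i)}

/-- The positive roots: the roots with nonnegative coordinates in the simple roots. -/
def posRoots : Set (B →₀ ℝ) := {α ∈ roots cs | ∀ i, 0 ≤ α i}

/-- The negative roots. -/
def negRoots : Set (B →₀ ℝ) := {α ∈ roots cs | ∀ i, α i ≤ 0}

end Roots

/-! ### Twisted involutions and Kottwitz' characters -/

section Twisted

variable {B : Type*} {M : CoxeterMatrix B} {W : Type*} [Group W]

/-- An automorphism `w ↦ w^⋄` of `W` with `(w^⋄)^⋄ = w` that permutes the simple reflections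
according to a symmetry `perm` of the Coxeter diagram. -/
structure Diamond (cs : CoxeterSystem M W) where
  toMulEquiv : W ≃* W
  perm : Equiv.Perm B
  map_simple : ∀ i, toMulEquiv (cs.simple i) = cs.simple (perm i)
  matrix_perm : ∀ i j, M (perm i) (perm j) = M i j
  involutive : ∀ w, toMulEquiv (toMulEquiv w) = w

variable {cs : CoxeterSystem M W} (d : Diamond cs)

/-- The induced map `α ↦ α^⋄` on the space spanned by the roots; it permutes the simple roots. -/
def Diamond.onRoots : (B →₀ ℝ) ≃ₗ[ℝ] (B →₀ ℝ) := Finsupp.domLCongr d.perm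

/-- The compatibility `w^⋄(α^⋄) = w(α)^⋄`. -/
theorem Diamond.geomRep_onRoots (w : W) (v : B →₀ ℝ) :
    geomRep cs (d.toMulEquiv w) (d.onRoots v) = d.onRoots (geomRep cs w v) := by
  have hroot (i : B) : d.onRoots (simpleRoot i) = simpleRoot (d.perm i) := by
    simp [Diamond.onRoots, simpleRoot]
  have hco (i : B) (v : B →₀ ℝ) :
      simpleCoroot M (d.perm i) (d.onRoots v) = simpleCoroot M i v := by
    have : (simpleCoroot M (d.perm i)).comp d.onRoots.toLinearMap = simpleCoroot M i := by
      refine Finsupp.lhom_ext' fun j => LinearMap.ext_ring ?_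
      change simpleCoroot M (d.perm i) (d.onRoots (simpleRoot j)) =
        simpleCoroot M i (simpleRoot j)
      rw [hroot, simpleCoroot_simpleRoot, simpleCoroot_simpleRoot, d.matrix_perm]
    exact LinearMap.congr_fun this v
  have hsimple (i : B) : geomRep cs (cs.simple i) = simpleReflection M i :=
    cs.lift_apply_simple (simpleReflection_liftable M) i
  induction w using cs.simple_induction_left generalizing v with
  | one => simp
  | mul_simple_left w i ih =>
    rw [map_mul, map_mul, map_mul, LinearEquiv.mul_apply, LinearEquiv.mul_apply, ih, d.map_simple,
      hsimple, hsimple]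
    simp only [simpleReflection, Module.reflection_apply]
    rw [map_sub, map_smul, hroot, hco]

/-- `w` is a `⋄`-twisted involution. -/
def Diamond.IsTwistedInvolution (w : W) : Prop := d.toMulEquiv w = w⁻¹

/-- `w` and `w'` are `⋄`-conjugate. -/
def Diamond.Conj (w w' : W) : Prop := ∃ x : W, w' = d.toMulEquiv x * w * x⁻¹

/-- The `⋄`-conjugacy class of `w`. -/
def Diamond.conjClass (w : W) : Set W := {w' | d.Conj w w'}

/-- The `⋄`-centraliser `{x | x^⋄ w = w x}`. -/
def Diamond.centralizer (w : W) : Subgroup W where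
  carrier := {x | d.toMulEquiv x * w = w * x}
  mul_mem' := by
    intro a b ha hb
    simp only [Set.mem_ofPred_eq, map_mul] at *
    rw [mul_assoc, hb, ← mul_assoc, ha, mul_assoc]
  one_mem' := by simp
  inv_mem' := by
    intro a ha
    simp only [Set.mem_ofPred_eq, map_inv] at *
    rw [inv_mul_eq_iff_eq_mul, ← mul_assoc, ha, mul_assoc, mul_inv_cancel, mul_one]

/-- `Φ_w`, the set of roots `α` with `w(α) = -α^⋄`. -/
def Diamond.twistedRoots (w : W) : Set (B →₀ ℝ) :=
  {α ∈ roots cs | geomRep cs w α = -d.onRoots α}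

/-- `ε_w(x) = (-1)^k`, with `k` the number of positive `α ∈ Φ_w` such that `x(α)` is negative. -/
def Diamond.sign (w : W) (x : d.centralizer w) : ℤ :=
  (-1) ^ Set.ncard {α | α ∈ posRoots cs ∧ α ∈ d.twistedRoots w ∧
    geomRep cs (x : W) α ∈ negRoots cs}

/-- Kottwitz' character `Υ_w^⋄`, induced from `ε_w`. -/
def Diamond.upsilon [Fintype W] (w : W) : W → ℂ :=
  induced (d.centralizer w) (fun x => (d.sign w x : ℂ))

end Twisted

/-! ### The Hecke algebra and the Kazhdan-Lusztig basis -/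

section Hecke

variable {B : Type*} {M : CoxeterMatrix B} {W : Type*} [Group W] (cs : CoxeterSystem M W)

/-- The ring `ℤ[v, v⁻¹]`. -/
abbrev LaurentRing : Type := LaurentPolynomial ℤ

/-- The power `v ^ n`. -/
def vpow (n : ℤ) : LaurentRing := LaurentPolynomial.T n

/-- The generic Hecke algebra, as the free module with basis `T_w = single w 1`; the product is
`heckeMul`. -/
abbrev HeckeModule (W : Type*) : Type _ := W →₀ LaurentRing

/-- The basis element `T_w`. -/
def stdElt (w : W) : HeckeModule W := Finsupp.single w 1

open scoped Classical in
/-- Left multiplication by `T_s`, `s = s_i`: `T_s T_w` is `T_{sw}` if `ℓ(sw) > ℓ(w)` and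
`T_{sw} + (v - v⁻¹) T_w` otherwise. -/
def leftMulSimple (i : B) : Module.End LaurentRing (HeckeModule W) :=
  Finsupp.linearCombination LaurentRing (fun w =>
    if cs.length w < cs.length (cs.simple i * w) then stdElt (cs.simple i * w)
    else stdElt (cs.simple i * w) + (vpow 1 - vpow (-1)) • stdElt w)

/-- Left multiplication by `T_s⁻¹ = T_s - (v - v⁻¹)`. -/
def leftMulSimpleInv (i : B) : Module.End LaurentRing (HeckeModule W) :=
  leftMulSimple cs i - (vpow 1 - vpow (-1)) • LinearMap.id

/-- A chosen reduced word of `w`. -/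
def redWord (w : W) : List B := Classical.choose (cs.exists_isReduced w)

/-- Left multiplication by `T_w = T_{s_1} ⋯ T_{s_k}`, where `w = s_1 ⋯ s_k` is reduced. -/
def leftMulStd (w : W) : Module.End LaurentRing (HeckeModule W) :=
  ((redWord cs w).map (leftMulSimple cs)).prod

/-- The multiplication of the Hecke algebra. -/
def heckeMul : HeckeModule W →ₗ[LaurentRing] HeckeModule W →ₗ[LaurentRing] HeckeModule W :=
  Finsupp.linearCombination LaurentRing (leftMulStd cs)

/-- The element `T_{w⁻¹}⁻¹ = T_{s_1}⁻¹ ⋯ T_{s_k}⁻¹`, where `w = s_1 ⋯ s_k` is reduced. -/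
def invStd (w : W) : HeckeModule W :=
  ((redWord cs w).map (leftMulSimpleInv cs)).prod (stdElt 1)

/-- The bar involution: `v ↦ v⁻¹`, `T_w ↦ T_{w⁻¹}⁻¹`. -/
def heckeBar (h : HeckeModule W) : HeckeModule W :=
  h.sum (fun w a => LaurentPolynomial.invert a • invStd cs w)

/-- The Bruhat-Chevalley order. -/
def bruhatLE (y w : W) : Prop :=
  Relation.ReflTransGen
    (fun a b => (∃ t, cs.IsReflection t ∧ b = a * t) ∧ cs.length a < cs.length b) y w

/-- The strict Bruhat-Chevalley order. -/
def bruhatLT (y w : W) : Prop := bruhatLE cs y w ∧ y ≠ w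

theorem bruhatLT_length {y w : W} (h : bruhatLT cs y w) : cs.length y < cs.length w := by
  obtain ⟨h, hne⟩ := h
  have : y = w ∨ cs.length y < cs.length w := by
    clear hne
    induction h with
    | refl => exact Or.inl rfl
    | tail _ h2 ih =>
      rcases ih with rfl | ih
      · exact Or.inr h2.2
      · exact Or.inr (ih.trans h2.2)
  exact this.resolve_left hne

/-- The element
`∑_y (-1)^{ℓ(w)+ℓ(y)} v^{ℓ(w)-ℓ(y)} P_y(q⁻¹) T_y`, `q = v²`, for a family of polynomials `P_y` in
the variable `q`. -/
def klSum [Fintype W] (w : W) (P : W → Polynomial ℤ) : HeckeModule W :=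
  ∑ y, ((-1) ^ (cs.length w + cs.length y) *
    vpow ((cs.length w : ℤ) - (cs.length y : ℤ)) *
      Polynomial.aeval (vpow (-2)) (P y)) • stdElt y

/-- The defining property of the family `y ↦ P_{y,w}` of Kazhdan-Lusztig polynomials:
`P_{w,w} = 1`, `P_{y,w} = 0` unless `y ≤ w`, `deg P_{y,w} ≤ (ℓ(w) - ℓ(y) - 1) / 2` for `y < w`,
and the corresponding element of the Hecke algebra is fixed by the bar involution. By Kazhdan and
Lusztig there is exactly one such family. -/
def IsKLFamily [Fintype W] (w : W) (P : W → Polynomial ℤ) : Prop :=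
  P w = 1 ∧ (∀ y, ¬ bruhatLE cs y w → P y = 0) ∧
  (∀ y, bruhatLT cs y w → 2 * (P y).natDegree + 1 + cs.length y ≤ cs.length w) ∧
  heckeBar cs (klSum cs w P) = klSum cs w P

open scoped Classical in
/-- The Kazhdan-Lusztig polynomial `P_{y,w}`. -/
def klPoly [Fintype W] (y w : W) : Polynomial ℤ :=
  if h : ∃ P, IsKLFamily cs w P then Classical.choose h y else if y = w then 1 else 0

/-- The Kazhdan-Lusztig basis element `C_w`. -/
def klElt [Fintype W] (w : W) : HeckeModule W := klSum cs w (fun y => klPoly cs y w)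

theorem klPoly_self [Fintype W] (w : W) : klPoly cs w w = 1 := by
  unfold klPoly
  split_ifs with h
  · exact (Classical.choose_spec h).1
  all_goals simp_all

theorem klPoly_eq_zero [Fintype W] {y w : W} (h : ¬ bruhatLE cs y w) : klPoly cs y w = 0 := by
  unfold klPoly
  split_ifs with h' h''
  · exact (Classical.choose_spec h').2.1 y h
  · exact absurd (h'' ▸ Relation.ReflTransGen.refl) h
  · rfl

theorem klElt_apply [Fintype W] (y w : W) : klElt cs w y =
    (-1) ^ (cs.length w + cs.length y) * vpow ((cs.length w : ℤ) - (cs.length y : ℤ)) *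
      Polynomial.aeval (vpow (-2)) (klPoly cs y w) := by
  classical
  simp only [klElt, klSum, stdElt, Finsupp.coe_finsetSum, Finset.sum_apply, Finsupp.smul_apply,
    Finsupp.single_apply, smul_eq_mul, mul_ite, mul_one, mul_zero]
  rw [Finset.sum_ite_eq' Finset.univ y]
  simp

/-- The elements `C_w` form a basis, by unitriangularity. -/
theorem klElt_isBasis [Fintype W] : LinearIndependent LaurentRing (klElt cs) ∧
    Submodule.span LaurentRing (Set.range (klElt cs)) = ⊤ := by
  classical
  rw [Module.Basis.is_basis_iff_det Finsupp.basisSingleOne, Module.Basis.det_apply]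
  have hent (y w : W) :
      (Finsupp.basisSingleOne (R := LaurentRing)).toMatrix (klElt cs) y w = klElt cs w y := by
    simp [Module.Basis.toMatrix_apply]
  have hzero (y w : W) (h : klElt cs w y ≠ 0) : y = w ∨ cs.length y < cs.length w := by
    by_contra! hc
    refine h ?_
    rw [klElt_apply, klPoly_eq_zero, map_zero, mul_zero]
    exact fun hb => absurd (bruhatLT_length cs ⟨hb, hc.1⟩) (not_lt.mpr hc.2)
  have htri : Matrix.BlockTriangular
      ((Finsupp.basisSingleOne (R := LaurentRing)).toMatrix (klElt cs)) cs.length := by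
    intro y w hlt
    rw [hent]
    by_contra h
    rcases hzero y w h with rfl | h
    · exact lt_irrefl _ hlt
    · exact lt_asymm h hlt
  rw [htri.det]
  have hblock (a : ℕ) : Matrix.toSquareBlock
      ((Finsupp.basisSingleOne (R := LaurentRing)).toMatrix (klElt cs)) cs.length a = 1 := by
    refine Matrix.ext fun ⟨y, hy⟩ ⟨w, hw⟩ => ?_
    change (Finsupp.basisSingleOne (R := LaurentRing)).toMatrix (klElt cs) y w = _
    rw [hent]
    by_cases h : y = w
    · subst h
      rw [Matrix.one_apply_eq, klElt_apply, klPoly_self]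
      simp [vpow, ← two_mul]
    · rw [Matrix.one_apply_ne (by simpa using h)]
      by_contra h0
      rcases hzero y w h0 with h1 | h1
      · exact h h1
      · rw [hy, hw] at h1
        exact lt_irrefl _ h1
  simp [hblock]

/-- The Kazhdan-Lusztig basis `(C_w)`. -/
def klBasis [Fintype W] : Module.Basis W LaurentRing (HeckeModule W) :=
  Module.Basis.mk (klElt_isBasis cs).1 (klElt_isBasis cs).2.ge

/-- The structure constants `h_{x,y,z}`, given by `C_x C_y = ∑_z h_{x,y,z} C_z`. -/
def klStructure [Fintype W] (x y z : W) : LaurentRing :=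
  (klBasis cs).repr (heckeMul cs (klElt cs x) (klElt cs y)) z

/-! ### Left cells and their characters -/

/-- `y ≺ w`: `y < w` and `deg P_{y,w}` has the maximal possible value `(ℓ(w) - ℓ(y) - 1) / 2`. -/
def klPrec [Fintype W] (y w : W) : Prop :=
  bruhatLT cs y w ∧ 2 * (klPoly cs y w).natDegree + 1 + cs.length y = cs.length w

/-- An elementary step of the left preorder: `y` and `w` are joined by an edge of the `W`-graph and
the left descent set of `y` is not contained in that of `w`. -/
def leftStep [Fintype W] (y w : W) : Prop :=
  (klPrec cs y w ∨ klPrec cs w y) ∧ ∃ i, cs.IsLeftDescent y i ∧ ¬ cs.IsLeftDescent w i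

/-- The Kazhdan-Lusztig left preorder `y ≤_L w`. -/
def leftLE [Fintype W] (y w : W) : Prop := Relation.ReflTransGen (leftStep cs) y w

/-- The equivalence relation `y ∼_L w`. -/
def leftEquiv [Fintype W] (y w : W) : Prop := leftLE cs y w ∧ leftLE cs w y

/-- `Γ` is a left cell of `W`. -/
def IsLeftCell [Fintype W] (Γ : Set W) : Prop := ∃ w, Γ = {y | leftEquiv cs y w}

open scoped Classical in
/-- The action of the Hecke algebra on the free module `[Γ]_A` with basis `(e_x)_{x ∈ Γ}`, given by
`C_x e_y = ∑_{z ∈ Γ} h_{x,y,z} e_z`. -/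
def cellAction [Fintype W] (Γ : Set W) :
    HeckeModule W →ₗ[LaurentRing] Module.End LaurentRing (Γ →₀ LaurentRing) :=
  (klBasis cs).constr LaurentRing (fun x =>
    Finsupp.linearCombination LaurentRing (fun y : Γ =>
      ∑ z : Γ, klStructure cs x y z • Finsupp.single z 1))

/-- The specialisation `ℤ[v, v⁻¹] → ℚ`, `v ↦ 1`. -/
def specOne : LaurentRing →+* ℚ := LaurentPolynomial.eval₂ (Int.castRingHom ℚ) 1

open scoped Classical in
/-- The matrix of `w ∈ W` acting on the `ℚ[W]`-module `[Γ]_1`, that is, of `T_w` acting on `[Γ]_A`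
with `v` specialised to `1`. -/
def cellMatrix [Fintype W] (Γ : Set W) (w : W) : Matrix Γ Γ ℚ :=
  (LinearMap.toMatrix Finsupp.basisSingleOne Finsupp.basisSingleOne
    (cellAction cs Γ (stdElt w))).map specOne

open scoped Classical in
/-- The character of `[Γ]_1`. -/
def cellChar [Fintype W] (Γ : Set W) : W → ℂ := fun w => ((cellMatrix cs Γ w).trace : ℂ)

/-- Kottwitz' conjecture for `(W, ⋄)`: `⟨Υ_w^⋄, [Γ]_1⟩ = |C ∩ Γ|` for every `⋄`-twisted
involution `w` with `⋄`-conjugacy class `C` and every left cell `Γ`. -/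
def KottwitzConjecture [Fintype W] (d : Diamond cs) : Prop :=
  ∀ w, d.IsTwistedInvolution w → ∀ Γ, IsLeftCell cs Γ →
    classInner (d.upsilon w) (cellChar cs Γ) = ((d.conjClass w ∩ Γ).ncard : ℂ)

end Hecke

/-! ### Dihedral groups -/

section Dihedral

variable {M : CoxeterMatrix (Fin 2)} {W : Type*} [Group W] (cs : CoxeterSystem M W)

/-- The alternating product `s_i s_j s_i ⋯` with `k` factors. -/
def altProd (i j : Fin 2) : ℕ → W
  | 0 => 1
  | k + 1 => cs.simple i * altProd j i k

/-- The product `1_k = s_1 s_2 s_1 ⋯` with `k` factors. -/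
def word1 (k : ℕ) : W := altProd cs 0 1 k

/-- The product `2_k = s_2 s_1 s_2 ⋯` with `k` factors. -/
def word2 (k : ℕ) : W := altProd cs 1 0 k

/-- `{1_1, 2_2, 1_3, …, 1_{2m-1}}`. -/
def cell1 (m : ℕ) : Set W :=
  {x | ∃ k, 1 ≤ k ∧ k ≤ 2 * m - 1 ∧ x = if Odd k then word1 cs k else word2 cs k}

/-- `{2_1, 1_2, 2_3, …, 2_{2m-1}}`. -/
def cell2 (m : ℕ) : Set W :=
  {x | ∃ k, 1 ≤ k ∧ k ≤ 2 * m - 1 ∧ x = if Odd k then word2 cs k else word1 cs k}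

end Dihedral

end

end TwistedInv

/-!
Both alternating products `s_i s_j s_i ⋯` and `s_j s_i s_j ⋯` are visited by one walk indexed by
`ℤ`, starting at `1` and closing up after `2n` steps. A product of group elements adds or subtracts
their indices, so that twisted conjugacy, centralizers and induced characters become divisibility
questions; in particular the twisted class of `1` consists of the rotations of even index.

For `x < y` a dihedral group has `P_{x,y} = 1`: the signed sum over a Bruhat interval satisfies the
recursion for `C_s C_w` and is fixed by the bar involution, and such an element is unique. Hence
the left cells are the fibres of the right descent set. At `v = 1`, the elements `C_y` such that `s`
is a right descent of `y` span the functions on `W` that change sign under right multiplication by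
`s`. The trace of `w` on this space is `|W|/2` if `w = 1` and `0` otherwise, minus half the number
of solutions of `x s = w x`; removing the sign representation carried by the longest element
leaves the character of the cell.

Finally `Υ_1` is induced from `{1, w₀}` with `w₀` central, so that
`⟨Υ_1, φ⟩ = (φ(1) + φ(w₀)) / 2` for real-valued `φ`, which is compared with the number of elements
of the twisted class in each cell.
-/

namespace TwistedInv

noncomputable section

section Walk

variable {M : CoxeterMatrix (Fin 2)} {W : Type*} [Group W] (cs : CoxeterSystem M W)

/-- The element at signed distance `k` from `1` on the two-generator Cayley graph
`…, s_j s_i, s_j, 1, s_i, s_i s_j, …`. It replaces the two families of alternating products by one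
family indexed by `ℤ`, in which multiplication is addition or subtraction of indices. -/
def walk (i j : Fin 2) (k : ℤ) : W :=
  if Even k then (cs.simple i * cs.simple j) ^ (k / 2)
  else (cs.simple i * cs.simple j) ^ (k / 2) * cs.simple i

variable (i j : Fin 2)

theorem walk_two_mul (a : ℤ) : walk cs i j (2 * a) = (cs.simple i * cs.simple j) ^ a := by
  simp [walk]

theorem walk_two_mul_add_one (a : ℤ) :
    walk cs i j (2 * a + 1) = (cs.simple i * cs.simple j) ^ a * cs.simple i := by
  have half : (2 * a + 1) / 2 = a := by omega
  rw [walk, if_neg (by simp), half]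

@[simp] theorem walk_zero : walk cs i j 0 = 1 := by
  simpa using walk_two_mul cs i j 0

@[simp] theorem walk_one : walk cs i j 1 = cs.simple i := by
  simpa using walk_two_mul_add_one cs i j 0

@[simp] theorem walk_neg_one : walk cs i j (-1) = cs.simple j := by
  simpa using walk_two_mul_add_one cs i j (-1)

theorem simple_mul_zpow (a : ℤ) :
    cs.simple i * (cs.simple i * cs.simple j) ^ a =
      (cs.simple i * cs.simple j) ^ (-a) * cs.simple i := by
  have inverts : SemiconjBy (cs.simple i) (cs.simple i * cs.simple j)
      (cs.simple i * cs.simple j)⁻¹ := by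
    simp [SemiconjBy, mul_assoc]
  rw [zpow_neg, ← inv_zpow]
  exact (inverts.zpow_right a).eq

theorem walk_mul_of_even {a : ℤ} (ha : Even a) (b : ℤ) :
    walk cs i j a * walk cs i j b = walk cs i j (a + b) := by
  obtain ⟨a, rfl⟩ := ha.exists_two_nsmul
  rw [nsmul_eq_mul, Nat.cast_ofNat]
  obtain ⟨b, rfl | rfl⟩ := Int.even_or_odd' b
  · rw [← mul_add, walk_two_mul, walk_two_mul, walk_two_mul, zpow_add]
  · rw [← add_assoc, ← mul_add, walk_two_mul, walk_two_mul_add_one, walk_two_mul_add_one, zpow_add,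
      mul_assoc]

theorem walk_mul_of_odd {a : ℤ} (ha : Odd a) (b : ℤ) :
    walk cs i j a * walk cs i j b = walk cs i j (a - b) := by
  obtain ⟨a, rfl⟩ := ha
  obtain ⟨b, rfl | rfl⟩ := Int.even_or_odd' b
  · rw [show 2 * a + 1 - 2 * b = 2 * (a - b) + 1 by ring, walk_two_mul, walk_two_mul_add_one,
      walk_two_mul_add_one, mul_assoc, simple_mul_zpow, ← mul_assoc, ← zpow_add, sub_eq_add_neg]
  · rw [show 2 * a + 1 - (2 * b + 1) = 2 * (a - b) by ring, walk_two_mul, walk_two_mul_add_one,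
      walk_two_mul_add_one, mul_assoc, ← mul_assoc (cs.simple i), simple_mul_zpow, mul_assoc,
      cs.simple_mul_simple_self, mul_one, ← zpow_add, sub_eq_add_neg]

theorem walk_inv_of_even {a : ℤ} (ha : Even a) : (walk cs i j a)⁻¹ = walk cs i j (-a) := by
  rw [inv_eq_iff_mul_eq_one, walk_mul_of_even cs i j ha, add_neg_cancel, walk_zero]

theorem walk_inv_of_odd {a : ℤ} (ha : Odd a) : (walk cs i j a)⁻¹ = walk cs i j a := by
  rw [inv_eq_iff_mul_eq_one, walk_mul_of_odd cs i j ha, sub_self, walk_zero]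

theorem simple_left_mul_walk (k : ℤ) : cs.simple i * walk cs i j k = walk cs i j (1 - k) := by
  rw [← walk_mul_of_odd cs i j odd_one, walk_one]

theorem simple_right_mul_walk (k : ℤ) : cs.simple j * walk cs i j k = walk cs i j (-1 - k) := by
  rw [← walk_mul_of_odd cs i j (by decide), walk_neg_one]

theorem walk_swap (k : ℤ) : walk cs j i k = walk cs i j (-k) := by
  have rotation (a : ℤ) :
      (cs.simple j * cs.simple i) ^ a = (cs.simple i * cs.simple j) ^ (-a) := by
    rw [zpow_neg, ← inv_zpow, mul_inv_rev, cs.inv_simple, cs.inv_simple]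
  obtain ⟨a, rfl | rfl⟩ := Int.even_or_odd' k
  · rw [walk_two_mul, rotation, ← mul_neg, walk_two_mul]
  · rw [show -(2 * a + 1) = 2 * (-a - 1) + 1 by ring, walk_two_mul_add_one, walk_two_mul_add_one,
      rotation, zpow_sub, zpow_one, mul_inv_rev, cs.inv_simple, cs.inv_simple, mul_assoc, mul_assoc,
      cs.simple_mul_simple_self, mul_one]

theorem altProd_eq_walk (k : ℕ) : altProd cs i j k = walk cs i j k := by
  induction k generalizing i j with
  | zero => simp [altProd]
  | succ k ih =>
    rw [altProd, ih, walk_swap, simple_left_mul_walk]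
    congr 1
    push_cast
    ring

theorem lengthParity_walk (k : ℤ) :
    cs.lengthParity (walk cs i j k) = Multiplicative.ofAdd (k : ZMod 2) := by
  have rotation (a : ℤ) : cs.lengthParity ((cs.simple i * cs.simple j) ^ a) = 1 := by
    rw [map_zpow, map_mul, cs.lengthParity_simple, cs.lengthParity_simple, ← ofAdd_add,
      CharTwo.add_self_eq_zero, ofAdd_zero, one_zpow]
  have two_eq_zero : (2 : ZMod 2) = 0 := rfl
  obtain ⟨a, rfl | rfl⟩ := Int.even_or_odd' k
  · rw [walk_two_mul, rotation]
    simp [two_eq_zero]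
  · rw [walk_two_mul_add_one, map_mul, rotation, cs.lengthParity_simple]
    simp [two_eq_zero]

theorem even_length_walk_iff (k : ℤ) : Even (cs.length (walk cs i j k)) ↔ Even k := by
  have parity := lengthParity_walk cs i j k
  rw [cs.lengthParity_eq_ofAdd_length, Multiplicative.ofAdd.apply_eq_iff_eq] at parity
  rw [← ZMod.natCast_eq_zero_iff_even, parity, ZMod.intCast_zmod_eq_zero_iff_dvd, even_iff_two_dvd,
    Nat.cast_ofNat]

theorem neg_one_pow_length_walk {R : Type*} [Ring R] (k : ℤ) :
    (-1 : R) ^ cs.length (walk cs i j k) = if Even k then 1 else -1 := by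
  split_ifs with hk
  · exact ((even_length_walk_iff cs i j k).mpr hk).neg_one_pow
  · exact (Nat.not_even_iff_odd.mp ((even_length_walk_iff cs i j k).not.mpr hk)).neg_one_pow

variable {i j} (hij : i ≠ j)

section Generators

include hij

theorem eq_or_eq_of_ne (b : Fin 2) : b = i ∨ b = j := by omega

theorem exists_walk_eq_wordProd (ω : List (Fin 2)) :
    ∃ k : ℤ, k.natAbs ≤ ω.length ∧ walk cs i j k = cs.wordProd ω := by
  induction ω with
  | nil => exact ⟨0, by simp⟩
  | cons b ω ih =>
    obtain ⟨k, hk, hω⟩ := ih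
    rw [cs.wordProd_cons, ← hω, List.length_cons]
    rcases eq_or_eq_of_ne hij b with rfl | rfl
    · exact ⟨1 - k, by omega, (simple_left_mul_walk cs _ _ k).symm⟩
    · exact ⟨-1 - k, by omega, (simple_right_mul_walk cs _ _ k).symm⟩

theorem exists_walk_natAbs_le_length (w : W) :
    ∃ k : ℤ, k.natAbs ≤ cs.length w ∧ walk cs i j k = w := by
  obtain ⟨ω, hω, rfl⟩ := cs.exists_isReduced w
  simpa only [hω.eq] using exists_walk_eq_wordProd cs hij ω

end Generators

theorem length_walk_le (k : ℤ) : cs.length (walk cs i j k) ≤ k.natAbs := by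
  have nonneg (n : ℕ) (i j : Fin 2) : cs.length (walk cs i j n) ≤ n := by
    induction n generalizing i j with
    | zero => simp
    | succ n ih =>
      rw [← altProd_eq_walk, altProd, altProd_eq_walk, add_comm n]
      exact (cs.length_mul_le _ _).trans (add_le_add (cs.length_simple i).le (ih j i))
  rcases Int.natAbs_eq k with h | h
  · simpa only [← h] using nonneg k.natAbs i j
  · simpa only [walk_swap cs i j, ← h] using nonneg k.natAbs j i

end Walk

section DihedralGroup

variable {M : CoxeterMatrix (Fin 2)} {W : Type*} [Group W] (cs : CoxeterSystem M W)
  {i j : Fin 2} (hij : i ≠ j) {n : ℕ} (hM : M i j = n)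
include hij hM

theorem isLiftable_of_mul_pow_eq_one {G : Type*} [Monoid G] {f : Fin 2 → G}
    (hf : ∀ b, f b * f b = 1) (hpow : (f i * f j) ^ n = 1) : M.IsLiftable f := by
  have inverse : (f i * f j) * (f j * f i) = 1 := by
    rw [mul_assoc, ← mul_assoc (f j), hf, one_mul, hf]
  have commute : Commute (f i * f j) (f j * f i) := by
    rw [Commute, SemiconjBy, inverse, mul_assoc, ← mul_assoc (f i), hf, one_mul, hf]
  intro a b
  rcases eq_or_eq_of_ne hij a with rfl | rfl <;> rcases eq_or_eq_of_ne hij b with rfl | rfl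
  · rw [M.diagonal, pow_one, hf]
  · rw [hM, hpow]
  · rw [M.symmetric, hM]
    simpa only [inverse, one_pow, hpow, one_mul, eq_comm] using commute.mul_pow n
  · rw [M.diagonal, pow_one, hf]

theorem orderOf_simple_mul_simple : orderOf (cs.simple i * cs.simple j) = n := by
  let reflection (b : Fin 2) : DihedralGroup n := .sr (if b = i then 0 else 1)
  have product : reflection i * reflection j = .r 1 := by simp [reflection, hij.symm]
  have liftable : M.IsLiftable reflection :=
    isLiftable_of_mul_pow_eq_one hij hM (fun b => DihedralGroup.sr_mul_self _)
      (by rw [product, DihedralGroup.r_one_pow_n])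
  refine Nat.dvd_antisymm (orderOf_dvd_of_pow_eq_one (hM ▸ cs.simple_mul_simple_pow i j)) ?_
  have divides := orderOf_map_dvd (cs.lift ⟨reflection, liftable⟩) (cs.simple i * cs.simple j)
  rwa [map_mul, cs.lift_apply_simple liftable, cs.lift_apply_simple liftable, product,
    DihedralGroup.orderOf_r_one] at divides

theorem walk_eq_one_iff {k : ℤ} : walk cs i j k = 1 ↔ (2 * n : ℤ) ∣ k := by
  obtain ⟨a, rfl | rfl⟩ := Int.even_or_odd' k
  · rw [walk_two_mul, ← orderOf_dvd_iff_zpow_eq_one, orderOf_simple_mul_simple cs hij hM]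
    exact (mul_dvd_mul_iff_left two_ne_zero).symm
  · refine iff_of_false (fun h => ?_) (fun h => ?_)
    · exact Int.not_even_iff_odd.mpr ⟨a, rfl⟩ ((even_length_walk_iff cs i j _).mp (by simp [h]))
    · have := dvd_of_mul_right_dvd h
      omega

theorem walk_eq_walk_iff {a b : ℤ} :
    walk cs i j a = walk cs i j b ↔ (2 * n : ℤ) ∣ a - b := by
  by_cases parity : Even a ↔ Even b
  · rw [← mul_inv_eq_one, ← walk_eq_one_iff cs hij hM]
    rcases Int.even_or_odd b with hb | hb
    · rw [walk_inv_of_even cs i j hb, walk_mul_of_even cs i j (parity.mpr hb), sub_eq_add_neg]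
    · have ha : Odd a := by grind
      rw [walk_inv_of_odd cs i j hb, walk_mul_of_odd cs i j ha]
  · refine iff_of_false (fun h => parity ?_) (fun h => parity ?_)
    · rw [← even_length_walk_iff cs i j, h, even_length_walk_iff]
    · exact Int.even_sub.mp (even_iff_two_dvd.mpr (dvd_of_mul_right_dvd h))

theorem walk_eq_walk_iff_of_bounds {a b : ℤ} (ha : -n < a ∧ a ≤ n) (hb : -n < b ∧ b ≤ n) :
    walk cs i j a = walk cs i j b ↔ a = b := by
  refine ⟨fun h => ?_, congrArg _⟩
  have bound : |a - b| < 2 * n := abs_lt.mpr (by omega)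
  have := Int.eq_zero_of_abs_lt_dvd ((walk_eq_walk_iff cs hij hM).mp h) bound
  omega

theorem length_walk {k : ℤ} (hk : k.natAbs ≤ n) : cs.length (walk cs i j k) = k.natAbs := by
  refine le_antisymm (length_walk_le cs k) ?_
  obtain ⟨l, hl, heq⟩ := exists_walk_natAbs_le_length cs hij (walk cs i j k)
  refine le_trans ?_ hl
  obtain ⟨c, hc⟩ := (walk_eq_walk_iff cs hij hM).mp heq
  rw [mul_assoc] at hc
  rcases lt_trichotomy c 0 with hneg | rfl | hpos
  · have : (n : ℤ) * c ≤ -n := by nlinarith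
    omega
  · omega
  · have : (n : ℤ) ≤ n * c := by nlinarith
    omega

theorem exists_walk_eq (hn : 0 < n) (w : W) : ∃ k : ℤ, (-n < k ∧ k ≤ n) ∧ walk cs i j k = w := by
  obtain ⟨l, -, rfl⟩ := exists_walk_natAbs_le_length cs hij w
  have period : (0 : ℤ) < 2 * n := by omega
  obtain ⟨c, ⟨lower, upper⟩, -⟩ := existsUnique_add_zsmul_mem_Ioc period l (-n)
  refine ⟨l + c • (2 * n : ℤ), ⟨lower, by omega⟩, ?_⟩
  rw [walk_eq_walk_iff cs hij hM]
  exact ⟨c, by rw [smul_eq_mul]; ring⟩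

theorem walk_swap_eq : walk cs j i n = walk cs i j n := by
  rw [walk_swap cs i j, walk_eq_walk_iff cs hij hM]
  exact ⟨-1, by ring⟩

theorem length_le (hn : 0 < n) (w : W) : cs.length w ≤ n := by
  obtain ⟨k, hk, rfl⟩ := exists_walk_eq cs hij hM hn w
  exact (length_walk_le cs k).trans (by omega)

theorem isLeftDescent_walk_iff {k : ℤ} (hk : -n < k ∧ k ≤ n) :
    cs.IsLeftDescent (walk cs i j k) i ↔ 0 < k := by
  rw [CoxeterSystem.IsLeftDescent, simple_left_mul_walk, length_walk cs hij hM (by omega),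
    length_walk cs hij hM (by omega)]
  omega

theorem walk_mem_pair_iff (k : ℤ) :
    walk cs i j k ∈ ({1, walk cs i j n} : Set W) ↔ (n : ℤ) ∣ k := by
  rw [Set.mem_insert_iff, Set.mem_singleton_iff, walk_eq_one_iff cs hij hM,
    walk_eq_walk_iff cs hij hM]
  constructor
  · rintro (⟨c, hc⟩ | ⟨c, hc⟩)
    · exact ⟨2 * c, by linarith⟩
    · exact ⟨2 * c + 1, by linarith⟩
  · rintro ⟨c, rfl⟩
    obtain ⟨c, rfl | rfl⟩ := Int.even_or_odd' c
    · exact .inl ⟨c, by ring⟩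
    · exact .inr ⟨c, by ring⟩

theorem walk_ne_one (hn : 0 < n) : walk cs i j n ≠ 1 := by
  rw [Ne, walk_eq_one_iff cs hij hM]
  intro h
  have := Int.le_of_dvd (by omega) h
  omega

theorem walk_mem_center (hn : Even n) : walk cs i j n ∈ Subgroup.center W := by
  rw [Subgroup.mem_center_iff]
  intro x
  obtain ⟨k, -, rfl⟩ := exists_walk_natAbs_le_length cs hij x
  have hn' : Even (n : ℤ) := by exact_mod_cast hn
  rw [walk_mul_of_even cs i j hn']
  rcases Int.even_or_odd k with hk | hk
  · rw [walk_mul_of_even cs i j hk, add_comm]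
  · rw [walk_mul_of_odd cs i j hk, walk_eq_walk_iff cs hij hM]
    exact ⟨-1, by ring⟩

include cs in
theorem card_eq [Fintype W] (hn : 0 < n) : Fintype.card W = 2 * n := by
  classical
  have enumeration : Finset.univ = (Finset.Ioc (-n : ℤ) n).image (walk cs i j) := by
    ext w
    obtain ⟨k, hk, rfl⟩ := exists_walk_eq cs hij hM hn w
    simpa using ⟨k, hk, rfl⟩
  rw [← Finset.card_univ, enumeration, Finset.card_image_of_injOn, Int.card_Ioc]
  · omega
  · exact fun a ha b hb => (walk_eq_walk_iff_of_bounds cs hij hM (by simpa using ha)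
      (by simpa using hb)).mp

end DihedralGroup

section TwistedClasses

variable {B : Type*} {M : CoxeterMatrix B} {W : Type*} [Group W] {cs : CoxeterSystem M W}
  (d : Diamond cs)

theorem Diamond.conj_refl (w : W) : d.Conj w w := ⟨1, by simp⟩

theorem Diamond.conjClass_eq {w w' : W} (h : w' ∈ d.conjClass w) :
    d.conjClass w' = d.conjClass w := by
  obtain ⟨x, rfl⟩ := h
  ext u
  constructor
  · rintro ⟨y, rfl⟩
    exact ⟨y * x, by simp [mul_assoc]⟩
  · rintro ⟨y, rfl⟩
    exact ⟨y * x⁻¹, by simp [mul_assoc]⟩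

theorem Diamond.coe_centralizer_one : (d.centralizer 1 : Set W) = {x | d.toMulEquiv x = x} := by
  ext x
  change d.toMulEquiv x * 1 = 1 * x ↔ d.toMulEquiv x = x
  rw [mul_one, one_mul]

theorem Diamond.sign_eq_one {w : W} (hw : d.twistedRoots w = ∅) (x : d.centralizer w) :
    d.sign w x = 1 := by
  simp [Diamond.sign, hw]

theorem Diamond.upsilon_eq_induced [Fintype W] {w : W} (hw : d.twistedRoots w = ∅) :
    d.upsilon w = induced (d.centralizer w) fun _ => 1 := by
  simp only [Diamond.upsilon, d.sign_eq_one hw, Int.cast_one]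

end TwistedClasses

section CentralInduction

variable {G : Type*} [Group G] [Fintype G] {H : Subgroup G} (hH : H ≤ Subgroup.center G)
include hH

open scoped Classical in
theorem induced_one_of_le_center (g : G) :
    induced H (fun _ => 1) g = if g ∈ H then (H.index : ℂ) else 0 := by
  have conj_mem (x : G) : x⁻¹ * g * x ∈ H ↔ g ∈ H := by
    constructor
    · intro h
      have commutes := Subgroup.mem_center_iff.mp (hH h) x
      rw [← mul_assoc, ← mul_assoc, mul_inv_cancel, one_mul, mul_left_inj] at commutes
      rwa [commutes]
    · intro h
      rwa [mul_assoc, ← Subgroup.mem_center_iff.mp (hH h) x, inv_mul_cancel_left]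
  have card_ne : (Nat.card H : ℂ) ≠ 0 := Nat.cast_ne_zero.mpr Nat.card_pos.ne'
  simp only [induced, conj_mem, dite_eq_ite]
  split_ifs
  · rw [Finset.sum_const, Finset.card_univ, nsmul_one, ← Nat.card_eq_fintype_card,
      ← H.card_mul_index, Nat.cast_mul, inv_mul_cancel_left₀ card_ne]
  · rw [Finset.sum_const_zero, mul_zero]

end CentralInduction

section DihedralTwist

variable {M : CoxeterMatrix (Fin 2)} {W : Type*} [Group W] {cs : CoxeterSystem M W}
  (d : Diamond cs) {i j : Fin 2} (hd : d.toMulEquiv (cs.simple i) = cs.simple j)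

section
include hd

theorem Diamond.map_walk (k : ℤ) : d.toMulEquiv (walk cs i j k) = walk cs i j (-k) := by
  have hd' : d.toMulEquiv (cs.simple j) = cs.simple i := by rw [← hd, d.involutive]
  rw [← walk_swap, walk, walk]
  split_ifs <;> simp [hd, hd']

theorem Diamond.map_walk_mul_inv (k : ℤ) :
    d.toMulEquiv (walk cs i j k) * (walk cs i j k)⁻¹ = walk cs i j (-(2 * k)) := by
  rw [d.map_walk hd]
  rcases Int.even_or_odd k with hk | hk
  · rw [walk_inv_of_even cs i j hk, walk_mul_of_even cs i j hk.neg]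
    ring_nf
  · rw [walk_inv_of_odd cs i j hk, walk_mul_of_odd cs i j hk.neg]
    ring_nf

theorem Diamond.mem_conjClass_one_iff (hij : i ≠ j) (w : W) :
    w ∈ d.conjClass 1 ↔ ∃ a : ℤ, walk cs i j (2 * a) = w := by
  constructor
  · rintro ⟨x, rfl⟩
    obtain ⟨a, -, rfl⟩ := exists_walk_natAbs_le_length cs hij x
    exact ⟨-a, by rw [mul_one, d.map_walk_mul_inv hd, mul_neg]⟩
  · rintro ⟨a, rfl⟩
    exact ⟨walk cs i j (-a), by rw [mul_one, d.map_walk_mul_inv hd, mul_neg, neg_neg]⟩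

variable (hij : i ≠ j) {n : ℕ} (hM : M i j = n) (hn : Even n)
include hij hM hn

theorem Diamond.isTwistedInvolution_iff (w : W) :
    d.IsTwistedInvolution w ↔ w ∈ d.conjClass 1 := by
  rw [d.mem_conjClass_one_iff hd hij]
  constructor
  · intro h
    obtain ⟨k, -, rfl⟩ := exists_walk_natAbs_le_length cs hij w
    obtain ⟨a, rfl | hk⟩ := Int.even_or_odd' k
    · exact ⟨a, rfl⟩
    · rw [Diamond.IsTwistedInvolution, d.map_walk hd, walk_inv_of_odd cs i j ⟨a, hk⟩,
        walk_eq_walk_iff cs hij hM] at h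
      obtain ⟨b, rfl⟩ := hn
      obtain ⟨c, hc⟩ := h
      push_cast at hc
      have : k = 2 * (-(b * c)) := by linarith
      omega
  · rintro ⟨a, rfl⟩
    rw [Diamond.IsTwistedInvolution, d.map_walk hd, walk_inv_of_even cs i j (even_two_mul a)]

theorem Diamond.coe_centralizer {w : W} (hw : w ∈ d.conjClass 1) :
    (d.centralizer w : Set W) = {1, walk cs i j n} := by
  obtain ⟨a, rfl⟩ := (d.mem_conjClass_one_iff hd hij w).mp hw
  ext x
  obtain ⟨k, -, rfl⟩ := exists_walk_natAbs_le_length cs hij x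
  rw [walk_mem_pair_iff cs hij hM]
  change d.toMulEquiv (walk cs i j k) * walk cs i j (2 * a) =
    walk cs i j (2 * a) * walk cs i j k ↔ _
  rw [d.map_walk hd, walk_mul_of_even cs i j (even_two_mul a)]
  rcases Int.even_or_odd k with hk | hk
  · rw [walk_mul_of_even cs i j hk.neg, walk_eq_walk_iff cs hij hM,
      show -k + 2 * a - (2 * a + k) = 2 * -k by ring, mul_dvd_mul_iff_left two_ne_zero, dvd_neg]
  · have two_dvd : (2 : ℤ) ∣ n := by exact_mod_cast hn.two_dvd
    rw [walk_mul_of_odd cs i j hk.neg, walk_eq_walk_iff cs hij hM,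
      show -k - 2 * a - (2 * a + k) = 2 * -(k + 2 * a) by ring,
      mul_dvd_mul_iff_left two_ne_zero]
    refine iff_of_false (fun h => ?_) (fun h => ?_)
    · have := two_dvd.trans h
      grind
    · have := two_dvd.trans h
      grind

theorem Diamond.centralizer_le_center {w : W} (hw : w ∈ d.conjClass 1) :
    d.centralizer w ≤ Subgroup.center W := by
  rw [← SetLike.coe_subset_coe, d.coe_centralizer hd hij hM hn hw, Set.insert_subset_iff,
    Set.singleton_subset_iff]
  exact ⟨one_mem _, walk_mem_center cs hij hM hn⟩

end

end DihedralTwist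

section DihedralRoots

/-- The vector with coordinates `sin ((k + 1) π / n)` and `sin (k π / n)` in the simple roots
`α_i`, `α_j` of the dihedral group of order `2n`. These vectors are the roots, all scaled by the
same factor `sin (π / n)` and indexed by their direction. -/
def rootVec (i j : Fin 2) (n : ℕ) (k : ℤ) : Fin 2 →₀ ℝ :=
  Finsupp.single i (Real.sin ((k + 1) * (Real.pi / n))) +
    Finsupp.single j (Real.sin (k * (Real.pi / n)))

theorem rootVec_apply_left {i j : Fin 2} (hij : i ≠ j) (n : ℕ) (k : ℤ) :
    rootVec i j n k i = Real.sin ((k + 1) * (Real.pi / n)) := by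
  simp [rootVec, hij]

theorem rootVec_apply_right {i j : Fin 2} (hij : i ≠ j) (n : ℕ) (k : ℤ) :
    rootVec i j n k j = Real.sin (k * (Real.pi / n)) := by
  simp [rootVec, hij.symm]

theorem rootVec_swap (i j : Fin 2) (n : ℕ) (k : ℤ) :
    rootVec j i n k = -rootVec i j n (-k - 1) := by
  rw [rootVec, rootVec, neg_add, ← Finsupp.single_neg, ← Finsupp.single_neg, ← Real.sin_neg,
    ← Real.sin_neg, add_comm]
  push_cast
  ring_nf

theorem rootVec_zero (i j : Fin 2) (n : ℕ) :
    rootVec i j n 0 = Real.sin (Real.pi / n) • simpleRoot i := by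
  simp [rootVec, simpleRoot]

theorem rootVec_add_natCast {n : ℕ} (hn : 0 < n) (i j : Fin 2) (k : ℤ) :
    rootVec i j n (k + n) = -rootVec i j n k := by
  have half_turn (x : ℝ) : Real.sin ((x + n) * (Real.pi / n)) = -Real.sin (x * (Real.pi / n)) := by
    rw [add_mul, mul_div_cancel₀ _ (by positivity), Real.sin_add_pi]
  rw [rootVec, rootVec, neg_add, ← Finsupp.single_neg, ← Finsupp.single_neg, ← half_turn,
    ← half_turn]
  push_cast
  ring_nf

variable {M : CoxeterMatrix (Fin 2)} {i j : Fin 2} (hij : i ≠ j) {n : ℕ}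
include hij

theorem ext_of_ne {v w : Fin 2 →₀ ℝ} (hi : v i = w i) (hj : v j = w j) : v = w := by
  ext b
  rcases eq_or_eq_of_ne hij b with rfl | rfl <;> assumption

theorem even_sub_of_rootVec_eq (hn : 2 ≤ n) {k l : ℤ} (h : rootVec i j n k = rootVec i j n l) :
    Even (k - l) := by
  have θ_pos : 0 < Real.pi / n := by positivity
  have θ_lt : Real.pi / n < Real.pi := div_lt_self Real.pi_pos (by exact_mod_cast hn)
  have sin_ne := (Real.sin_pos_of_pos_of_lt_pi θ_pos θ_lt).ne'
  have sin_eq := DFunLike.congr_fun h j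
  have cos_eq := DFunLike.congr_fun h i
  simp only [rootVec_apply_left hij, rootVec_apply_right hij, add_mul, one_mul, Real.sin_add]
    at sin_eq cos_eq
  rw [sin_eq, add_right_inj, mul_left_inj' sin_ne] at cos_eq
  obtain ⟨c, hc⟩ := Real.Angle.angle_eq_iff_two_pi_dvd_sub.mp (Real.Angle.cos_sin_inj cos_eq sin_eq)
  have index_eq : ((k - l : ℤ) : ℝ) = (2 * (n * c) : ℤ) := by
    have := Real.pi_ne_zero
    field_simp at hc
    push_cast
    linarith
  exact even_iff_two_dvd.mpr ⟨n * c, by exact_mod_cast index_eq⟩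

variable (hM : M i j = n)
include hM

theorem simpleReflection_left_rootVec (k : ℤ) :
    simpleReflection M i (rootVec i j n k) = -rootVec i j n (-k) := by
  have coroot (v : Fin 2 →₀ ℝ) :
      simpleCoroot M i v = 2 * v i - 2 * Real.cos (Real.pi / n) * v j := by
    rw [simpleCoroot, Finsupp.linearCombination_apply, Finsupp.sum_fintype _ _ (by simp)]
    rcases (by omega : i = 0 ∧ j = 1 ∨ i = 1 ∧ j = 0) with ⟨rfl, rfl⟩ | ⟨rfl, rfl⟩ <;>
    · simp [hM]
      ring
  rw [simpleReflection, Module.reflection_apply, coroot]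
  apply ext_of_ne hij
  · simp [rootVec_apply_left hij, rootVec_apply_right hij, simpleRoot, add_mul, Real.sin_add]
    ring
  · simp [rootVec_apply_right hij, simpleRoot, hij]

theorem simpleReflection_right_rootVec (k : ℤ) :
    simpleReflection M j (rootVec i j n k) = -rootVec i j n (-k - 2) := by
  rw [rootVec_swap j i, map_neg,
    simpleReflection_left_rootVec hij.symm ((M.symmetric j i).trans hM), rootVec_swap i j,
    neg_neg, neg_neg]
  ring_nf

variable {W : Type*} [Group W] {cs : CoxeterSystem M W}

omit hij hM in
theorem geomRep_simple (b : Fin 2) : geomRep cs (cs.simple b) = simpleReflection M b :=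
  cs.lift_apply_simple (simpleReflection_liftable M) b

theorem geomRep_walk_two_mul_rootVec (a k : ℤ) :
    geomRep cs (walk cs i j (2 * a)) (rootVec i j n k) = rootVec i j n (k + 2 * a) := by
  have rotate (k : ℤ) :
      geomRep cs (cs.simple i * cs.simple j) (rootVec i j n k) = rootVec i j n (k + 2) := by
    rw [map_mul, LinearEquiv.mul_apply, geomRep_simple, geomRep_simple,
      simpleReflection_right_rootVec hij hM, map_neg, simpleReflection_left_rootVec hij hM, neg_neg]
    ring_nf
  rw [walk_two_mul]
  induction a generalizing k with
  | zero => simp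
  | succ a ih =>
    rw [zpow_add_one, map_mul, LinearEquiv.mul_apply, rotate, ih]
    ring_nf
  | pred a ih =>
    have shifted := rotate (k - 2)
    rw [sub_add_cancel] at shifted
    rw [← shifted, ← LinearEquiv.mul_apply, ← map_mul, ← zpow_add_one, sub_add_cancel, ih]
    ring_nf

theorem exists_rootVec_eq_smul (hn : 0 < n) {α : Fin 2 →₀ ℝ} (hα : α ∈ roots cs) :
    ∃ k : ℤ, Real.sin (Real.pi / n) • α = rootVec i j n k := by
  obtain ⟨w, b, rfl⟩ := hα
  have neg_rootVec (k : ℤ) : -rootVec i j n k = rootVec i j n (k + n) :=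
    (rootVec_add_natCast hn i j k).symm
  rw [← map_smul]
  induction w using cs.simple_induction_left with
  | one =>
    rcases eq_or_eq_of_ne hij b with rfl | rfl
    · exact ⟨0, by simp [rootVec_zero]⟩
    · refine ⟨-1 + n, ?_⟩
      rw [map_one, LinearEquiv.coe_one, id_eq, ← rootVec_zero b i, rootVec_swap i b, neg_rootVec]
      norm_num
  | mul_simple_left w c ih =>
    obtain ⟨k, hk⟩ := ih
    rw [map_mul, LinearEquiv.mul_apply, hk, geomRep_simple]
    rcases eq_or_eq_of_ne hij c with rfl | rfl
    · exact ⟨-k + n, by rw [simpleReflection_left_rootVec hij hM, neg_rootVec]⟩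
    · exact ⟨-k - 2 + n, by rw [simpleReflection_right_rootVec hij hM, neg_rootVec]⟩

variable (d : Diamond cs) (hd : d.toMulEquiv (cs.simple i) = cs.simple j)
include hd

theorem Diamond.perm_apply (hn : 2 ≤ n) : d.perm i = j := by
  refine (eq_or_eq_of_ne hij (d.perm i)).resolve_left fun h => ?_
  have simple_eq := d.map_simple i
  rw [h, hd, ← walk_one cs i j, ← walk_neg_one cs i j, walk_eq_walk_iff cs hij hM] at simple_eq
  have := Int.le_of_dvd (by norm_num) ((dvd_neg (b := 2)).mp simple_eq)
  omega

theorem Diamond.onRoots_rootVec (hn : 2 ≤ n) (k : ℤ) :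
    d.onRoots (rootVec i j n k) = -rootVec i j n (-k - 1) := by
  have hperm := d.perm_apply hij hM hd hn
  have hperm' : d.perm j = i := by
    refine (eq_or_eq_of_ne hij (d.perm j)).resolve_right fun h => hij ?_
    exact d.perm.injective (hperm.trans h.symm)
  rw [← rootVec_swap]
  simp [Diamond.onRoots, rootVec, Finsupp.domLCongr_apply, Finsupp.equivMapDomain_eq_mapDomain,
    Finsupp.mapDomain_add, hperm, hperm']

/-
A rotation moves the direction of a root by an even number of steps, whereas `α ↦ -α^⋄` moves it
by an odd number of steps.
-/
theorem Diamond.twistedRoots_eq_empty (hn : 2 ≤ n) {w : W} (hw : w ∈ d.conjClass 1) :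
    d.twistedRoots w = ∅ := by
  obtain ⟨a, rfl⟩ := (d.mem_conjClass_one_iff hd hij w).mp hw
  refine Set.eq_empty_iff_forall_notMem.mpr ?_
  rintro α ⟨hα, fixed⟩
  obtain ⟨k, hk⟩ := exists_rootVec_eq_smul hij hM (by omega) hα
  have directions := congrArg (Real.sin (Real.pi / n) • ·) fixed
  simp only [smul_neg, ← map_smul, hk] at directions
  rw [geomRep_walk_two_mul_rootVec hij hM, d.onRoots_rootVec hij hM hd hn, neg_neg] at directions
  have := even_sub_of_rootVec_eq hij hn directions
  grind

theorem Diamond.card_centralizer (hn : 0 < n) (hn' : Even n) {w : W} (hw : w ∈ d.conjClass 1) :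
    Nat.card (d.centralizer w) = 2 := by
  rw [← SetLike.coe_sort_coe, d.coe_centralizer hd hij hM hn' hw, Nat.card_coe_set_eq,
    Set.ncard_pair (walk_ne_one cs hij hM hn).symm]

open scoped Classical in
theorem Diamond.upsilon_apply [Fintype W] (hn : 2 ≤ n) (hn' : Even n) {w : W}
    (hw : w ∈ d.conjClass 1) (g : W) :
    d.upsilon w g = if g = 1 ∨ g = walk cs i j n then (n : ℂ) else 0 := by
  have mem_iff : g ∈ d.centralizer w ↔ g = 1 ∨ g = walk cs i j n := by
    rw [← SetLike.mem_coe, d.coe_centralizer hd hij hM hn' hw, Set.mem_insert_iff,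
      Set.mem_singleton_iff]
  have index_eq : (d.centralizer w).index = n := by
    have lagrange := (d.centralizer w).card_mul_index
    rw [d.card_centralizer hij hM hd (by omega) hn' hw, Nat.card_eq_fintype_card,
      card_eq cs hij hM (by omega)] at lagrange
    omega
  rw [d.upsilon_eq_induced (d.twistedRoots_eq_empty hij hM hd hn hw),
    induced_one_of_le_center (d.centralizer_le_center hd hij hM hn' hw), index_eq]
  simp only [mem_iff]

theorem Diamond.classInner_upsilon [Fintype W] (hn : 2 ≤ n) (hn' : Even n) {w : W}
    (hw : w ∈ d.conjClass 1) (φ : W → ℂ) :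
    classInner (d.upsilon w) φ =
      ((starRingEnd ℂ) (φ 1) + (starRingEnd ℂ) (φ (walk cs i j n))) / 2 := by
  classical
  have support : ({g | g = 1 ∨ g = walk cs i j n} : Finset W) = {1, walk cs i j n} := by
    ext g
    simp
  have n_ne : (n : ℂ) ≠ 0 := Nat.cast_ne_zero.mpr (by omega)
  simp only [classInner, d.upsilon_apply hij hM hd hn hn' hw, ite_mul, zero_mul]
  rw [← Finset.sum_filter, support, Finset.sum_pair (walk_ne_one cs hij hM (by omega)).symm,
    card_eq cs hij hM (by omega)]
  push_cast
  field_simp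

end DihedralRoots

section HeckeModule

theorem vpow_mul_vpow (a b : ℤ) : vpow a * vpow b = vpow (a + b) :=
  (LaurentPolynomial.T_add a b).symm

@[simp] theorem vpow_zero : vpow 0 = 1 := rfl

theorem invert_vpow (a : ℤ) : LaurentPolynomial.invert (vpow a) = vpow (-a) :=
  LaurentPolynomial.invert_T a

theorem coeff_vpow_mul_aeval (a n : ℤ) (p : Polynomial ℤ) :
    (vpow a * Polynomial.aeval (vpow (-2)) p).coeff n =
      ∑ k ∈ Finset.range (p.natDegree + 1), if a - 2 * k = n then p.coeff k else 0 := by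
  have monomial (k : ℕ) :
      vpow a * (p.coeff k • vpow (-2) ^ k) = p.coeff k • vpow (a - 2 * k) := by
    rw [vpow, vpow, LaurentPolynomial.T_pow, mul_smul_comm, ← LaurentPolynomial.T_add, vpow]
    ring_nf
  simp only [Polynomial.aeval_eq_sum_range, Finset.mul_sum, monomial]
  simp only [AddMonoidAlgebra.coeff_sum, Finsupp.finsetSum_apply, vpow,
    AddMonoidAlgebra.coeff_smul, Finsupp.smul_apply, LaurentPolynomial.T_apply, smul_eq_mul,
    mul_ite, mul_one, mul_zero]

theorem aeval_vpow_injective : Function.Injective (Polynomial.aeval (R := ℤ) (vpow (-2))) := by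
  rw [injective_iff_map_eq_zero]
  intro p hp
  ext k
  have coeff_sum := coeff_vpow_mul_aeval 0 (-2 * k) p
  have index_eq (l : ℕ) : ((0 : ℤ) - 2 * l = -2 * k) ↔ k = l := by omega
  simp only [hp, mul_zero, index_eq, Finset.sum_ite_eq, Finset.mem_range] at coeff_sum
  split_ifs at coeff_sum with hk
  · simpa using coeff_sum.symm
  · rw [Polynomial.coeff_eq_zero_of_natDegree_lt (by omega), Polynomial.coeff_zero]

variable {B : Type*} {M : CoxeterMatrix B} {W : Type*} [Group W] (cs : CoxeterSystem M W)

theorem length_simple_mul_lt_or (i : B) (w : W) :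
    cs.length w < cs.length (cs.simple i * w) ∨ cs.length (cs.simple i * w) < cs.length w := by
  have := cs.length_simple_mul w i
  omega

open scoped Classical in
theorem leftMulSimple_apply (i : B) (h : HeckeModule W) (z : W) :
    leftMulSimple cs i h z = h (cs.simple i * z) +
      if cs.IsLeftDescent z i then (vpow 1 - vpow (-1)) * h z else 0 := by
  induction h using Finsupp.induction_linear with
  | zero => simp
  | add f g hf hg =>
    rw [map_add, Finsupp.add_apply, hf, hg, Finsupp.add_apply, Finsupp.add_apply]
    split_ifs <;> ring
  | single w a =>
    have flip : cs.simple i * w = z ↔ w = cs.simple i * z := by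
      constructor <;> rintro rfl <;> simp
    rw [leftMulSimple, Finsupp.linearCombination_single]
    rcases length_simple_mul_lt_or cs i w with hw | hw
    · rw [if_pos hw]
      by_cases hz : w = z
      · subst hz
        simp [stdElt, CoxeterSystem.IsLeftDescent, hw.not_gt, Finsupp.single_apply, flip]
      · simp [stdElt, Finsupp.single_apply, flip, hz]
    · rw [if_neg hw.not_gt]
      by_cases hz : w = z
      · subst hz
        simp [stdElt, CoxeterSystem.IsLeftDescent, hw, Finsupp.single_apply, flip, mul_comm a]
      · simp [stdElt, Finsupp.single_apply, flip, hz]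

theorem leftMulSimpleInv_eq_sub (i : B) (h : HeckeModule W) : leftMulSimpleInv cs i h =
    leftMulSimple cs i h - (vpow 1 - vpow (-1)) • h := rfl

theorem leftMulSimpleInv_apply (i : B) (h : HeckeModule W) (z : W) :
    leftMulSimpleInv cs i h z = leftMulSimple cs i h z - (vpow 1 - vpow (-1)) * h z := rfl

theorem leftMulSimple_stdElt_of_lt {i : B} {w : W}
    (hw : cs.length w < cs.length (cs.simple i * w)) :
    leftMulSimple cs i (stdElt w) = stdElt (cs.simple i * w) := by
  rw [leftMulSimple, stdElt, Finsupp.linearCombination_single, one_smul, if_pos hw]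

theorem leftMulSimpleInv_leftMulSimple (i : B) (h : HeckeModule W) :
    leftMulSimpleInv cs i (leftMulSimple cs i h) = h := by
  classical
  ext z : 1
  have hz := length_simple_mul_lt_or cs i z
  simp only [leftMulSimpleInv_apply, leftMulSimple_apply, CoxeterSystem.IsLeftDescent,
    cs.simple_mul_simple_cancel_left]
  rcases hz with hz | hz <;> simp only [hz, hz.not_gt, if_true, if_false] <;> ring

theorem leftMulSimple_stdElt_of_gt {i : B} {w : W}
    (hw : cs.length (cs.simple i * w) < cs.length w) : leftMulSimple cs i (stdElt w) =
      stdElt (cs.simple i * w) + (vpow 1 - vpow (-1)) • stdElt w := by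
  rw [leftMulSimple]
  nth_rw 1 [stdElt]
  rw [Finsupp.linearCombination_single, one_smul, if_neg hw.not_gt]

theorem leftMulSimpleInv_leftMulSimpleInv (i : B) (h : HeckeModule W) :
    leftMulSimpleInv cs i (leftMulSimpleInv cs i h) =
      h - (vpow 1 - vpow (-1)) • leftMulSimpleInv cs i h := by
  conv_lhs => rw [leftMulSimpleInv_eq_sub cs i h]
  rw [map_sub, map_smul, leftMulSimpleInv_leftMulSimple]

end HeckeModule

section BarInvolution

variable {B : Type*} {M : CoxeterMatrix B} {W : Type*} [Group W] (cs : CoxeterSystem M W)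

/-- `h` has the shape `T_w + (a combination of T_y with ℓ(y) < ℓ(w))`. -/
def HasLeadingTerm (h : HeckeModule W) (w : W) : Prop :=
  h w = 1 ∧ ∀ y, y ≠ w → cs.length w ≤ cs.length y → h y = 0

variable {cs} in
theorem HasLeadingTerm.leftMulSimpleInv {h : HeckeModule W} {w : W} (hh : HasLeadingTerm cs h w)
    {i : B} (hw : cs.length w < cs.length (cs.simple i * w)) :
    HasLeadingTerm cs (leftMulSimpleInv cs i h) (cs.simple i * w) := by
  classical
  have coeff (z : W) (hz : cs.length w < cs.length z) :
      TwistedInv.leftMulSimpleInv cs i h z = h (cs.simple i * z) := by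
    have : h z = 0 := hh.2 z (by rintro rfl; exact hz.false) hz.le
    rw [leftMulSimpleInv_apply, leftMulSimple_apply, this]
    simp
  refine ⟨by rw [coeff _ hw, cs.simple_mul_simple_cancel_left, hh.1], fun z hz hlen => ?_⟩
  rw [coeff z (hw.trans_le hlen)]
  refine hh.2 _ (fun h => hz ?_) ?_
  · rw [← h, cs.simple_mul_simple_cancel_left]
  · have := cs.length_simple_mul z i
    omega

variable {cs} in
theorem length_wordProd_lt_cons {i : B} {ω : List B} (hω : cs.IsReduced (i :: ω)) :
    cs.length (cs.wordProd ω) < cs.length (cs.simple i * cs.wordProd ω) := by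
  have tail : cs.IsReduced ω := hω.drop 1
  rw [← cs.wordProd_cons, hω.eq, tail.eq, List.length_cons]
  exact Nat.lt_succ_self _

variable {cs} in
theorem isLeftDescent_wordProd_cons {i : B} {ω : List B} (hω : cs.IsReduced (i :: ω)) :
    cs.IsLeftDescent (cs.wordProd (i :: ω)) i := by
  rw [CoxeterSystem.IsLeftDescent, cs.wordProd_cons, cs.simple_mul_simple_cancel_left]
  exact length_wordProd_lt_cons hω

theorem isReduced_redWord (w : W) : cs.IsReduced (redWord cs w) :=
  (Classical.choose_spec (cs.exists_isReduced w)).1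

theorem wordProd_redWord (w : W) : cs.wordProd (redWord cs w) = w :=
  (Classical.choose_spec (cs.exists_isReduced w)).2.symm

theorem hasLeadingTerm_invStd (w : W) : HasLeadingTerm cs (invStd cs w) w := by
  have word (ω : List B) (hω : cs.IsReduced ω) :
      HasLeadingTerm cs ((ω.map (leftMulSimpleInv cs)).prod (stdElt 1)) (cs.wordProd ω) := by
    induction ω with
    | nil =>
      rw [List.map_nil, List.prod_nil, cs.wordProd_nil]
      exact ⟨Finsupp.single_eq_same, fun y hy _ => Finsupp.single_eq_of_ne hy⟩
    | cons i ω ih =>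
      rw [cs.wordProd_cons, List.map_cons, List.prod_cons, Module.End.mul_apply]
      exact (ih (hω.drop 1)).leftMulSimpleInv (length_wordProd_lt_cons hω)
  simpa only [wordProd_redWord, invStd] using word (redWord cs w) (isReduced_redWord cs w)

theorem invStd_one : invStd cs (1 : W) = stdElt 1 := by
  have empty : redWord cs (1 : W) = [] := by
    rw [← List.length_eq_zero_iff, ← (isReduced_redWord cs 1).eq, wordProd_redWord, cs.length_one]
  rw [invStd, empty, List.map_nil, List.prod_nil, Module.End.one_apply]

theorem heckeBar_add (h h' : HeckeModule W) :
    heckeBar cs (h + h') = heckeBar cs h + heckeBar cs h' :=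
  Finsupp.sum_add_index' (by simp) (by simp [add_smul])

theorem heckeBar_smul (a : LaurentRing) (h : HeckeModule W) :
    heckeBar cs (a • h) = LaurentPolynomial.invert a • heckeBar cs h := by
  rw [heckeBar, Finsupp.sum_smul_index (by simp), heckeBar, Finsupp.smul_sum]
  simp [mul_smul]

theorem heckeBar_sub (h h' : HeckeModule W) :
    heckeBar cs (h - h') = heckeBar cs h - heckeBar cs h' := by
  have neg := heckeBar_smul cs (-1) h'
  rw [neg_one_smul, map_neg, map_one, neg_one_smul] at neg
  rw [sub_eq_add_neg, heckeBar_add, neg, sub_eq_add_neg]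

theorem heckeBar_stdElt (w : W) : heckeBar cs (stdElt w) = invStd cs w := by
  rw [heckeBar, stdElt, Finsupp.sum_single_index (by simp)]
  simp

theorem heckeBar_sum {ι : Type*} (s : Finset ι) (f : ι → HeckeModule W) :
    heckeBar cs (∑ x ∈ s, f x) = ∑ x ∈ s, heckeBar cs (f x) :=
  map_sum (AddMonoidHom.mk' (heckeBar cs) (heckeBar_add cs)) f s

theorem heckeBar_leftMulSimple_of_support {i : B} {h : HeckeModule W}
    (hh : ∀ y ∈ h.support,
      heckeBar cs (leftMulSimple cs i (stdElt y)) = leftMulSimpleInv cs i (invStd cs y)) :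
    heckeBar cs (leftMulSimple cs i h) = leftMulSimpleInv cs i (heckeBar cs h) := by
  have expansion : h = ∑ y ∈ h.support, h y • stdElt y := by
    conv_lhs => rw [← Finsupp.sum_single h]
    simp [Finsupp.sum, stdElt]
  conv_lhs => rw [expansion]
  rw [map_sum, heckeBar_sum, heckeBar, Finsupp.sum, map_sum]
  refine Finset.sum_congr rfl fun y hy => ?_
  rw [map_smul, heckeBar_smul, hh y hy, map_smul]

theorem heckeBar_leftMulSimple_stdElt_of_lt {i : B} {y : W}
    (hy : cs.length y < cs.length (cs.simple i * y))
    (inv : invStd cs (cs.simple i * y) = leftMulSimpleInv cs i (invStd cs y)) :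
    heckeBar cs (leftMulSimple cs i (stdElt y)) = leftMulSimpleInv cs i (invStd cs y) := by
  rw [leftMulSimple_stdElt_of_lt cs hy, heckeBar_stdElt, inv]

theorem heckeBar_leftMulSimple_stdElt_of_gt {i : B} {y : W}
    (hy : cs.length (cs.simple i * y) < cs.length y)
    (inv : invStd cs y = leftMulSimpleInv cs i (invStd cs (cs.simple i * y))) :
    heckeBar cs (leftMulSimple cs i (stdElt y)) = leftMulSimpleInv cs i (invStd cs y) := by
  rw [leftMulSimple_stdElt_of_gt cs hy, heckeBar_add, heckeBar_smul, heckeBar_stdElt,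
    heckeBar_stdElt, inv, leftMulSimpleInv_leftMulSimpleInv]
  have bar_scalar : LaurentPolynomial.invert (vpow 1 - vpow (-1)) = -(vpow 1 - vpow (-1)) := by
    simp [invert_vpow]
  rw [bar_scalar, neg_smul, ← sub_eq_add_neg]

/- At a basis element of maximal length in the support, the bar involution inverts the
coefficient. -/
theorem eq_zero_of_heckeBar_eq_self {h : HeckeModule W} (bar : heckeBar cs h = h)
    (positive : ∀ y, ∀ n ≤ 0, (h y).coeff n = 0) : h = 0 := by
  by_contra hne
  obtain ⟨y, hy, hmax⟩ :=
    h.support.exists_max_image cs.length (Finsupp.support_nonempty_iff.mpr hne)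
  have inverted : h y = LaurentPolynomial.invert (h y) := by
    conv_lhs => rw [← bar]
    rw [heckeBar, Finsupp.sum, Finsupp.finsetSum_apply, Finset.sum_eq_single_of_mem y hy]
    · rw [Finsupp.smul_apply, (hasLeadingTerm_invStd cs y).1, smul_eq_mul, mul_one]
    · intro w hw hwy
      rw [Finsupp.smul_apply, (hasLeadingTerm_invStd cs w).2 y hwy.symm (hmax w hw), smul_zero]
  refine Finsupp.mem_support_iff.mp hy (LaurentPolynomial.ext fun n => ?_)
  rcases le_or_gt n 0 with hn | hn
  · exact positive y n hn
  · rw [inverted, LaurentPolynomial.invert_apply, positive y _ (by omega)]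
    rfl

variable [Fintype W]

theorem klSum_apply (w y : W) (P : W → Polynomial ℤ) : klSum cs w P y =
    (-1) ^ (cs.length w + cs.length y) * vpow ((cs.length w : ℤ) - (cs.length y : ℤ)) *
      Polynomial.aeval (vpow (-2)) (P y) := by
  classical
  simp only [klSum, stdElt, Finsupp.coe_finsetSum, Finset.sum_apply, Finsupp.smul_apply,
    Finsupp.single_apply, smul_eq_mul, mul_ite, mul_one, mul_zero]
  rw [Finset.sum_ite_eq' Finset.univ y]
  simp

variable {cs} {w : W} {P Q : W → Polynomial ℤ}

theorem IsKLFamily.coeff_klSum_eq_zero (hP : IsKLFamily cs w P) {y : W} (hy : y ≠ w) {n : ℤ}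
    (hn : n ≤ 0) : (klSum cs w P y).coeff n = 0 := by
  rw [klSum_apply, mul_assoc]
  by_cases hle : bruhatLE cs y w
  · have degree := hP.2.2.1 y ⟨hle, hy⟩
    have coeff_zero : (vpow ((cs.length w : ℤ) - (cs.length y : ℤ)) *
        Polynomial.aeval (vpow (-2)) (P y)).coeff n = 0 := by
      rw [coeff_vpow_mul_aeval]
      refine Finset.sum_eq_zero fun k hk => if_neg ?_
      have := Finset.mem_range.mp hk
      omega
    rcases neg_one_pow_eq_or LaurentRing (cs.length w + cs.length y) with h | h <;>
      simp [h, coeff_zero]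
  · simp [hP.2.1 y hle]

theorem IsKLFamily.unique (hP : IsKLFamily cs w P) (hQ : IsKLFamily cs w Q) : P = Q := by
  have difference : klSum cs w P - klSum cs w Q = 0 := by
    refine eq_zero_of_heckeBar_eq_self cs ?_ fun y n hn => ?_
    · rw [heckeBar_sub, hP.2.2.2, hQ.2.2.2]
    · rw [Finsupp.sub_apply, AddMonoidAlgebra.coeff_sub, Finsupp.sub_apply]
      by_cases hy : y = w
      · subst hy
        rw [klSum_apply, klSum_apply, hP.1, hQ.1, sub_self]
      · rw [hP.coeff_klSum_eq_zero hy hn, hQ.coeff_klSum_eq_zero hy hn, sub_self]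
  funext y
  have coeff_eq := DFunLike.congr_fun (sub_eq_zero.mp difference) y
  rw [klSum_apply, klSum_apply] at coeff_eq
  have unit : IsUnit ((-1 : LaurentRing) ^ (cs.length w + cs.length y) *
      vpow ((cs.length w : ℤ) - (cs.length y : ℤ))) :=
    (isUnit_one.neg.pow _).mul (LaurentPolynomial.isUnit_T _)
  exact aeval_vpow_injective (unit.mul_left_cancel coeff_eq)

theorem IsKLFamily.klPoly_eq (hP : IsKLFamily cs w P) (y : W) : klPoly cs y w = P y := by
  have existence : ∃ P, IsKLFamily cs w P := ⟨P, hP⟩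
  rw [klPoly, dif_pos existence, (Classical.choose_spec existence).unique hP]

end BarInvolution

section DihedralKazhdanLusztig

variable {M : CoxeterMatrix (Fin 2)} {W : Type*} [Group W] (cs : CoxeterSystem M W)
  {i j : Fin 2} (hij : i ≠ j) {n : ℕ} (hM : M i j = n)

include hij hM

omit [Group W] in
theorem matrix_eq_of_ne {a b : Fin 2} (hab : a ≠ b) : M a b = n := by
  rcases eq_or_eq_of_ne hij a with rfl | rfl <;> rcases eq_or_eq_of_ne hij b with rfl | rfl
  · exact absurd rfl hab
  · exact hM
  · rw [M.symmetric, hM]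
  · exact absurd rfl hab

theorem exists_walk_eq_of_isLeftDescent (hn : 0 < n) {w : W} {a b : Fin 2} (hab : a ≠ b)
    (ha : cs.IsLeftDescent w a) : ∃ k : ℤ, 0 < k ∧ k ≤ n ∧ walk cs a b k = w := by
  have hM' := matrix_eq_of_ne hij hM hab
  obtain ⟨k, hk, rfl⟩ := exists_walk_eq cs hab hM' hn w
  exact ⟨k, (isLeftDescent_walk_iff cs hab hM' hk).mp ha, hk.2, rfl⟩

theorem eq_of_isLeftDescent {w : W} (hw : cs.length w < n) {a b : Fin 2}
    (ha : cs.IsLeftDescent w a) (hb : cs.IsLeftDescent w b) : a = b := by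
  by_contra hab
  obtain ⟨k, hpos, hk, rfl⟩ := exists_walk_eq_of_isLeftDescent cs hij hM (by omega) hab ha
  have hM' := matrix_eq_of_ne hij hM hab
  rw [length_walk cs hab hM' (by omega)] at hw
  rw [walk_swap cs b a, isLeftDescent_walk_iff cs (Ne.symm hab)
    (matrix_eq_of_ne hij hM (Ne.symm hab)) (by omega)] at hb
  omega

theorem eq_of_isReduced_of_wordProd_eq {ω ω' : List (Fin 2)} (hω : cs.IsReduced ω)
    (hω' : cs.IsReduced ω') (heq : cs.wordProd ω = cs.wordProd ω') (hlen : ω.length < n) :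
    ω = ω' := by
  have same_length : ω.length = ω'.length := by rw [← hω.eq, heq, hω'.eq]
  induction ω generalizing ω' with
  | nil => exact (List.length_eq_zero_iff.mp same_length.symm).symm
  | cons a ω ih =>
    cases ω' with
    | nil => exact absurd same_length (by simp)
    | cons b ω' =>
      obtain rfl : a = b := eq_of_isLeftDescent cs hij hM (by rwa [hω.eq])
        (isLeftDescent_wordProd_cons hω) (heq ▸ isLeftDescent_wordProd_cons hω')
      rw [cs.wordProd_cons, cs.wordProd_cons, mul_right_inj] at heq
      rw [List.length_cons] at hlen
      have tails_eq : ω = ω' := ih (hω.drop 1) (hω'.drop 1) heq (by omega)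
        (Nat.succ_injective same_length)
      rw [tails_eq]

theorem invStd_wordProd {ω : List (Fin 2)} (hω : cs.IsReduced ω) (hlen : ω.length < n) :
    invStd cs (cs.wordProd ω) = (ω.map (leftMulSimpleInv cs)).prod (stdElt 1) := by
  rw [invStd, ← eq_of_isReduced_of_wordProd_eq cs hij hM hω (isReduced_redWord cs _)
    (wordProd_redWord cs _).symm hlen]

theorem invStd_simple_mul {a : Fin 2} {w : W} (hw : cs.length w < cs.length (cs.simple a * w))
    (hlt : cs.length (cs.simple a * w) < n) :
    invStd cs (cs.simple a * w) = leftMulSimpleInv cs a (invStd cs w) := by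
  have length_word : (redWord cs w).length = cs.length w := by
    rw [← (isReduced_redWord cs w).eq, wordProd_redWord]
  have length_mul : cs.length (cs.simple a * w) = cs.length w + 1 := by
    have := cs.length_simple_mul w a
    omega
  have product : cs.wordProd (a :: redWord cs w) = cs.simple a * w := by
    rw [cs.wordProd_cons, wordProd_redWord]
  have reduced : cs.IsReduced (a :: redWord cs w) := by
    rw [CoxeterSystem.IsReduced, product, length_mul, List.length_cons, length_word]
  rw [← product, invStd_wordProd cs hij hM reduced (by rw [List.length_cons]; omega),
    List.map_cons, List.prod_cons, Module.End.mul_apply, invStd]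

theorem exists_invStd_eq (hn : 0 < n) {w : W} (hw : w ≠ 1) :
    ∃ a, cs.IsLeftDescent w a ∧
      invStd cs w = leftMulSimpleInv cs a (invStd cs (cs.simple a * w)) := by
  have hle := length_le cs hij hM hn w
  have reduced := isReduced_redWord cs w
  have product := wordProd_redWord cs w
  have unfolded : invStd cs w = ((redWord cs w).map (leftMulSimpleInv cs)).prod (stdElt 1) := rfl
  rw [unfolded]
  generalize redWord cs w = ω at reduced product
  subst product
  rw [reduced.eq] at hle
  cases ω with
  | nil => exact absurd cs.wordProd_nil hw
  | cons a ω =>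
    have tail : cs.IsReduced ω := reduced.drop 1
    have cancel : cs.simple a * cs.wordProd (a :: ω) = cs.wordProd ω := by
      rw [cs.wordProd_cons, cs.simple_mul_simple_cancel_left]
    refine ⟨a, isLeftDescent_wordProd_cons reduced, ?_⟩
    rw [cancel, invStd_wordProd cs hij hM tail (by simpa using hle), List.map_cons,
      List.prod_cons, Module.End.mul_apply]

end DihedralKazhdanLusztig

section SignedPower

/-- The Laurent monomial `(-v) ^ a`. -/
def signedPow (a : ℤ) : LaurentRing := a.negOnePow • vpow a

theorem signedPow_zero : signedPow 0 = 1 := by simp [signedPow]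

theorem vpow_one_mul_signedPow (a : ℤ) : vpow 1 * signedPow a = -signedPow (a + 1) := by
  rw [signedPow, signedPow, mul_smul_comm, vpow_mul_vpow, Int.negOnePow_succ, add_comm,
    Units.neg_smul, neg_neg]

theorem vpow_neg_one_mul_signedPow (a : ℤ) : vpow (-1) * signedPow a = -signedPow (a - 1) := by
  have shift := vpow_one_mul_signedPow (a - 1)
  rw [sub_add_cancel] at shift
  rw [← neg_neg (signedPow a), ← shift, mul_neg, ← mul_assoc, vpow_mul_vpow, neg_add_cancel,
    vpow_zero, one_mul]

theorem neg_one_pow_mul_vpow (a b : ℕ) :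
    (-1) ^ (a + b) * vpow ((a : ℤ) - b) = signedPow (a - b) := by
  rw [signedPow, Int.negOnePow_sub, ← Int.negOnePow_add, ← Nat.cast_add, Int.negOnePow_def,
    zpow_natCast, Units.smul_def, zsmul_eq_mul]
  simp

end SignedPower

section BallElement

variable {B : Type*} {M : CoxeterMatrix B} {W : Type*} [Group W] (cs : CoxeterSystem M W)
  [Fintype W]

open scoped Classical in
/-- The value of the Kazhdan–Lusztig sum of `w` at the family which is `1` at `w` and at every
element shorter than `w`. In a dihedral group this is the Kazhdan–Lusztig basis element. -/
def ballElt (w : W) : HeckeModule W :=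
  klSum cs w fun y => if y = w ∨ cs.length y < cs.length w then 1 else 0

open scoped Classical in
theorem ballElt_apply (w y : W) : ballElt cs w y =
    if y = w ∨ cs.length y < cs.length w then signedPow (cs.length w - cs.length y) else 0 := by
  rw [ballElt, klSum_apply, neg_one_pow_mul_vpow]
  split_ifs <;> simp

theorem ballElt_one : ballElt cs 1 = stdElt 1 := by
  classical
  ext y : 1
  rw [ballElt_apply, cs.length_one, stdElt, Finsupp.single_apply]
  by_cases hy : y = 1
  · simp [hy, signedPow_zero]
  · simp [hy, Ne.symm hy]

end BallElement

section DihedralBallElement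

variable {M : CoxeterMatrix (Fin 2)} {W : Type*} [Group W] (cs : CoxeterSystem M W)
  {i j : Fin 2} (hij : i ≠ j) {n : ℕ} (hM : M i j = n) [Fintype W]

include hij hM

theorem ballElt_walk_apply {k l : ℤ} (hk : -n < k ∧ k ≤ n) (hl : -n < l ∧ l ≤ n) :
    ballElt cs (walk cs i j k) (walk cs i j l) =
      if l = k ∨ |l| < |k| then signedPow (|k| - |l|) else 0 := by
  classical
  rw [ballElt_apply, walk_eq_walk_iff_of_bounds cs hij hM hl hk,
    length_walk cs hij hM (by omega), length_walk cs hij hM (by omega)]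
  simp only [← Nat.cast_lt (α := ℤ), Int.natCast_natAbs]

theorem leftMulSimple_ballElt {k : ℤ} (hk : k ≤ 0) (hk' : 1 - k ≤ n) :
    leftMulSimple cs i (ballElt cs (walk cs i j k)) =
      vpow 1 • ballElt cs (walk cs i j k) + ballElt cs (walk cs i j (1 - k)) +
        if k ≤ -2 then ballElt cs (walk cs i j (-1 - k)) else 0 := by
  classical
  ext y : 1
  obtain ⟨l, hl, rfl⟩ := exists_walk_eq cs hij hM (by omega) y
  rw [leftMulSimple_apply, simple_left_mul_walk, isLeftDescent_walk_iff cs hij hM hl,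
    Finsupp.add_apply, Finsupp.add_apply, Finsupp.smul_apply, smul_eq_mul,
    apply_ite (fun h : HeckeModule W => h (walk cs i j l)), Finsupp.zero_apply,
    ballElt_walk_apply cs hij hM (by omega) (by omega),
    ballElt_walk_apply cs hij hM (by omega) hl, ballElt_walk_apply cs hij hM (by omega) hl]
  have inner : (if k ≤ -2 then ballElt cs (walk cs i j (-1 - k)) (walk cs i j l) else 0) =
      if k ≤ -2 ∧ (l = -1 - k ∨ |l| < -1 - k) then signedPow (-1 - k - |l|) else 0 := by
    by_cases hk2 : k ≤ -2
    · rw [if_pos hk2, ballElt_walk_apply cs hij hM (by omega) hl,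
        abs_of_nonneg (by omega : 0 ≤ -1 - k)]
      simp only [hk2, true_and]
    · simp only [hk2, if_false, false_and]
  rw [inner, abs_of_nonpos hk, abs_of_nonneg (by omega : 0 ≤ 1 - k)]
  rcases lt_or_ge 0 l with hl0 | hl0
  · rw [abs_of_pos hl0, abs_of_nonpos (by omega : 1 - l ≤ 0)]
    split_ifs <;> first | omega | skip
    all_goals simp only [sub_mul, vpow_one_mul_signedPow, vpow_neg_one_mul_signedPow, mul_zero]
    all_goals ring_nf
  · rw [abs_of_nonpos hl0, abs_of_nonneg (by omega : 0 ≤ 1 - l)]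
    split_ifs <;> first | omega | skip
    all_goals simp only [vpow_one_mul_signedPow, mul_zero]
    all_goals ring_nf

theorem heckeBar_leftMulSimple_ballElt (hn : 0 < n) {w : W} {a : Fin 2}
    (hw : cs.length w < cs.length (cs.simple a * w))
    (inv : invStd cs (cs.simple a * w) = leftMulSimpleInv cs a (invStd cs w)) :
    heckeBar cs (leftMulSimple cs a (ballElt cs w)) =
      leftMulSimpleInv cs a (heckeBar cs (ballElt cs w)) := by
  classical
  have hle := length_le cs hij hM hn (cs.simple a * w)
  refine heckeBar_leftMulSimple_of_support cs fun y hy => ?_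
  rw [Finsupp.mem_support_iff, ballElt_apply] at hy
  by_cases hyw : y = w
  · rw [hyw]
    exact heckeBar_leftMulSimple_stdElt_of_lt cs hw inv
  · have shorter : cs.length y < cs.length w := by
      by_contra h
      exact hy (if_neg (by tauto))
    rcases length_simple_mul_lt_or cs a y with h | h
    · refine heckeBar_leftMulSimple_stdElt_of_lt cs h (invStd_simple_mul cs hij hM h ?_)
      have := cs.length_simple_mul y a
      omega
    · refine heckeBar_leftMulSimple_stdElt_of_gt cs h ?_
      simpa only [cs.simple_mul_simple_cancel_left] using
        invStd_simple_mul cs hij hM (w := cs.simple a * y) (a := a)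
          (by rwa [cs.simple_mul_simple_cancel_left])
          (by rw [cs.simple_mul_simple_cancel_left]; omega)

theorem heckeBar_ballElt (hn : 0 < n) (w : W) : heckeBar cs (ballElt cs w) = ballElt cs w := by
  induction hlen : cs.length w using Nat.strong_induction_on generalizing w with
  | h N ih =>
    subst hlen
    by_cases hw : w = 1
    · rw [hw, ballElt_one, heckeBar_stdElt, invStd_one]
    obtain ⟨a, descent, inv⟩ := exists_invStd_eq cs hij hM hn hw
    obtain ⟨b, hab⟩ := exists_ne a
    have hM' := matrix_eq_of_ne hij hM hab.symm
    obtain ⟨k, hpos, hk, rfl⟩ := exists_walk_eq_of_isLeftDescent cs hij hM hn hab.symm descent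
    obtain ⟨l, rfl⟩ : ∃ l, k = 1 - l := ⟨1 - k, by omega⟩
    have length_mul {x : ℤ} (hx : x.natAbs ≤ n) := length_walk cs hab.symm hM' hx
    have recursion := leftMulSimple_ballElt cs hab.symm hM' (k := l) (by omega) hk
    rw [simple_left_mul_walk, sub_sub_cancel] at inv
    have bar_mul := heckeBar_leftMulSimple_ballElt cs hij hM hn (a := a) (w := walk cs a b l)
      (by rw [simple_left_mul_walk, length_mul (by omega), length_mul (by omega)]; omega)
      (by rw [simple_left_mul_walk, inv])
    have bar_shorter {x : ℤ} (hx : x.natAbs < (1 - l).natAbs) :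
        heckeBar cs (ballElt cs (walk cs a b x)) = ballElt cs (walk cs a b x) :=
      ih _ (by rwa [length_mul (by omega), length_mul (by omega)]) _ rfl
    have bar_correction : heckeBar cs (if l ≤ -2 then ballElt cs (walk cs a b (-1 - l)) else 0) =
        if l ≤ -2 then ballElt cs (walk cs a b (-1 - l)) else 0 := by
      split_ifs
      · exact bar_shorter (by omega)
      · exact Finsupp.sum_zero_index
    rw [bar_shorter (by omega), leftMulSimpleInv_eq_sub, recursion, heckeBar_add, heckeBar_add,
      heckeBar_smul, bar_correction, bar_shorter (by omega), invert_vpow] at bar_mul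
    rw [← sub_eq_zero] at bar_mul ⊢
    rw [← bar_mul]
    module

end DihedralBallElement

section DihedralBruhat

variable {M : CoxeterMatrix (Fin 2)} {W : Type*} [Group W] (cs : CoxeterSystem M W)
  {i j : Fin 2} (hij : i ≠ j) {n : ℕ} (hM : M i j = n) (hn : 0 < n)

theorem isReflection_walk_of_odd (i j : Fin 2) {k : ℤ} (hk : Odd k) :
    cs.IsReflection (walk cs i j k) := by
  obtain ⟨a, rfl⟩ := hk
  rcases Int.even_or_odd a with ha | ha
  · refine ⟨walk cs i j a, i, ?_⟩
    rw [← walk_one cs i j, walk_inv_of_even cs i j ha, walk_mul_of_even cs i j ha,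
      walk_mul_of_odd cs i j (ha.add_odd odd_one)]
    ring_nf
  · refine ⟨walk cs i j a, j, ?_⟩
    rw [← walk_neg_one cs i j, walk_inv_of_odd cs i j ha, walk_mul_of_odd cs i j ha,
      walk_mul_of_even cs i j (ha.sub_odd (by decide))]
    ring_nf

include hij hM hn

theorem bruhatLE_of_odd_length_add {y w : W} (hlt : cs.length y < cs.length w)
    (odd : Odd (cs.length y + cs.length w)) : bruhatLE cs y w := by
  refine Relation.ReflTransGen.single ⟨⟨y⁻¹ * w, ?_, by simp⟩, hlt⟩
  obtain ⟨k, -, hk⟩ := exists_walk_eq cs hij hM hn (y⁻¹ * w)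
  have parity := cs.length_mul_mod_two y⁻¹ w
  rw [cs.length_inv, ← hk] at parity
  rw [← hk]
  refine isReflection_walk_of_odd cs i j (Int.not_even_iff_odd.mp fun even => ?_)
  rw [← even_length_walk_iff cs i j, Nat.even_iff] at even
  rw [Nat.odd_iff] at odd
  omega

theorem bruhatLE_iff {y w : W} : bruhatLE cs y w ↔ y = w ∨ cs.length y < cs.length w := by
  constructor
  · intro h
    by_cases hyw : y = w
    · exact .inl hyw
    · exact .inr (bruhatLT_length cs ⟨h, hyw⟩)
  · rintro (rfl | hlt)
    · exact Relation.ReflTransGen.refl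
    rcases Nat.even_or_odd (cs.length y + cs.length w) with even | odd
    · have hw := length_le cs hij hM hn w
      obtain ⟨z, hz⟩ : ∃ z, cs.length z = cs.length w - 1 :=
        ⟨walk cs i j (cs.length w - 1 : ℕ), by rw [length_walk cs hij hM (by omega)]; rfl⟩
      rw [Nat.even_iff] at even
      refine (bruhatLE_of_odd_length_add cs hij hM hn (w := z) ?_ ?_).trans
        (bruhatLE_of_odd_length_add cs hij hM hn ?_ ?_) <;> rw [hz]
      all_goals first | omega | (rw [Nat.odd_iff]; omega)
    · exact bruhatLE_of_odd_length_add cs hij hM hn hlt odd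

variable [Fintype W]

open scoped Classical in
theorem isKLFamily_indicator (w : W) :
    IsKLFamily cs w fun y => if y = w ∨ cs.length y < cs.length w then 1 else 0 := by
  refine ⟨if_pos (.inl rfl), fun y hy => if_neg ?_, fun y hy => ?_,
    heckeBar_ballElt cs hij hM hn w⟩
  · rwa [← bruhatLE_iff cs hij hM hn]
  · have hlt := bruhatLT_length cs hy
    simpa only [hlt, or_true, if_true, Polynomial.natDegree_one] using by omega

open scoped Classical in
theorem klPoly_eq_ite (y w : W) :
    klPoly cs y w = if y = w ∨ cs.length y < cs.length w then 1 else 0 :=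
  (isKLFamily_indicator cs hij hM hn w).klPoly_eq y

theorem klElt_eq_ballElt (w : W) : klElt cs w = ballElt cs w := by
  simp only [klElt, ballElt, klPoly_eq_ite cs hij hM hn]

theorem klPrec_iff {y w : W} : klPrec cs y w ↔ cs.length w = cs.length y + 1 := by
  have hlt_iff : bruhatLT cs y w ↔ cs.length y < cs.length w := by
    refine ⟨bruhatLT_length cs, fun hlt => ⟨(bruhatLE_iff cs hij hM hn).mpr (.inr hlt), ?_⟩⟩
    rintro rfl
    exact hlt.false
  rw [klPrec, hlt_iff, klPoly_eq_ite cs hij hM hn]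
  constructor
  · rintro ⟨hlt, hdeg⟩
    rw [if_pos (.inr hlt), Polynomial.natDegree_one] at hdeg
    omega
  · intro h
    rw [if_pos (.inr (by omega)), Polynomial.natDegree_one]
    omega

theorem leftStep_iff {y w : W} : leftStep cs y w ↔
    (cs.length w = cs.length y + 1 ∨ cs.length y = cs.length w + 1) ∧
      ∃ a, cs.IsLeftDescent y a ∧ ¬ cs.IsLeftDescent w a := by
  rw [leftStep, klPrec_iff cs hij hM hn, klPrec_iff cs hij hM hn]

end DihedralBruhat

section DescentClass

variable {B : Type*} {M : CoxeterMatrix B} {W : Type*} [Group W] (cs : CoxeterSystem M W)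

/-- The elements of `W` whose right descent set is `I`. For dihedral groups these are the left
cells. -/
def descentClass (I : Set B) : Set W := {w | {b | cs.IsRightDescent w b} = I}

theorem inv_mem_descentClass_iff {I : Set B} {w : W} :
    w⁻¹ ∈ descentClass cs I ↔ ∀ b, cs.IsLeftDescent w b ↔ b ∈ I := by
  simp only [descentClass, Set.mem_ofPred_eq, cs.isRightDescent_inv_iff, Set.ext_iff]

theorem descentClass_empty : descentClass cs ∅ = {1} := by
  ext w
  constructor
  · intro h
    by_contra hw
    obtain ⟨b, hb⟩ := cs.exists_rightDescent_of_ne_one hw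
    exact Set.notMem_empty b (h ▸ hb : b ∈ ∅)
  · rintro rfl
    exact Set.eq_empty_of_forall_notMem fun b hb => by simp [CoxeterSystem.IsRightDescent] at hb

end DescentClass

section DihedralDescentClass

variable {M : CoxeterMatrix (Fin 2)} {W : Type*} [Group W] (cs : CoxeterSystem M W)
  {i j : Fin 2} (hij : i ≠ j) {n : ℕ} (hM : M i j = n)

include hij hM

theorem isLeftDescent_walk_iff_eq {k : ℤ} (hpos : 0 < k) (hlt : k < n) (b : Fin 2) :
    cs.IsLeftDescent (walk cs i j k) b ↔ b = i := by
  have hi : cs.IsLeftDescent (walk cs i j k) i :=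
    (isLeftDescent_walk_iff cs hij hM (by omega)).mpr hpos
  refine ⟨fun hb => eq_of_isLeftDescent cs hij hM ?_ hb hi, fun hb => hb ▸ hi⟩
  rw [length_walk cs hij hM (by omega)]
  omega

theorem isLeftDescent_longest (hn : 0 < n) (b : Fin 2) :
    cs.IsLeftDescent (walk cs i j n) b := by
  rcases eq_or_eq_of_ne hij b with rfl | rfl
  · exact (isLeftDescent_walk_iff cs hij hM (by omega)).mpr (by omega)
  · rw [← walk_swap_eq cs hij hM]
    exact (isLeftDescent_walk_iff cs hij.symm (matrix_eq_of_ne hij hM hij.symm) (by omega)).mpr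
      (by omega)

theorem walk_inv_longest : (walk cs i j n)⁻¹ = walk cs i j n := by
  rcases Int.even_or_odd n with even | odd
  · rw [walk_inv_of_even cs i j even, ← walk_swap, walk_swap_eq cs hij hM]
  · exact walk_inv_of_odd cs i j odd

theorem descentClass_univ (hn : 0 < n) : descentClass cs Set.univ = {walk cs i j n} := by
  ext w
  rw [← inv_inv w, inv_mem_descentClass_iff, Set.mem_singleton_iff, inv_eq_iff_eq_inv,
    walk_inv_longest cs hij hM]
  constructor
  · intro h
    obtain ⟨k, hpos, hk, hw⟩ :=
      exists_walk_eq_of_isLeftDescent cs hij hM hn hij ((h i).mpr (Set.mem_univ i))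
    obtain rfl | hlt := hk.eq_or_lt
    · exact hw.symm
    · rw [← hw] at h
      exact absurd ((isLeftDescent_walk_iff_eq cs hij hM hpos hlt j).mp ((h j).mpr trivial))
        hij.symm
  · intro h b
    exact iff_of_true (h ▸ isLeftDescent_longest cs hij hM hn b) (Set.mem_univ b)

theorem mem_descentClass_singleton_iff (hn : 0 < n) {w : W} :
    w ∈ descentClass cs {i} ↔ ∃ k : ℤ, 0 < k ∧ k < n ∧ (walk cs i j k)⁻¹ = w := by
  constructor
  · intro h
    rw [← inv_inv w, inv_mem_descentClass_iff] at h
    obtain ⟨k, hpos, hk, hw⟩ :=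
      exists_walk_eq_of_isLeftDescent cs hij hM hn hij ((h i).mpr rfl)
    refine ⟨k, hpos, hk.lt_of_ne ?_, by rw [hw, inv_inv]⟩
    rintro rfl
    exact hij.symm ((h j).mp (hw ▸ isLeftDescent_longest cs hij hM hn j))
  · rintro ⟨k, hpos, hlt, rfl⟩
    exact (inv_mem_descentClass_iff cs).mpr (isLeftDescent_walk_iff_eq cs hij hM hpos hlt)

end DihedralDescentClass

section DihedralLeftCells

variable {M : CoxeterMatrix (Fin 2)} {W : Type*} [Group W] (cs : CoxeterSystem M W)
  {i j : Fin 2} (hij : i ≠ j) {n : ℕ} (hM : M i j = n) (hn : 0 < n)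

theorem eq_iff_ne_of_ne {i j : Fin 2} (hij : i ≠ j) (b : Fin 2) : b = j ↔ b ≠ i := by
  rcases eq_or_eq_of_ne hij b with rfl | rfl <;> simp [hij, hij.symm]

theorem eq_empty_or_singleton_or_univ {i j : Fin 2} (hij : i ≠ j) (I : Set (Fin 2)) :
    I = ∅ ∨ I = {i} ∨ I = {j} ∨ I = Set.univ := by
  have univ_eq : (Set.univ : Set (Fin 2)) = {i, j} :=
    (Set.eq_univ_of_forall (eq_or_eq_of_ne hij)).symm
  rw [univ_eq, ← Set.subset_pair_iff_eq, ← univ_eq]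
  exact Set.subset_univ I

include hij hM in
theorem isLeftDescent_walk_inv_iff {k : ℤ} (hpos : 0 < k) (hlt : k < n) (b : Fin 2) :
    cs.IsLeftDescent (walk cs i j k)⁻¹ b ↔ (b = i ↔ Odd k) := by
  rcases Int.even_or_odd k with even | odd
  · rw [walk_inv_of_even cs i j even, ← walk_swap, isLeftDescent_walk_iff_eq cs hij.symm
      (matrix_eq_of_ne hij hM hij.symm) hpos hlt, eq_iff_ne_of_ne hij,
      iff_false_right (Int.not_odd_iff_even.mpr even)]
  · rw [walk_inv_of_odd cs i j odd, isLeftDescent_walk_iff_eq cs hij hM hpos hlt,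
      iff_true_right odd]

variable [Fintype W]

include hij hM hn

theorem leftStep_walk_inv {k l : ℤ} (hk : 0 < k ∧ k < n) (hl : 0 < l ∧ l < n)
    (adjacent : l = k + 1 ∨ k = l + 1) :
    leftStep cs (walk cs i j k)⁻¹ (walk cs i j l)⁻¹ := by
  refine (leftStep_iff cs hij hM hn).mpr ⟨?_, ?_⟩
  · rw [cs.length_inv, cs.length_inv, length_walk cs hij hM (by omega),
      length_walk cs hij hM (by omega)]
    omega
  · simp only [isLeftDescent_walk_inv_iff cs hij hM hk.1 hk.2,
      isLeftDescent_walk_inv_iff cs hij hM hl.1 hl.2]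
    have parity : Odd l ↔ ¬ Odd k := by
      grind
    by_cases odd : Odd k
    · exact ⟨i, by simp [odd], by simp [parity, odd]⟩
    · exact ⟨j, by simp [odd, hij.symm], by simp [parity, odd, hij.symm]⟩

theorem leftLE_walk_inv {k l : ℤ} (hk : 0 < k ∧ k < n) (hl : 0 < l ∧ l < n) :
    leftLE cs (walk cs i j k)⁻¹ (walk cs i j l)⁻¹ := by
  let adjacent (a b : ℤ) : Prop := (0 < a ∧ a < n) ∧ (0 < b ∧ b < n) ∧ (b = a + 1 ∨ a = b + 1)
  have path : Relation.ReflTransGen adjacent k l :=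
    reflTransGen_of_succ adjacent
      (fun a ha => ⟨by grind, by grind [Order.succ_eq_add_one], .inl rfl⟩)
      (fun a ha => ⟨by grind [Order.succ_eq_add_one], by grind, .inr rfl⟩)
  exact path.lift _ fun a b h => leftStep_walk_inv cs hij hM hn h.1 h.2.1 h.2.2

theorem isRightDescent_of_leftStep {y w : W} (h : leftStep cs y w) {b : Fin 2}
    (hb : cs.IsRightDescent w b) : cs.IsRightDescent y b := by
  obtain ⟨length_eq, a, hya, hwa⟩ := (leftStep_iff cs hij hM hn).mp h
  obtain ⟨c, hbc⟩ : ∃ c, b ≠ c := (exists_ne b).imp fun _ => Ne.symm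
  have hM₁ := matrix_eq_of_ne hij hM hbc
  have hM₂ := matrix_eq_of_ne hij hM hbc.symm
  rw [← cs.isLeftDescent_inv_iff] at hb ⊢
  obtain ⟨k, hpos, hk, hkw⟩ := exists_walk_eq_of_isLeftDescent cs hij hM hn hbc hb
  obtain rfl : (walk cs b c k)⁻¹ = w := by rw [hkw, inv_inv]
  obtain ⟨l, hl, hly⟩ := exists_walk_eq cs hbc hM₁ hn y⁻¹
  have k_ne : k ≠ n := by
    rintro rfl
    rw [walk_inv_longest cs hbc hM₁] at hwa
    exact hwa (isLeftDescent_longest cs hbc hM₁ hn a)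
  rw [← hly, isLeftDescent_walk_iff cs hbc hM₁ hl]
  by_contra! l_nonpos
  rw [walk_swap cs c b] at hly
  obtain rfl : (walk cs c b (-l))⁻¹ = y := by rw [hly, inv_inv]
  have l_ne : l ≠ 0 := by
    rintro rfl
    simp [CoxeterSystem.IsLeftDescent] at hya
  rw [cs.length_inv, cs.length_inv, length_walk cs hbc hM₁ (by omega),
    length_walk cs hbc.symm hM₂ (by omega)] at length_eq
  rw [isLeftDescent_walk_inv_iff cs hbc.symm hM₂ (by omega) (by omega),
    eq_iff_ne_of_ne hbc] at hya
  rw [isLeftDescent_walk_inv_iff cs hbc hM₁ hpos (by omega)] at hwa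
  grind

theorem isRightDescent_of_leftLE {y w : W} (h : leftLE cs y w) {b : Fin 2}
    (hb : cs.IsRightDescent w b) : cs.IsRightDescent y b := by
  induction h using Relation.ReflTransGen.head_induction_on with
  | refl => exact hb
  | head step _ ih => exact isRightDescent_of_leftStep cs hij hM hn step ih

theorem leftLE_of_mem_descentClass {I : Set (Fin 2)} {y w : W} (hy : y ∈ descentClass cs I)
    (hw : w ∈ descentClass cs I) : leftLE cs y w := by
  rcases eq_empty_or_singleton_or_univ hij I with rfl | rfl | rfl | rfl
  · rw [descentClass_empty] at hy hw
    exact hy ▸ hw ▸ .refl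
  · obtain ⟨k, hk, hk', rfl⟩ := (mem_descentClass_singleton_iff cs hij hM hn).mp hy
    obtain ⟨l, hl, hl', rfl⟩ := (mem_descentClass_singleton_iff cs hij hM hn).mp hw
    exact leftLE_walk_inv cs hij hM hn ⟨hk, hk'⟩ ⟨hl, hl'⟩
  · have hM' := matrix_eq_of_ne hij hM hij.symm
    obtain ⟨k, hk, hk', rfl⟩ := (mem_descentClass_singleton_iff cs hij.symm hM' hn).mp hy
    obtain ⟨l, hl, hl', rfl⟩ := (mem_descentClass_singleton_iff cs hij.symm hM' hn).mp hw
    exact leftLE_walk_inv cs hij.symm hM' hn ⟨hk, hk'⟩ ⟨hl, hl'⟩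
  · rw [descentClass_univ cs hij hM hn] at hy hw
    exact hy ▸ hw ▸ .refl

theorem setOf_leftEquiv_eq_descentClass (w : W) :
    {y | leftEquiv cs y w} = descentClass cs {b | cs.IsRightDescent w b} := by
  ext y
  refine ⟨fun h => Set.Subset.antisymm ?_ ?_, fun h => ⟨?_, ?_⟩⟩
  · exact fun b => isRightDescent_of_leftLE cs hij hM hn h.2
  · exact fun b => isRightDescent_of_leftLE cs hij hM hn h.1
  · exact leftLE_of_mem_descentClass cs hij hM hn h rfl
  · exact leftLE_of_mem_descentClass cs hij hM hn rfl h

omit [Fintype W] in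
theorem descentClass_nonempty (hn' : 2 ≤ n) (I : Set (Fin 2)) : (descentClass cs I).Nonempty := by
  rcases eq_empty_or_singleton_or_univ hij I with rfl | rfl | rfl | rfl
  · rw [descentClass_empty]
    exact Set.singleton_nonempty 1
  · exact ⟨_, (mem_descentClass_singleton_iff cs hij hM hn).mpr ⟨1, by omega, by omega, rfl⟩⟩
  · exact ⟨_, (mem_descentClass_singleton_iff cs hij.symm (matrix_eq_of_ne hij hM hij.symm)
      hn).mpr ⟨1, by omega, by omega, rfl⟩⟩
  · rw [descentClass_univ cs hij hM hn]
    exact Set.singleton_nonempty _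

theorem setOf_isLeftCell_eq_range (hn' : 2 ≤ n) :
    {Γ : Set W | IsLeftCell cs Γ} = Set.range (descentClass cs) := by
  ext Γ
  constructor
  · rintro ⟨w, rfl⟩
    exact ⟨_, (setOf_leftEquiv_eq_descentClass cs hij hM hn w).symm⟩
  · rintro ⟨I, rfl⟩
    obtain ⟨w, hw⟩ := descentClass_nonempty cs hij hM hn hn' I
    exact ⟨w, by rw [setOf_leftEquiv_eq_descentClass cs hij hM hn, show _ = I from hw]⟩

theorem setOf_isLeftCell_eq (hn' : 2 ≤ n) : {Γ : Set W | IsLeftCell cs Γ} =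
    {{1}, descentClass cs {i}, descentClass cs {j}, {walk cs i j n}} := by
  rw [setOf_isLeftCell_eq_range cs hij hM hn hn', ← descentClass_empty cs,
    ← descentClass_univ cs hij hM hn]
  ext Γ
  constructor
  · rintro ⟨I, rfl⟩
    rcases eq_empty_or_singleton_or_univ hij I with rfl | rfl | rfl | rfl <;> simp
  · rintro (rfl | rfl | rfl | rfl) <;> exact Set.mem_range_self _

theorem ncard_setOf_isLeftCell (hn' : 2 ≤ n) : {Γ : Set W | IsLeftCell cs Γ}.ncard = 4 := by
  have injective : Function.Injective (descentClass cs) := fun I J h => by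
    obtain ⟨w, hw⟩ := descentClass_nonempty cs hij hM hn hn' I
    exact Eq.trans (Eq.symm hw) (h ▸ hw : w ∈ descentClass cs J)
  rw [setOf_isLeftCell_eq_range cs hij hM hn hn', ← Set.image_univ,
    Set.ncard_image_of_injective _ injective, Set.ncard_univ, Nat.card_eq_fintype_card]
  simp

end DihedralLeftCells

section TwistedClassInCells

variable {M : CoxeterMatrix (Fin 2)} {W : Type*} [Group W] (cs : CoxeterSystem M W)

theorem ite_altProd_eq_walk_inv (i j : Fin 2) (k : ℕ) :
    (if Odd k then altProd cs i j k else altProd cs j i k) = (walk cs i j k)⁻¹ := by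
  rw [altProd_eq_walk, altProd_eq_walk]
  split_ifs with h
  · rw [walk_inv_of_odd cs i j (Int.odd_coe_nat k |>.mpr h)]
  · rw [walk_inv_of_even cs i j (Int.even_coe_nat k |>.mpr (Nat.not_odd_iff_even.mp h)), walk_swap]

theorem setOf_ite_altProd_eq_descentClass {i j : Fin 2} (hij : i ≠ j) {m : ℕ}
    (hM : M i j = 2 * m) (hm : 0 < m) :
    {x | ∃ k, 1 ≤ k ∧ k ≤ 2 * m - 1 ∧ x = if Odd k then altProd cs i j k else altProd cs j i k} =
      descentClass cs {i} := by
  ext w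
  rw [mem_descentClass_singleton_iff cs hij hM (by omega)]
  simp only [ite_altProd_eq_walk_inv, Set.mem_ofPred_eq]
  constructor
  · rintro ⟨k, hpos, hlt, rfl⟩
    exact ⟨k, by omega, by omega, rfl⟩
  · rintro ⟨k, hpos, hlt, rfl⟩
    lift k to ℕ using hpos.le
    exact ⟨k, by omega, by omega, rfl⟩

theorem cell1_eq_descentClass {m : ℕ} (hM : M 0 1 = 2 * m) (hm : 0 < m) :
    cell1 cs m = descentClass cs {0} :=
  setOf_ite_altProd_eq_descentClass cs zero_ne_one hM hm

theorem cell2_eq_descentClass {m : ℕ} (hM : M 0 1 = 2 * m) (hm : 0 < m) :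
    cell2 cs m = descentClass cs {1} :=
  setOf_ite_altProd_eq_descentClass cs one_ne_zero (M.symmetric 0 1 ▸ hM) hm

variable {cs} (d : Diamond cs) {i j : Fin 2} (hd : d.toMulEquiv (cs.simple i) = cs.simple j)
  (hij : i ≠ j) {m : ℕ} (hM : M i j = 2 * m)

include hd hij hM

theorem Diamond.conjClass_one_inter_eq_image (hm : 0 < m) :
    d.conjClass 1 ∩ descentClass cs {i} =
      (fun a : ℕ => (walk cs i j (2 * a))⁻¹) '' Finset.Icc 1 (m - 1) := by
  ext w
  rw [Set.mem_inter_iff, d.mem_conjClass_one_iff hd hij,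
    mem_descentClass_singleton_iff cs hij hM (by omega)]
  constructor
  · rintro ⟨⟨a, ha⟩, k, hpos, hlt, rfl⟩
    obtain ⟨b, rfl⟩ : 2 ∣ k := by
      obtain ⟨c, hc⟩ : (2 * (2 * m : ℕ) : ℤ) ∣ 2 * a + k := by
        rwa [eq_inv_iff_mul_eq_one, walk_mul_of_even cs i j (even_two_mul a),
          walk_eq_one_iff cs hij hM] at ha
      exact ⟨m * c * 2 - a, by push_cast at hc; linear_combination hc⟩
    lift b to ℕ using by omega
    exact ⟨b, by simp; omega, rfl⟩
  · rintro ⟨b, hb, rfl⟩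
    simp only [Finset.coe_Icc, Set.mem_Icc] at hb
    exact ⟨⟨-b, by simp only [walk_inv_of_even cs i j (even_two_mul _), mul_neg]⟩,
      2 * b, by omega, by omega, rfl⟩

theorem Diamond.ncard_conjClass_one_inter (hm : 0 < m) :
    (d.conjClass 1 ∩ descentClass cs {i}).ncard = m - 1 := by
  rw [d.conjClass_one_inter_eq_image hd hij hM hm, Set.InjOn.ncard_image,
    Set.ncard_coe_finset, Nat.card_Icc, Nat.add_sub_cancel]
  intro a ha b hb h
  simp only [Finset.coe_Icc, Set.mem_Icc] at ha hb
  have := (walk_eq_walk_iff_of_bounds cs hij hM (by omega) (by omega)).mp (inv_injective h)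
  omega

omit hd hij hM in
theorem Diamond.ncard_conjClass_one_inter_one : (d.conjClass 1 ∩ {1}).ncard = 1 := by
  rw [Set.inter_eq_self_of_subset_right, Set.ncard_singleton]
  exact Set.singleton_subset_iff.mpr (d.conj_refl 1)

omit hM in
theorem Diamond.ncard_conjClass_one_inter_longest {n : ℕ} (hn : Even n) :
    (d.conjClass 1 ∩ {walk cs i j n}).ncard = 1 := by
  obtain ⟨a, rfl⟩ := hn
  rw [Set.inter_eq_self_of_subset_right, Set.ncard_singleton]
  exact Set.singleton_subset_iff.mpr
    ((d.mem_conjClass_one_iff hd hij _).mpr ⟨a, by rw [Nat.cast_add, two_mul]⟩)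

end TwistedClassInCells

section CellCharacters

open scoped Classical

variable {B : Type*} {M : CoxeterMatrix B} {W : Type*} [Group W] (cs : CoxeterSystem M W)

theorem specOne_vpow (a : ℤ) : specOne (vpow a) = 1 := by
  simp [specOne, vpow]

theorem specOne_leftMulSimple (i : B) (h : HeckeModule W) (z : W) :
    specOne (leftMulSimple cs i h z) = specOne (h (cs.simple i * z)) := by
  rw [leftMulSimple_apply]
  split_ifs <;> simp [specOne_vpow]

theorem specOne_leftMulStd (w : W) (h : HeckeModule W) (z : W) :
    specOne (leftMulStd cs w h z) = specOne (h (w⁻¹ * z)) := by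
  have along_word (ω : List B) : ∀ z, specOne ((ω.map (leftMulSimple cs)).prod h z) =
      specOne (h ((cs.wordProd ω)⁻¹ * z)) := by
    induction ω with
    | nil => simp
    | cons b ω ih =>
      intro z
      rw [List.map_cons, List.prod_cons, Module.End.mul_apply, specOne_leftMulSimple, ih,
        cs.wordProd_cons, mul_inv_rev, cs.inv_simple, mul_assoc]
  rw [leftMulStd, along_word, wordProd_redWord]

theorem heckeMul_stdElt (w : W) : heckeMul cs (stdElt w) = leftMulStd cs w := by
  rw [heckeMul, stdElt, Finsupp.linearCombination_single, one_smul]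

/-- The matrix of left translation by `w` on the functions on `W`, in the basis of indicator
functions. -/
def translationMatrix (w : W) : Matrix W W ℚ := Matrix.of fun x z => if x = w * z then 1 else 0

variable [Fintype W]

/-- The transition matrix from the standard basis `(T_x)` to the Kazhdan-Lusztig basis `(C_y)`, at
`v = 1`. -/
def klMatrix : Matrix W W ℚ := Matrix.of fun x y => specOne (klElt cs y x)

theorem klBasis_apply (w : W) : klBasis cs w = klElt cs w := by
  rw [klBasis, Module.Basis.mk_apply]

theorem klMatrix_eq_map_toMatrix :
    klMatrix cs = (Finsupp.basisSingleOne.toMatrix (klBasis cs)).map specOne := by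
  ext x y
  simp [klMatrix, Module.Basis.toMatrix_apply, klBasis_apply]

theorem map_toMatrix_mul_klMatrix :
    ((klBasis cs).toMatrix Finsupp.basisSingleOne).map specOne * klMatrix cs = 1 := by
  rw [klMatrix_eq_map_toMatrix, ← Matrix.map_mul, Module.Basis.toMatrix_mul_toMatrix_flip]
  simp

theorem klMatrix_inv :
    (klMatrix cs)⁻¹ = ((klBasis cs).toMatrix Finsupp.basisSingleOne).map specOne :=
  Matrix.inv_eq_left_inv (map_toMatrix_mul_klMatrix cs)

theorem klMatrix_inv_mul_self : (klMatrix cs)⁻¹ * klMatrix cs = 1 := by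
  rw [klMatrix_inv, map_toMatrix_mul_klMatrix]

theorem klMatrix_mul_inv : klMatrix cs * (klMatrix cs)⁻¹ = 1 :=
  mul_eq_one_comm.mp (klMatrix_inv_mul_self cs)

theorem map_toMatrix_leftMulStd (w : W) :
    (LinearMap.toMatrix Finsupp.basisSingleOne Finsupp.basisSingleOne (leftMulStd cs w)).map
      specOne = translationMatrix w := by
  ext x z
  simp only [Matrix.map_apply, LinearMap.toMatrix_apply, Finsupp.coe_basisSingleOne,
    Finsupp.basisSingleOne_repr, LinearEquiv.refl_apply, specOne_leftMulStd, translationMatrix,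
    Matrix.of_apply, Finsupp.single_apply, eq_inv_mul_iff_mul_eq, eq_comm (a := x)]
  split_ifs <;> simp

theorem cellAction_single (Γ : Set W) (h : HeckeModule W) (y : Γ) :
    cellAction cs Γ h (Finsupp.single y 1) =
      ∑ z : Γ, (klBasis cs).repr (heckeMul cs h (klElt cs y)) z • Finsupp.single z 1 := by
  let expansion : HeckeModule W →ₗ[LaurentRing] (Γ →₀ LaurentRing) :=
    ∑ z : Γ, ((klBasis cs).coord z ∘ₗ (heckeMul cs).flip (klElt cs y)).smulRight
      (Finsupp.single z 1)
  have eq_expansion : (cellAction cs Γ).flip (Finsupp.single y 1) = expansion := by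
    refine (klBasis cs).ext fun x => ?_
    rw [LinearMap.flip_apply, cellAction, Module.Basis.constr_basis,
      Finsupp.linearCombination_single, one_smul]
    simp [expansion, klStructure, klBasis_apply]
  rw [← LinearMap.flip_apply, eq_expansion]
  simp [expansion]

theorem cellMatrix_eq_submatrix (Γ : Set W) (w : W) : cellMatrix cs Γ w =
    ((klMatrix cs)⁻¹ * translationMatrix w * klMatrix cs).submatrix (↑) (↑) := by
  rw [klMatrix_inv, klMatrix_eq_map_toMatrix, ← map_toMatrix_leftMulStd cs, ← Matrix.map_mul,
    ← Matrix.map_mul, basis_toMatrix_mul_linearMap_toMatrix_mul_basis_toMatrix]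
  ext z y
  simp only [cellMatrix, Matrix.map_apply, LinearMap.toMatrix_apply, Finsupp.coe_basisSingleOne,
    Finsupp.basisSingleOne_repr, LinearEquiv.refl_apply, cellAction_single, heckeMul_stdElt,
    Matrix.submatrix_apply, klBasis_apply]
  simp [Finsupp.finsetSum_apply, Finsupp.single_apply]

theorem cellChar_apply (Γ : Set W) (w : W) : cellChar cs Γ w =
    ((∑ y with y ∈ Γ, ((klMatrix cs)⁻¹ * translationMatrix w * klMatrix cs) y y : ℚ) : ℂ) := by
  rw [cellChar, cellMatrix_eq_submatrix, Matrix.trace,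
    Finset.sum_subtype (p := (· ∈ Γ)) (Finset.univ.filter (· ∈ Γ)) (by simp)]
  rfl

end CellCharacters

section RightDescents

open scoped Classical Matrix

/-- If the columns of `b` indexed by `S` span the range of the projection `p`, then the diagonal
entries of `b⁻¹ * a * b` in `S` sum to the trace of `a` on that range. -/
theorem sum_diag_conj_eq_trace {ι R : Type*} [Fintype ι] [CommRing R] {a b p : Matrix ι ι R}
    {S : Set ι} (hb : b⁻¹ * b = 1) (hcomm : a * p = p * a)
    (hmem : ∀ y ∈ S, (p * b).col y = b.col y) (hnotMem : ∀ y ∉ S, (b⁻¹ * p).row y = 0) :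
    ∑ y with y ∈ S, (b⁻¹ * a * b) y y = (p * a).trace := by
  have diag_eq (y : ι) :
      (b⁻¹ * (p * a) * b) y y = if y ∈ S then (b⁻¹ * a * b) y y else 0 := by
    split_ifs with hy
    · rw [← hcomm, ← mul_assoc, mul_assoc, Matrix.mul_apply', Matrix.mul_apply']
      exact congrArg _ (hmem y hy)
    · rw [← mul_assoc, mul_assoc, Matrix.mul_apply', show (b⁻¹ * p) y = 0 from hnotMem y hy,
        zero_dotProduct]
  have trace_conj : (b⁻¹ * (p * a) * b).trace = (p * a).trace := by
    rw [Matrix.trace_mul_comm, ← mul_assoc, mul_eq_one_comm.mp hb, one_mul]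
  rw [← trace_conj, Matrix.trace, Finset.sum_filter]
  exact Finset.sum_congr rfl fun y _ => (diag_eq y).symm

section General

variable {B : Type*} {M : CoxeterMatrix B} {W : Type*} [Group W] (cs : CoxeterSystem M W)

/-- The projection of the functions on `W` onto those with `f (x * s_i) = -f x`. -/
def antisymmetrizer (i : B) : Matrix W W ℚ :=
  (2⁻¹ : ℚ) • (1 - Matrix.of fun x z => if x * cs.simple i = z then 1 else 0)

variable [Fintype W]

theorem antisymmetrizer_mul_apply (i : B) (a : Matrix W W ℚ) (x z : W) :
    (antisymmetrizer cs i * a) x z = (a x z - a (x * cs.simple i) z) / 2 := by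
  rw [antisymmetrizer, Matrix.smul_mul, sub_mul, one_mul, Matrix.smul_apply, Matrix.sub_apply,
    Matrix.mul_apply]
  simp only [Matrix.of_apply, ite_mul, one_mul, zero_mul, Finset.sum_ite_eq, Finset.mem_univ,
    if_true, smul_eq_mul]
  ring

theorem mul_antisymmetrizer_apply (i : B) (a : Matrix W W ℚ) (x z : W) :
    (a * antisymmetrizer cs i) x z = (a x z - a x (z * cs.simple i)) / 2 := by
  rw [antisymmetrizer, Matrix.mul_smul, mul_sub, mul_one, Matrix.smul_apply, Matrix.sub_apply,
    Matrix.mul_apply]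
  simp only [Matrix.of_apply, ← eq_mul_inv_iff_mul_eq, cs.inv_simple, mul_ite, mul_one, mul_zero,
    Finset.sum_ite_eq', Finset.mem_univ, if_true, smul_eq_mul]
  ring

theorem translationMatrix_mul_antisymmetrizer (i : B) (w : W) :
    translationMatrix w * antisymmetrizer cs i = antisymmetrizer cs i * translationMatrix w := by
  ext x z
  simp only [antisymmetrizer_mul_apply, mul_antisymmetrizer_apply, translationMatrix,
    Matrix.of_apply, ← mul_assoc, ← mul_inv_eq_iff_eq_mul (b := cs.simple i), cs.inv_simple]

theorem trace_antisymmetrizer_mul_translationMatrix (i : B) (w : W) :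
    (antisymmetrizer cs i * translationMatrix w).trace =
      ((if w = 1 then Fintype.card W else 0 : ℚ) -
        Finset.card {x | x * cs.simple i = w * x}) / 2 := by
  simp only [Matrix.trace, Matrix.diag_apply, antisymmetrizer_mul_apply, translationMatrix,
    Matrix.of_apply, right_eq_mul, ← Finset.sum_div, Finset.sum_sub_distrib, Finset.sum_boole]
  split_ifs with hw <;> simp [hw]

theorem klMatrix_self (y : W) : klMatrix cs y y = 1 := by
  simp [klMatrix, klElt_apply, klPoly_self, specOne_vpow, ← two_mul]

theorem klMatrix_eq_zero {x y : W} (hne : x ≠ y) (hxy : cs.length y ≤ cs.length x) :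
    klMatrix cs x y = 0 := by
  rw [klMatrix, Matrix.of_apply, klElt_apply, klPoly_eq_zero cs fun h =>
    (bruhatLT_length cs ⟨h, hne⟩).not_ge hxy, map_zero, mul_zero, map_zero]

/-- A component `c y` of maximal length would be the only one visible at `y`, and invisible at
`y * s_b`. -/
theorem eq_zero_of_klMatrix_mulVec_antisymm {b : B} {c : W → ℚ}
    (hc : ∀ z, cs.IsRightDescent z b → c z = 0)
    (hanti : ∀ x, (klMatrix cs *ᵥ c) (x * cs.simple b) = -(klMatrix cs *ᵥ c) x) : c = 0 := by
  by_contra hne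
  obtain ⟨y, hy, hmax⟩ := Finset.exists_max_image {z | c z ≠ 0} cs.length
    (by simpa [Finset.filter_nonempty_iff] using Function.ne_iff.mp hne)
  simp only [Finset.mem_filter_univ] at hy hmax
  have length_mul : cs.length (y * cs.simple b) = cs.length y + 1 :=
    cs.not_isRightDescent_iff.mp (mt (hc y) hy)
  have at_mul : (klMatrix cs *ᵥ c) (y * cs.simple b) = 0 := by
    refine Finset.sum_eq_zero fun z _ => ?_
    by_cases hz : c z = 0
    · rw [hz, mul_zero]
    · have length_le := hmax z hz
      have hne : y * cs.simple b ≠ z := by rintro rfl; lia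
      exact mul_eq_zero_of_left (klMatrix_eq_zero cs hne (by lia)) _
  have at_self : (klMatrix cs *ᵥ c) y = c y := by
    rw [← one_mul (c y), ← klMatrix_self cs y]
    refine Finset.sum_eq_single_of_mem y (Finset.mem_univ y) fun z _ hzy => ?_
    by_cases hz : c z = 0
    · rw [hz, mul_zero]
    · exact mul_eq_zero_of_left (klMatrix_eq_zero cs hzy.symm (hmax z hz)) _
  exact hy (by linarith [hanti y])

end General

section Dihedral

variable {M : CoxeterMatrix (Fin 2)} {W : Type*} [Group W] (cs : CoxeterSystem M W)
  {i j : Fin 2} (hij : i ≠ j) {n : ℕ} (hM : M i j = n)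

include hij hM

theorem eq_of_isRightDescent (hn : 0 < n) {x y : W} {b : Fin 2} (hx : cs.IsRightDescent x b)
    (hy : cs.IsRightDescent y b) (hlen : cs.length x = cs.length y) : x = y := by
  obtain ⟨c, hbc⟩ := exists_ne b
  obtain ⟨k, hk, hkn, hkx⟩ := exists_walk_eq_of_isLeftDescent cs hij hM hn hbc.symm
    (cs.isLeftDescent_inv_iff.mpr hx)
  obtain ⟨l, hl, hln, hly⟩ := exists_walk_eq_of_isLeftDescent cs hij hM hn hbc.symm
    (cs.isLeftDescent_inv_iff.mpr hy)
  have hM' := matrix_eq_of_ne hij hM hbc.symm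
  rw [← cs.length_inv x, ← cs.length_inv y, ← hkx, ← hly, length_walk cs hbc.symm hM' (by lia),
    length_walk cs hbc.symm hM' (by lia)] at hlen
  rw [← inv_inj, ← hkx, ← hly, show k = l by lia]

variable [Fintype W]

theorem klMatrix_apply (hn : 0 < n) (x y : W) : klMatrix cs x y =
    if x = y ∨ cs.length x < cs.length y then (-1) ^ (cs.length y + cs.length x) else 0 := by
  rw [klMatrix, Matrix.of_apply, klElt_eq_ballElt cs hij hM hn, ballElt_apply]
  split_ifs
  · rw [← neg_one_pow_mul_vpow, map_mul, specOne_vpow, mul_one, map_pow, map_neg, map_one]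
  · exact map_zero _

theorem klMatrix_mul_simple (hn : 0 < n) {y : W} {b : Fin 2} (hy : cs.IsRightDescent y b) (x : W) :
    klMatrix cs (x * cs.simple b) y = -klMatrix cs x y := by
  have mono (x : W) (hx : x = y ∨ cs.length x < cs.length y) :
      x * cs.simple b = y ∨ cs.length (x * cs.simple b) < cs.length y := by
    rcases hx with rfl | hx
    · exact Or.inr hy
    · rcases cs.length_mul_simple x b with h | h
      · rw [h, or_iff_not_imp_right]
        intro hle
        refine eq_of_isRightDescent cs hij hM hn ?_ hy (by lia)
        rw [CoxeterSystem.IsRightDescent, cs.simple_mul_simple_cancel_right]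
        lia
      · exact Or.inr (by lia)
  have mono_iff : (x * cs.simple b = y ∨ cs.length (x * cs.simple b) < cs.length y) ↔
      x = y ∨ cs.length x < cs.length y :=
    ⟨fun h => by simpa using mono (x * cs.simple b) h, mono x⟩
  have sign_eq : (-1 : ℚ) ^ cs.length (x * cs.simple b) = -(-1) ^ cs.length x := by
    rcases cs.length_mul_simple x b with h | h
    · rw [h, pow_succ, mul_neg_one]
    · rw [← h, pow_succ, mul_neg_one, neg_neg]
  rw [klMatrix_apply cs hij hM hn, klMatrix_apply cs hij hM hn, if_congr mono_iff rfl rfl,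
    pow_add, pow_add, sign_eq]
  split_ifs <;> ring

theorem klMatrix_inv_mulVec_eq_zero (hn : 0 < n) {b : Fin 2} {f : W → ℚ}
    (hf : ∀ x, f (x * cs.simple b) = -f x) {y : W} (hy : ¬ cs.IsRightDescent y b) :
    ((klMatrix cs)⁻¹ *ᵥ f) y = 0 := by
  set c := (klMatrix cs)⁻¹ *ᵥ f with hc
  let c₁ (z : W) : ℚ := if cs.IsRightDescent z b then c z else 0
  have antisymm (x : W) :
      (klMatrix cs *ᵥ c₁) (x * cs.simple b) = -(klMatrix cs *ᵥ c₁) x := by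
    simp only [Matrix.mulVec, dotProduct, ← Finset.sum_neg_distrib]
    refine Finset.sum_congr rfl fun z _ => ?_
    by_cases hz : cs.IsRightDescent z b
    · rw [klMatrix_mul_simple cs hij hM hn hz, neg_mul]
    · simp [c₁, hz]
  have sub_eq_zero : c - c₁ = 0 := by
    refine eq_zero_of_klMatrix_mulVec_antisymm cs (b := b) (fun z hz => by simp [c₁, hz])
      fun x => ?_
    rw [Matrix.mulVec_sub, hc, Matrix.mulVec_mulVec, klMatrix_mul_inv, Matrix.one_mulVec,
      Pi.sub_apply, Pi.sub_apply, hf, antisymm]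
    ring
  simpa [c₁, hy] using congrFun sub_eq_zero y

theorem sum_diag_klMatrix_conj_translationMatrix (hn : 0 < n) (b : Fin 2) (w : W) :
    ∑ y with cs.IsRightDescent y b,
        ((klMatrix cs)⁻¹ * translationMatrix w * klMatrix cs) y y =
      ((if w = 1 then Fintype.card W else 0 : ℚ) -
        Finset.card {x | x * cs.simple b = w * x}) / 2 := by
  rw [← trace_antisymmetrizer_mul_translationMatrix]
  refine sum_diag_conj_eq_trace (S := {y | cs.IsRightDescent y b}) (klMatrix_inv_mul_self cs)
    (translationMatrix_mul_antisymmetrizer cs b w) (fun y hy => ?_) fun y hy => ?_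
  · ext x
    rw [Matrix.col_apply, Matrix.col_apply, antisymmetrizer_mul_apply,
      klMatrix_mul_simple cs hij hM hn hy]
    ring
  · ext z
    refine klMatrix_inv_mulVec_eq_zero cs hij hM hn (f := fun x => antisymmetrizer cs b x z)
      (fun x => ?_) hy
    rw [← mul_one (antisymmetrizer cs b), antisymmetrizer_mul_apply, antisymmetrizer_mul_apply,
      cs.simple_mul_simple_cancel_right]
    ring

end Dihedral

end RightDescents

section DihedralCellCharacters

open scoped Classical Matrix

variable {M : CoxeterMatrix (Fin 2)} {W : Type*} [Group W] [Fintype W] (cs : CoxeterSystem M W)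
  {i j : Fin 2} (hij : i ≠ j) {n : ℕ} (hM : M i j = n)

theorem cellChar_singleton (y w : W) : cellChar cs {y} w =
    (((klMatrix cs)⁻¹ * translationMatrix w * klMatrix cs) y y : ℚ) := by
  simp [cellChar_apply, Finset.sum_filter]

theorem translationMatrix_mul_apply (w : W) (a : Matrix W W ℚ) (x z : W) :
    (translationMatrix w * a) x z = a (w⁻¹ * x) z := by
  simp [Matrix.mul_apply, translationMatrix, ← inv_mul_eq_iff_eq_mul]

include hij hM

theorem sum_klMatrix (hn : 0 < n) (y : W) : ∑ x, klMatrix cs x y = if y = 1 then 1 else 0 := by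
  split_ifs with hy
  · rw [Finset.sum_eq_single 1, hy, klMatrix_self]
    · exact fun x _ hx => klMatrix_eq_zero cs (hy ▸ hx) (by simp [hy])
    · simp
  · obtain ⟨b, hb⟩ := cs.exists_rightDescent_of_ne_one hy
    have sum_eq_neg : ∑ x, klMatrix cs x y = -∑ x, klMatrix cs x y := by
      rw [← Finset.sum_neg_distrib, ← Equiv.sum_comp (Equiv.mulRight (cs.simple b))]
      exact Finset.sum_congr rfl fun x _ => klMatrix_mul_simple cs hij hM hn hb x
    linarith

theorem cellChar_singleton_one (hn : 0 < n) : cellChar cs {1} = fun _ => 1 := by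
  have vecMul_one : (1 : W → ℚ) ᵥ* klMatrix cs = Pi.single 1 1 := by
    ext y
    simp [Matrix.vecMul, dotProduct, sum_klMatrix cs hij hM hn, Pi.single_apply]
  have row_one : (klMatrix cs)⁻¹.row 1 = 1 := by
    rw [← Matrix.single_one_vecMul, ← vecMul_one, Matrix.vecMul_vecMul, klMatrix_mul_inv,
      Matrix.vecMul_one]
  funext w
  rw [cellChar_singleton, mul_assoc, Matrix.mul_apply]
  simp only [translationMatrix_mul_apply]
  rw [Finset.sum_eq_single w, inv_mul_cancel, klMatrix_self, mul_one,
    show (klMatrix cs)⁻¹ 1 w = 1 from congrFun row_one w, Rat.cast_one]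
  · intro x _ hx
    rw [klMatrix_eq_zero cs (by simpa [inv_mul_eq_one] using hx.symm) (by simp), mul_zero]
  · simp

theorem klMatrix_longest (hn : 0 < n) (x : W) :
    klMatrix cs x (walk cs i j n) = (-1) ^ (n + cs.length x) := by
  have length_longest : cs.length (walk cs i j n) = n := length_walk cs hij hM (by simp)
  rw [klMatrix_apply cs hij hM hn, length_longest, if_pos]
  obtain ⟨k, hk, rfl⟩ := exists_walk_eq cs hij hM hn x
  rcases hk.2.eq_or_lt with rfl | hlt
  · exact Or.inl rfl
  · exact Or.inr ((length_walk_le cs k).trans_lt (by omega))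

theorem cellChar_singleton_longest (hn : 0 < n) :
    cellChar cs {walk cs i j n} = fun w => (-1) ^ cs.length w := by
  funext w
  have sign_eq (x : W) :
      (-1 : ℚ) ^ cs.length (w⁻¹ * x) = (-1) ^ cs.length w * (-1) ^ cs.length x := by
    rw [neg_one_pow_eq_pow_mod_two, cs.length_mul_mod_two, ← neg_one_pow_eq_pow_mod_two,
      cs.length_inv, pow_add]
  have eigenvector (x : W) : (translationMatrix w * klMatrix cs) x (walk cs i j n) =
      (-1) ^ cs.length w * klMatrix cs x (walk cs i j n) := by
    rw [translationMatrix_mul_apply, klMatrix_longest cs hij hM hn, klMatrix_longest cs hij hM hn,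
      pow_add, pow_add, sign_eq, mul_left_comm]
  rw [cellChar_singleton, mul_assoc, Matrix.mul_apply]
  simp only [eigenvector, mul_left_comm, ← Finset.mul_sum, ← Matrix.mul_apply,
    klMatrix_inv_mul_self, Matrix.one_apply_eq]
  simp

omit [Fintype W] hM in
theorem isRightDescent_iff_mem_descentClass (y : W) : cs.IsRightDescent y i ↔
    y ∈ descentClass cs {i} ∨ y ∈ descentClass cs Set.univ := by
  constructor
  · intro hy
    rcases eq_empty_or_singleton_or_univ hij {b | cs.IsRightDescent y b} with h | h | h | h
    · exact absurd (h ▸ hy : i ∈ (∅ : Set (Fin 2))) (Set.notMem_empty i)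
    · exact Or.inl h
    · exact absurd (h ▸ hy : i ∈ ({j} : Set (Fin 2))) hij
    · exact Or.inr h
  · rintro (hy | hy)
    · exact (Set.ext_iff.mp hy i).mpr rfl
    · exact (Set.ext_iff.mp hy i).mpr trivial

theorem cellChar_descentClass_add (hn : 0 < n) (w : W) :
    cellChar cs (descentClass cs {i}) w + (-1) ^ cs.length w =
      ((if w = 1 then 2 * n else 0) - Finset.card {x | x * cs.simple i = w * x}) / 2 := by
  have disjoint (y : W) (hy : y ∈ descentClass cs {i}) : y ∉ descentClass cs Set.univ :=
    fun hy' => hij (Set.mem_singleton_iff.mp ((hy.symm.trans hy').ge (Set.mem_univ j))).symm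
  rw [← congrFun (cellChar_singleton_longest cs hij hM hn) w, ← descentClass_univ cs hij hM hn,
    cellChar_apply, cellChar_apply, ← Rat.cast_add, ← Finset.sum_union
    (Finset.disjoint_filter.mpr fun y _ => disjoint y), ← Finset.filter_or]
  simp only [← isRightDescent_iff_mem_descentClass cs hij,
    sum_diag_klMatrix_conj_translationMatrix cs hij hM hn, card_eq cs hij hM hn]
  split_ifs <;> push_cast <;> rfl

omit [Fintype W] in
theorem walk_mul_simple_eq_walk_mul_walk_iff (c l : ℤ) :
    walk cs i j l * cs.simple i = walk cs i j (2 * c + 1) * walk cs i j l ↔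
      if Even l then (n : ℤ) ∣ l - c else (n : ℤ) ∣ l - (c + 1) := by
  rw [← walk_one cs i j, walk_mul_of_odd cs i j (odd_two_mul_add_one c)]
  split_ifs with even
  · rw [walk_mul_of_even cs i j even, walk_eq_walk_iff cs hij hM,
      show l + 1 - (2 * c + 1 - l) = 2 * (l - c) by ring, mul_dvd_mul_iff_left two_ne_zero]
  · rw [walk_mul_of_odd cs i j (Int.not_even_iff_odd.mp even), walk_eq_walk_iff cs hij hM,
      show l - 1 - (2 * c + 1 - l) = 2 * (l - (c + 1)) by ring, mul_dvd_mul_iff_left two_ne_zero]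

theorem filter_walk_mul_eq_of_even (hn : 0 < n) (hn' : Even n) {c : ℤ} (hc : Even c) :
    ({x | x * cs.simple i = walk cs i j (2 * c + 1) * x} : Finset W) =
      {walk cs i j c, walk cs i j (c + n), walk cs i j (c + 1), walk cs i j (c + 1 + n)} := by
  ext x
  obtain ⟨l, -, rfl⟩ := exists_walk_eq cs hij hM hn x
  have dvd_iff (d : ℤ) : (n : ℤ) ∣ d ↔ 2 * (n : ℤ) ∣ d ∨ 2 * (n : ℤ) ∣ d - n := by
    constructor
    · rintro ⟨q, rfl⟩
      obtain ⟨q, rfl | rfl⟩ := Int.even_or_odd' q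
      · exact Or.inl ⟨q, by ring⟩
      · exact Or.inr ⟨q, by ring⟩
    · rintro (h | h)
      · exact dvd_of_mul_left_dvd h
      · exact (dvd_sub_self_right).mp (dvd_of_mul_left_dvd h)
  simp only [Finset.mem_filter_univ, walk_mul_simple_eq_walk_mul_walk_iff cs hij hM,
    Finset.mem_insert, Finset.mem_singleton, walk_eq_walk_iff cs hij hM, ← sub_sub _ _ (n : ℤ)]
  rw [← or_assoc, ← dvd_iff, ← dvd_iff]
  split_ifs with hl
  · exact (or_iff_left fun h => by grind [((Int.even_coe_nat n).mpr hn').trans_dvd h]).symm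
  · exact (or_iff_right fun h => by grind [((Int.even_coe_nat n).mpr hn').trans_dvd h]).symm

theorem card_conjugating_simple (hn : 1 < n) (hn' : Even n) (c : ℤ) :
    Finset.card {x | x * cs.simple i = walk cs i j (2 * c + 1) * x} = if Even c then 4 else 0 := by
  split_ifs with hc
  · rw [filter_walk_mul_eq_of_even cs hij hM (by omega) hn' hc]
    have odd_ne {k l : ℤ} (hkl : Odd (k - l)) : walk cs i j k ≠ walk cs i j l := fun h =>
      Int.not_even_iff_odd.mpr hkl
        (even_iff_two_dvd.mpr (dvd_of_mul_right_dvd ((walk_eq_walk_iff cs hij hM).mp h)))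
    have add_ne (k : ℤ) : walk cs i j k ≠ walk cs i j (k + n) := by
      rw [Ne, walk_eq_walk_iff cs hij hM, sub_add_cancel_left, dvd_neg]
      exact fun h => absurd (Int.le_of_dvd (by omega) h) (by omega)
    rw [Finset.card_insert_of_notMem, Finset.card_insert_of_notMem, Finset.card_pair (add_ne _)]
    · simp [odd_ne, hn', parity_simps]
    · simp [odd_ne, hn', parity_simps, add_ne]
  · rw [Finset.card_eq_zero, Finset.filter_eq_empty_iff]
    intro x _
    obtain ⟨l, -, rfl⟩ := exists_walk_eq cs hij hM (by omega) x
    rw [walk_mul_simple_eq_walk_mul_walk_iff cs hij hM]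
    split_ifs with hl
    all_goals exact fun h => by grind [((Int.even_coe_nat n).mpr hn').trans_dvd h]

theorem cellChar_descentClass_walk_two_mul (hn : 0 < n) (a : ℤ) :
    cellChar cs (descentClass cs {i}) (walk cs i j (2 * a)) =
      (if (n : ℤ) ∣ a then (n : ℂ) else 0) - 1 := by
  have sum_eq := cellChar_descentClass_add cs hij hM hn (walk cs i j (2 * a))
  have no_fixed : Finset.card {x | x * cs.simple i = walk cs i j (2 * a) * x} = 0 := by
    rw [Finset.card_eq_zero, Finset.filter_eq_empty_iff]
    intro x _ hx
    have isReflection : cs.IsReflection (walk cs i j (2 * a)) :=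
      ⟨x, i, eq_mul_inv_of_mul_eq hx.symm⟩
    exact Nat.not_even_iff_odd.mpr isReflection.odd_length
      ((even_length_walk_iff cs i j _).mpr (even_two_mul a))
  simp only [no_fixed, neg_one_pow_length_walk, even_two_mul, if_true,
    walk_eq_one_iff cs hij hM, mul_dvd_mul_iff_left (two_ne_zero' ℤ)] at sum_eq
  rw [eq_sub_iff_add_eq, sum_eq]
  split_ifs <;> simp

theorem cellChar_descentClass_walk_two_mul_add_one (hn : 1 < n) (hn' : Even n) (c : ℤ) :
    cellChar cs (descentClass cs {i}) (walk cs i j (2 * c + 1)) = if Even c then -1 else 1 := by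
  have sum_eq := cellChar_descentClass_add cs hij hM (by omega) (walk cs i j (2 * c + 1))
  rw [card_conjugating_simple cs hij hM hn hn', neg_one_pow_length_walk, if_neg (by grind),
    if_neg] at sum_eq
  · rw [← sub_eq_add_neg, sub_eq_iff_eq_add] at sum_eq
    rw [sum_eq]
    split_ifs <;> norm_num
  · intro h
    exact Int.not_even_two_mul_add_one c ((even_length_walk_iff cs i j _).mp (by simp [h]))

end DihedralCellCharacters

section Irreducible

variable {k G V : Type*} [Field k] [Group G] [AddCommGroup V] [Module k V]
  {ρ : Representation k G V}

theorem isIrreducible_of_forall_eq_bot_or_eq_top [Nontrivial V]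
    (h : ∀ S : Submodule k V, (∀ g, ∀ x ∈ S, ρ g x ∈ S) → S = ⊥ ∨ S = ⊤) : ρ.IsIrreducible where
  exists_pair_ne := ⟨⊥, ⊤, fun eq => bot_ne_top (congrArg Subrepresentation.toSubmodule eq)⟩
  eq_bot_or_eq_top S := (h S.toSubmodule fun g _ hx => S.apply_mem_toSubmodule g hx).imp
    (fun eq => Subrepresentation.toSubmodule_injective eq)
    fun eq => Subrepresentation.toSubmodule_injective eq

theorem eq_bot_or_eq_top_of_isIrreducible (hρ : ρ.IsIrreducible) {S : Submodule k V}
    (hS : ∀ g, ∀ x ∈ S, ρ g x ∈ S) : S = ⊥ ∨ S = ⊤ :=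
  (hρ.eq_bot_or_eq_top ⟨S, fun g _ hx => hS g _ hx⟩).imp
    (congrArg Subrepresentation.toSubmodule) (congrArg Subrepresentation.toSubmodule)

theorem nontrivial_of_isIrreducible (hρ : ρ.IsIrreducible) : Nontrivial V := by
  by_contra trivial
  rw [not_nontrivial_iff_subsingleton] at trivial
  exact bot_ne_top (α := Subrepresentation ρ)
    (Subrepresentation.toSubmodule_injective (Subsingleton.elim _ _))

theorem zpow_apply_of_apply_eq_smul {g : G} {v : V} {c : k} (hc : c ≠ 0)
    (h : ρ g v = c • v) (a : ℤ) : ρ (g ^ a) v = c ^ a • v := by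
  have apply_inv : ρ g⁻¹ v = c⁻¹ • v := by
    rw [eq_inv_smul_iff₀ hc, ← map_smul, ← h, Representation.inv_self_apply]
  induction a with
  | zero => simp
  | succ a ih => rw [zpow_add_one, map_mul, Module.End.mul_apply, h, map_smul, ih, smul_smul,
      zpow_add_one₀ hc, mul_comm]
  | pred a ih => rw [zpow_sub_one, map_mul, Module.End.mul_apply, apply_inv, map_smul, ih,
      smul_smul, zpow_sub_one₀ hc, mul_comm]

end Irreducible

theorem trace_eq_det_of_finrank_eq_one {k V : Type*} [Field k] [AddCommGroup V] [Module k V]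
    (h : Module.finrank k V = 1) (f : Module.End k V) :
    LinearMap.trace k V f = LinearMap.det f := by
  have : FiniteDimensional k V := Module.finite_of_finrank_eq_succ h
  let b := Module.finBasisOfFinrankEq k V h
  rw [LinearMap.trace_eq_matrix_trace k b, ← LinearMap.det_toMatrix b, Matrix.trace_fin_one,
    Matrix.det_fin_one]

section SignCharacters

variable {G : Type*} [Group G]

/-- A homomorphism to the units `±1` of `ℤ`, regarded as a complex-valued character. -/
def signChar (f : G →* ℤˣ) : G → ℂ := fun g => ((f g : ℤ) : ℂ)

theorem signChar_apply (f : G →* ℤˣ) (g : G) : signChar f g = ((f g : ℤ) : ℂ) := rfl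

theorem signChar_one (f : G →* ℤˣ) : signChar f 1 = 1 := by simp [signChar_apply]

theorem signChar_injective : Function.Injective (signChar (G := G)) := fun _ _ h =>
  MonoidHom.ext fun g => Units.ext (Int.cast_injective (congrFun h g))

theorem signChar_mem_irrChars (f : G →* ℤˣ) : signChar f ∈ irrChars G := by
  let ρ : Representation ℂ G (Fin 1 → ℂ) := (algebraMap ℂ _).toMonoidHom.comp
    ((Int.castRingHom ℂ).toMonoidHom.comp ((Units.coeHom ℤ).comp f))
  have : IsSimpleModule ℂ (Fin 1 → ℂ) := isSimpleModule_iff_finrank_eq_one.mpr (by simp)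
  refine ⟨1, ρ, isIrreducible_of_forall_eq_bot_or_eq_top fun S _ => eq_bot_or_eq_top S,
    funext fun g => ?_⟩
  have apply_eq : ρ g = signChar f g • 1 :=
    Algebra.algebraMap_eq_smul_one (A := Module.End ℂ (Fin 1 → ℂ)) (signChar f g)
  rw [Representation.character, apply_eq, map_smul, LinearMap.trace_one]
  simp

variable {B : Type*} {M : CoxeterMatrix B} {W : Type*} [Group W] (cs : CoxeterSystem M W)

include cs

theorem exists_coe_eq_signChar (c : W →* ℂ) : ∃ f : W →* ℤˣ, ⇑c = signChar f := by
  have sign (w : W) : ∃ ε : ℤˣ, ((ε : ℤ) : ℂ) = c w := by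
    induction w using cs.simple_induction with
    | simple b =>
      have square : c (cs.simple b) * c (cs.simple b) = 1 := by
        rw [← map_mul, cs.simple_mul_simple_self, map_one]
      rcases mul_self_eq_one_iff.mp square with h | h
      · exact ⟨1, by simp [h]⟩
      · exact ⟨-1, by simp [h]⟩
    | one => exact ⟨1, by simp⟩
    | mul w w' hw hw' =>
      obtain ⟨⟨ε, hε⟩, ε', hε'⟩ := And.intro hw hw'
      exact ⟨ε * ε', by rw [map_mul, ← hε, ← hε']; push_cast; rfl⟩
  choose f hf using sign
  have f_mul (w w' : W) : f (w * w') = f w * f w' := by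
    refine Units.ext (Int.cast_injective (α := ℂ) ?_)
    rw [Units.val_mul, Int.cast_mul, hf, hf, hf, map_mul]
  exact ⟨MonoidHom.mk' f f_mul, funext fun w => (hf w).symm⟩

theorem exists_character_eq_signChar {V : Type*} [AddCommGroup V] [Module ℂ V]
    (ρ : Representation ℂ W V) (h : Module.finrank ℂ V = 1) :
    ∃ f : W →* ℤˣ, ρ.character = signChar f := by
  obtain ⟨f, hf⟩ := exists_coe_eq_signChar cs (LinearMap.det.comp ρ)
  exact ⟨f, hf ▸ funext fun w => trace_eq_det_of_finrank_eq_one h (ρ w)⟩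

end SignCharacters

theorem add_inv_eq_add_inv_iff {K : Type*} [Field K] {a b : K} (ha : a ≠ 0) (hb : b ≠ 0) :
    a + a⁻¹ = b + b⁻¹ ↔ a = b ∨ a = b⁻¹ := by
  have factor : (a - b) * (a - b⁻¹) = a * (a + a⁻¹ - (b + b⁻¹)) := by field_simp; ring
  rw [← sub_eq_zero, ← mul_eq_zero_iff_left ha, ← factor, mul_eq_zero, sub_eq_zero,
    sub_eq_zero]

theorem funext_walk {M : CoxeterMatrix (Fin 2)} {W α : Type*} [Group W] (cs : CoxeterSystem M W)
    {i j : Fin 2} (hij : i ≠ j) {n : ℕ} (hM : M i j = n) (hn : 0 < n) {φ ψ : W → α}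
    (even : ∀ a : ℤ, φ (walk cs i j (2 * a)) = ψ (walk cs i j (2 * a)))
    (odd : ∀ a : ℤ, φ (walk cs i j (2 * a + 1)) = ψ (walk cs i j (2 * a + 1))) : φ = ψ := by
  funext w
  obtain ⟨k, -, rfl⟩ := exists_walk_eq cs hij hM hn w
  obtain ⟨a, rfl | rfl⟩ := Int.even_or_odd' k
  exacts [even a, odd a]

section DihedralCharacter

variable {M : CoxeterMatrix (Fin 2)} {W : Type*} [Group W] (cs : CoxeterSystem M W) (ζ : ℂ)

/-- The character of the two-dimensional representation of a dihedral group in which a generating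
rotation has the eigenvalues `ζ` and `ζ⁻¹`. An element of even length `2a` is the `a`-th power of
the rotation or of its inverse, so that the length determines the value. -/
def dihedralChar : W → ℂ := fun w =>
  if Even (cs.length w) then ζ ^ (cs.length w / 2) + ζ⁻¹ ^ (cs.length w / 2) else 0

theorem dihedralChar_inv : dihedralChar cs ζ⁻¹ = dihedralChar cs ζ := by
  funext w
  simp only [dihedralChar, inv_inv, add_comm]

theorem dihedralChar_one : dihedralChar cs ζ 1 = 2 := by
  simp [dihedralChar, one_add_one_eq_two]

theorem dihedralChar_walk_two_mul_add_one (i j : Fin 2) (a : ℤ) :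
    dihedralChar cs ζ (walk cs i j (2 * a + 1)) = 0 :=
  if_neg (by rw [even_length_walk_iff, Int.not_even_iff_odd]; exact odd_two_mul_add_one a)

variable {ζ} {i j : Fin 2} (hij : i ≠ j) {n : ℕ} (hM : M i j = n) (hn : 0 < n)

include hij hM hn

theorem dihedralChar_walk_two_mul (hζ : ζ ^ n = 1) (a : ℤ) :
    dihedralChar cs ζ (walk cs i j (2 * a)) = ζ ^ a + ζ ^ (-a) := by
  obtain ⟨k, bounds, hk⟩ := exists_walk_eq cs hij hM hn (walk cs i j (2 * a))
  obtain ⟨c, hc⟩ := (walk_eq_walk_iff cs hij hM).mp hk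
  obtain ⟨b, rfl⟩ : Even k := by rw [← sub_add_cancel k (2 * a), hc]; simp [parity_simps]
  obtain rfl : a = b - n * c := by linarith
  have ζ_ne : ζ ≠ 0 := by rintro rfl; simp [hn.ne'] at hζ
  have period : ζ ^ (b - n * c) = ζ ^ b := by
    rw [zpow_sub₀ ζ_ne, zpow_mul, zpow_natCast, hζ, one_zpow, div_one]
  rw [zpow_neg, period, ← hk, dihedralChar, length_walk cs hij hM (by omega),
    if_pos (by rw [Int.natAbs_even]; exact ⟨b, rfl⟩), show (b + b).natAbs / 2 = b.natAbs by omega,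
    inv_pow]
  rcases b.natAbs_eq with h | h <;> nth_rewrite 3 4 [h]
  · rw [zpow_natCast]
  · rw [zpow_neg, zpow_natCast, inv_inv, add_comm]

theorem dihedralChar_walk_two_eq_iff {ξ : ℂ} (hζ : ζ ^ n = 1) (hξ : ξ ^ n = 1) :
    dihedralChar cs ζ (walk cs i j 2) = dihedralChar cs ξ (walk cs i j 2) ↔
      ζ = ξ ∨ ζ = ξ⁻¹ := by
  have apply_walk_two {η : ℂ} (hη : η ^ n = 1) :
      dihedralChar cs η (walk cs i j 2) = η + η⁻¹ := by
    simpa using dihedralChar_walk_two_mul cs hij hM hn hη 1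
  rw [apply_walk_two hζ, apply_walk_two hξ, add_inv_eq_add_inv_iff]
  · rintro rfl; simp [hn.ne'] at hζ
  · rintro rfl; simp [hn.ne'] at hξ

theorem eq_dihedralChar (hζ : ζ ^ n = 1) {ψ : W → ℂ}
    (even : ∀ a : ℤ, ψ (walk cs i j (2 * a)) = ζ ^ a + ζ ^ (-a))
    (odd : ∀ a : ℤ, ψ (walk cs i j (2 * a + 1)) = 0) : ψ = dihedralChar cs ζ :=
  funext_walk cs hij hM hn
    (fun a => by rw [even, dihedralChar_walk_two_mul cs hij hM hn hζ])
    fun a => by rw [odd, dihedralChar_walk_two_mul_add_one]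

end DihedralCharacter

section DihedralRepresentation

variable {M : CoxeterMatrix (Fin 2)} {W : Type*} [Group W] (cs : CoxeterSystem M W)
  {V : Type*} [AddCommGroup V] [Module ℂ V] (ρ : Representation ℂ W V) {i j : Fin 2}

theorem simple_apply_simple_apply (b : Fin 2) (x : V) :
    ρ (cs.simple b) (ρ (cs.simple b) x) = x := by
  rw [← Module.End.mul_apply, ← map_mul, cs.simple_mul_simple_self, map_one, Module.End.one_apply]

theorem apply_mem_of_simple_apply_mem (hij : i ≠ j) {S : Submodule ℂ V}
    (reflection : ∀ x ∈ S, ρ (cs.simple i) x ∈ S)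
    (rotation : ∀ x ∈ S, ρ (cs.simple i * cs.simple j) x ∈ S) (w : W) : ∀ x ∈ S, ρ w x ∈ S := by
  induction w using cs.simple_induction_left with
  | one => simp
  | mul_simple_left w b ih =>
    intro x hx
    rw [map_mul, Module.End.mul_apply]
    rcases eq_or_eq_of_ne hij b with rfl | rfl
    · exact reflection _ (ih x hx)
    · have := reflection _ (rotation _ (ih x hx))
      rwa [map_mul, Module.End.mul_apply, simple_apply_simple_apply] at this

variable {ρ}

section Eigenvector

variable {v : V} {ζ : ℂ} (hζ : ζ ≠ 0) (rotation : ρ (cs.simple i * cs.simple j) v = ζ • v)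

include hζ rotation

theorem zpow_apply_simple_apply (a : ℤ) :
    ρ ((cs.simple i * cs.simple j) ^ a) (ρ (cs.simple i) v) = ζ ^ (-a) • ρ (cs.simple i) v := by
  rw [← Module.End.mul_apply, ← map_mul, ← neg_neg a, ← simple_mul_zpow, map_mul,
    Module.End.mul_apply, zpow_apply_of_apply_eq_smul hζ rotation, map_smul, neg_neg]

theorem rotation_apply_simple_apply :
    ρ (cs.simple i * cs.simple j) (ρ (cs.simple i) v) = ζ⁻¹ • ρ (cs.simple i) v := by
  simpa using zpow_apply_simple_apply cs hζ rotation 1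

theorem span_eigenvector_eq_top (hij : i ≠ j) (hρ : ρ.IsIrreducible) (hv : v ≠ 0) :
    Submodule.span ℂ {v, ρ (cs.simple i) v} = ⊤ := by
  have rotation' := rotation_apply_simple_apply cs hζ rotation
  refine (eq_bot_or_eq_top_of_isIrreducible hρ (apply_mem_of_simple_apply_mem cs ρ hij
    (fun x hx => ?_) fun x hx => ?_)).resolve_left fun bot => hv ?_
  · obtain ⟨a, b, rfl⟩ := Submodule.mem_span_pair.mp hx
    rw [map_add, map_smul, map_smul, simple_apply_simple_apply, add_comm]
    exact Submodule.mem_span_pair.mpr ⟨b, a, rfl⟩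
  · obtain ⟨a, b, rfl⟩ := Submodule.mem_span_pair.mp hx
    rw [map_add, map_smul, map_smul, rotation, rotation', smul_smul, smul_smul]
    exact Submodule.mem_span_pair.mpr ⟨_, _, rfl⟩
  · rw [Submodule.span_eq_bot] at bot
    exact bot v (by simp)

end Eigenvector

section Basis

variable (b : Module.Basis (Fin 2) ℂ V) {ζ : ℂ} (hζ : ζ ≠ 0)
  (rotation : ρ (cs.simple i * cs.simple j) (b 0) = ζ • b 0)
  (reflection : ρ (cs.simple i) (b 0) = b 1)

include hζ rotation reflection

theorem character_walk_two_mul (a : ℤ) :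
    ρ.character (walk cs i j (2 * a)) = ζ ^ a + ζ ^ (-a) := by
  have h₀ := zpow_apply_of_apply_eq_smul hζ rotation a
  have h₁ := zpow_apply_simple_apply cs hζ rotation a
  rw [reflection] at h₁
  rw [walk_two_mul, Representation.character, LinearMap.trace_eq_matrix_trace ℂ b,
    Matrix.trace_fin_two, LinearMap.toMatrix_apply, LinearMap.toMatrix_apply, h₀, h₁]
  simp

theorem character_walk_two_mul_add_one (a : ℤ) :
    ρ.character (walk cs i j (2 * a + 1)) = 0 := by
  have h₀ := zpow_apply_of_apply_eq_smul hζ rotation a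
  have h₁ := zpow_apply_simple_apply cs hζ rotation a
  have reflection' : ρ (cs.simple i) (b 1) = b 0 := by
    rw [← reflection, simple_apply_simple_apply]
  rw [reflection] at h₁
  rw [walk_two_mul_add_one, Representation.character, LinearMap.trace_eq_matrix_trace ℂ b,
    Matrix.trace_fin_two, LinearMap.toMatrix_apply, LinearMap.toMatrix_apply, map_mul,
    Module.End.mul_apply, Module.End.mul_apply, reflection, reflection', h₀, h₁]
  simp

theorem isIrreducible_of_sq_ne_one (hζ' : ζ ^ 2 ≠ 1) : ρ.IsIrreducible := by
  have : Nontrivial V := ⟨b 0, 0, b.ne_zero 0⟩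
  have ζ_ne_inv : ζ - ζ⁻¹ ≠ 0 := fun h => hζ' <| by
    rw [sq, ← mul_inv_cancel₀ hζ, ← sub_eq_zero.mp h]
  have rotation' := rotation_apply_simple_apply cs hζ rotation
  rw [reflection] at rotation'
  refine isIrreducible_of_forall_eq_bot_or_eq_top fun S hS => or_iff_not_imp_left.mpr fun hbot => ?_
  obtain ⟨x, hx, hx0⟩ := S.ne_bot_iff.mp hbot
  have expand : x = b.repr x 0 • b 0 + b.repr x 1 • b 1 := by
    rw [← Fin.sum_univ_two (fun l => b.repr x l • b l), b.sum_repr]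
  have project₀ : ((ζ - ζ⁻¹) * b.repr x 0) • b 0 ∈ S := by
    convert S.sub_mem (hS (cs.simple i * cs.simple j) x hx) (S.smul_mem ζ⁻¹ hx) using 1
    nth_rewrite 2 3 [expand]
    rw [map_add, map_smul, map_smul, rotation, rotation']
    module
  have project₁ : ((ζ⁻¹ - ζ) * b.repr x 1) • b 1 ∈ S := by
    convert S.sub_mem (hS (cs.simple i * cs.simple j) x hx) (S.smul_mem ζ hx) using 1
    nth_rewrite 2 3 [expand]
    rw [map_add, map_smul, map_smul, rotation, rotation']
    module
  have reflection_mem_iff : b 0 ∈ S ↔ b 1 ∈ S := by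
    refine ⟨fun h => reflection ▸ hS _ _ h, fun h => ?_⟩
    simpa only [← reflection, simple_apply_simple_apply] using hS (cs.simple i) _ h
  have basis_mem : b 1 ∈ S := by
    by_cases h₀ : b.repr x 0 = 0
    · have h₁ : b.repr x 1 ≠ 0 := fun h₁ => hx0 (by rw [expand, h₀, h₁]; simp)
      exact (S.smul_mem_iff (mul_ne_zero (by rwa [← neg_sub, neg_ne_zero]) h₁)).mp project₁
    · exact reflection_mem_iff.mp ((S.smul_mem_iff (mul_ne_zero ζ_ne_inv h₀)).mp project₀)
  rw [eq_top_iff, ← b.span_eq, Submodule.span_le, Set.range_subset_iff, Fin.forall_fin_two]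
  exact ⟨reflection_mem_iff.mpr basis_mem, basis_mem⟩

theorem sq_ne_one_of_isIrreducible (hij : i ≠ j) (hρ : ρ.IsIrreducible) : ζ ^ 2 ≠ 1 := by
  intro square
  have ζ_inv : ζ⁻¹ = ζ := inv_eq_of_mul_eq_one_right (by rw [← sq, square])
  have rotation' := rotation_apply_simple_apply cs hζ rotation
  rw [reflection, ζ_inv] at rotation'
  have fixed : ρ (cs.simple i) (b 0 + b 1) = b 0 + b 1 := by
    rw [map_add, ← reflection, simple_apply_simple_apply, add_comm]
  have scaled : ρ (cs.simple i * cs.simple j) (b 0 + b 1) = ζ • (b 0 + b 1) := by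
    rw [map_add, rotation, rotation', smul_add]
  have b_sum_ne : b 0 + b 1 ≠ 0 := fun h => by
    simpa using congrArg (fun x => b.repr x 0) h
  have top := span_eigenvector_eq_top cs hζ scaled hij hρ b_sum_ne
  rw [fixed, Set.pair_eq_singleton] at top
  obtain ⟨c, hc⟩ := Submodule.mem_span_singleton.mp (top ▸ Submodule.mem_top (x := b 0))
  have coord₀ : c = 1 := by simpa using congrArg (fun x => b.repr x 0) hc
  have coord₁ : c = 0 := by simpa using congrArg (fun x => b.repr x 1) hc
  exact one_ne_zero (coord₀.symm.trans coord₁)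

end Basis

end DihedralRepresentation

section Classification

variable {M : CoxeterMatrix (Fin 2)} {W : Type*} [Group W] (cs : CoxeterSystem M W)
  {i j : Fin 2} (hij : i ≠ j) {n : ℕ} (hM : M i j = n)

include hM

theorem pow_eq_one_of_rotation_apply {V : Type*} [AddCommGroup V] [Module ℂ V]
    {ρ : Representation ℂ W V} {v : V} (hv : v ≠ 0) {ζ : ℂ}
    (rotation : ρ (cs.simple i * cs.simple j) v = ζ • v) : ζ ^ n = 1 := by
  have iterate (k : ℕ) : ρ ((cs.simple i * cs.simple j) ^ k) v = ζ ^ k • v := by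
    induction k with
    | zero => simp
    | succ k ih => rw [pow_succ, map_mul, Module.End.mul_apply, rotation, map_smul, ih, smul_smul,
        pow_succ']
  have fixed := iterate n
  rw [← hM, cs.simple_mul_simple_pow, map_one, Module.End.one_apply, hM, eq_comm] at fixed
  exact smul_left_injective ℂ hv (fixed.trans (one_smul ℂ v).symm)

include hij

theorem exists_hom_simple_eq (hn : Even n) (α β : ℤˣ) :
    ∃ f : W →* ℤˣ, f (cs.simple i) = α ∧ f (cs.simple j) = β := by
  have liftable : M.IsLiftable fun b => if b = i then α else β :=
    isLiftable_of_mul_pow_eq_one hij hM (fun _ => Int.units_mul_self _) <| by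
      rw [Int.units_pow_eq_pow_mod_two, Nat.even_iff.mp hn, pow_zero]
  exact ⟨cs.lift ⟨_, liftable⟩, by simp [cs.lift_apply_simple liftable],
    by simp [cs.lift_apply_simple liftable, hij.symm]⟩

theorem exists_rotation_apply_single {ζ : ℂ} (hζ : ζ ^ n = 1) (hζ' : ζ ≠ 0) :
    ∃ ρ : Representation ℂ W (Fin 2 → ℂ),
      ρ (cs.simple i * cs.simple j) (Pi.single 0 1) = ζ • Pi.single 0 1 ∧
        ρ (cs.simple i) (Pi.single 0 1) = Pi.single 1 1 := by
  let A : Matrix (Fin 2) (Fin 2) ℂ := !![0, 1; 1, 0]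
  let C : Matrix (Fin 2) (Fin 2) ℂ := !![0, ζ⁻¹; ζ, 0]
  have A_sq : A * A = 1 := by simp [A, Matrix.one_fin_two]
  have C_sq : C * C = 1 := by simp [C, Matrix.one_fin_two, hζ']
  have A_mul_C : A * C = Matrix.diagonal ![ζ, ζ⁻¹] := by
    ext a b; fin_cases a <;> fin_cases b <;> simp [A, C]
  have power : (A * C) ^ n = 1 := by
    rw [A_mul_C, Matrix.diagonal_pow, Matrix.diagonal_eq_one]
    ext a; fin_cases a <;> simp [hζ]
  have liftable : M.IsLiftable fun b => if b = i then A else C :=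
    isLiftable_of_mul_pow_eq_one hij hM (fun b => by split_ifs <;> assumption)
      (by simpa only [if_true, if_neg hij.symm] using power)
  let ρ : Representation ℂ W (Fin 2 → ℂ) :=
    (Matrix.toLinAlgEquiv' (R := ℂ)).toAlgHom.toMonoidHom.comp (cs.lift ⟨_, liftable⟩)
  have apply_i (x : Fin 2 → ℂ) : ρ (cs.simple i) x = A.mulVec x :=
    congrArg (Matrix.mulVec · x) ((cs.lift_apply_simple liftable i).trans (if_pos rfl))
  have apply_j (x : Fin 2 → ℂ) : ρ (cs.simple j) x = C.mulVec x :=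
    congrArg (Matrix.mulVec · x) ((cs.lift_apply_simple liftable j).trans (if_neg hij.symm))
  refine ⟨ρ, ?_, ?_⟩
  · rw [map_mul, Module.End.mul_apply, apply_i, apply_j, Matrix.mulVec_mulVec, A_mul_C]
    ext a; fin_cases a <;> simp
  · rw [apply_i]
    ext a; fin_cases a <;> simp [A]

variable (hn : 0 < n)

include hn

theorem dihedralChar_mem_irrChars {ζ : ℂ} (hζ : ζ ^ n = 1) (hζ' : ζ ^ 2 ≠ 1) :
    dihedralChar cs ζ ∈ irrChars W := by
  have ζ_ne : ζ ≠ 0 := by rintro rfl; simp [hn.ne'] at hζ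
  obtain ⟨ρ, rotation, reflection⟩ := exists_rotation_apply_single cs hij hM hζ ζ_ne
  simp only [← Pi.basisFun_apply] at rotation reflection
  have irreducible := isIrreducible_of_sq_ne_one cs _ ζ_ne rotation reflection hζ'
  exact ⟨2, ρ, irreducible, (eq_dihedralChar cs hij hM hn hζ
    (character_walk_two_mul cs _ ζ_ne rotation reflection)
    (character_walk_two_mul_add_one cs _ ζ_ne rotation reflection)).symm⟩

theorem character_mem_of_isIrreducible {V : Type*} [AddCommGroup V] [Module ℂ V]
    [FiniteDimensional ℂ V] {ρ : Representation ℂ W V} (hρ : ρ.IsIrreducible) :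
    ρ.character ∈ Set.range signChar ∪ dihedralChar cs '' {ζ | ζ ^ n = 1 ∧ ζ ^ 2 ≠ 1} := by
  have := nontrivial_of_isIrreducible hρ
  obtain ⟨ζ, hζ⟩ := Module.End.exists_eigenvalue (ρ (cs.simple i * cs.simple j))
  obtain ⟨v, hv⟩ := hζ.exists_hasEigenvector
  have rotation : ρ (cs.simple i * cs.simple j) v = ζ • v := hv.apply_eq_smul
  have ζ_pow := pow_eq_one_of_rotation_apply cs hM hv.2 rotation
  have ζ_ne : ζ ≠ 0 := by rintro rfl; simp [hn.ne'] at ζ_pow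
  have span_eq_top : Submodule.span ℂ (Set.range ![v, ρ (cs.simple i) v]) = ⊤ := by
    rw [Matrix.range_cons_cons_empty, span_eigenvector_eq_top cs ζ_ne rotation hij hρ hv.2]
  by_cases independent : LinearIndependent ℂ ![v, ρ (cs.simple i) v]
  · right
    let b := Module.Basis.mk independent span_eq_top.ge
    have rotation_b : ρ (cs.simple i * cs.simple j) (b 0) = ζ • b 0 := by simpa [b] using rotation
    have reflection_b : ρ (cs.simple i) (b 0) = b 1 := by simp [b]
    exact ⟨ζ, ⟨ζ_pow, sq_ne_one_of_isIrreducible cs b ζ_ne rotation_b reflection_b hij hρ⟩,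
      (eq_dihedralChar cs hij hM hn ζ_pow
        (character_walk_two_mul cs b ζ_ne rotation_b reflection_b)
        (character_walk_two_mul_add_one cs b ζ_ne rotation_b reflection_b)).symm⟩
  · left
    have finrank_lt := mt linearIndependent_iff_card_le_finrank_span.mpr independent
    rw [Set.finrank, span_eq_top, finrank_top, Fintype.card_fin, not_le] at finrank_lt
    have finrank_pos := Module.finrank_pos (R := ℂ) (M := V)
    obtain ⟨f, hf⟩ := exists_character_eq_signChar cs ρ (by omega)
    exact ⟨f, hf.symm⟩

theorem irrChars_eq_range_union :
    irrChars W = Set.range signChar ∪ dihedralChar cs '' {ζ | ζ ^ n = 1 ∧ ζ ^ 2 ≠ 1} := by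
  refine Set.Subset.antisymm ?_ (Set.union_subset ?_ ?_)
  · rintro _ ⟨_, ρ, hρ, rfl⟩
    exact character_mem_of_isIrreducible cs hij hM hn hρ
  · rintro _ ⟨f, rfl⟩
    exact signChar_mem_irrChars f
  · rintro _ ⟨ζ, ⟨hζ, hζ'⟩, rfl⟩
    exact dihedralChar_mem_irrChars cs hij hM hn hζ hζ'

end Classification

section RootsOfUnity

variable {K : Type*} [Field K]

theorem sub_one_mul_sum_pow_add_inv {z : K} (hz : z ≠ 0) (t : ℕ) :
    (z - 1) * ∑ k ∈ Finset.Icc 1 t, (z ^ k + (z ^ k)⁻¹) = z ^ (t + 1) - z + 1 - (z ^ t)⁻¹ := by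
  induction t with
  | zero => simp
  | succ t ih =>
    rw [Finset.sum_Icc_succ_top (by omega), mul_add, ih]
    field_simp
    ring

theorem one_add_pow_add_sum_pow_add_inv {z : K} {h : ℕ} (hh : 0 < h) (hz : z ^ (2 * h) = 1)
    (hz' : z ≠ 1) : 1 + z ^ h + ∑ k ∈ Finset.Icc 1 (h - 1), (z ^ k + (z ^ k)⁻¹) = 0 := by
  obtain ⟨t, rfl⟩ := Nat.exists_eq_add_of_lt hh
  rw [zero_add, Nat.add_sub_cancel] at *
  have z_ne : z ≠ 0 := by rintro rfl; simp at hz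
  have inv : (z ^ t)⁻¹ = z ^ (t + 2) := inv_eq_of_mul_eq_one_right (by rw [← hz]; ring)
  have telescope := sub_one_mul_sum_pow_add_inv z_ne t
  rw [inv] at telescope
  refine (mul_eq_zero.mp ?_).resolve_left (sub_ne_zero.mpr hz')
  linear_combination telescope

theorem one_add_sum_pow_add_inv {z : K} {h : ℕ} (hz : z ^ (2 * h + 1) = 1) (hz' : z ≠ 1) :
    1 + ∑ k ∈ Finset.Icc 1 h, (z ^ k + (z ^ k)⁻¹) = 0 := by
  have z_ne : z ≠ 0 := by rintro rfl; simp at hz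
  have inv : (z ^ h)⁻¹ = z ^ (h + 1) := inv_eq_of_mul_eq_one_right (by rw [← hz]; ring)
  have telescope := sub_one_mul_sum_pow_add_inv z_ne h
  rw [inv] at telescope
  refine (mul_eq_zero.mp ?_).resolve_left (sub_ne_zero.mpr hz')
  linear_combination telescope

theorem pow_eq_neg_one_of_isPrimitiveRoot {η : K} {h : ℕ} (hh : 0 < h)
    (hη : IsPrimitiveRoot η (2 * h)) : η ^ h = -1 :=
  (hη.pow (by omega) (mul_comm 2 h)).eq_neg_one_of_two_right

theorem zpow_pow_eq_one_of_isPrimitiveRoot {η : K} {n : ℕ} (hη : IsPrimitiveRoot η n) (a : ℤ) :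
    (η ^ a) ^ n = 1 := by
  rw [← zpow_natCast, zpow_comm, zpow_natCast, hη.pow_eq_one, one_zpow]

theorem sum_zpow_pow_add_inv_of_even {η : K} {h : ℕ} (hh : 0 < h)
    (hη : IsPrimitiveRoot η (2 * h)) (a : ℤ) :
    ∑ k ∈ Finset.Icc 1 (h - 1), ((η ^ a) ^ k + ((η ^ a) ^ k)⁻¹) =
      (if ((2 * h : ℕ) : ℤ) ∣ a then (2 * h : K) else 0) - 1 - (-1) ^ a := by
  have pow_half : (η ^ a) ^ h = (-1) ^ a := by
    rw [← zpow_natCast, zpow_comm, zpow_natCast, pow_eq_neg_one_of_isPrimitiveRoot hh hη]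
  rw [← pow_half]
  split_ifs with dvd
  · obtain ⟨t, rfl⟩ := Nat.exists_eq_add_of_lt hh
    simp [(hη.zpow_eq_one_iff_dvd a).mpr dvd]
    ring
  · linear_combination one_add_pow_add_sum_pow_add_inv hh
      (zpow_pow_eq_one_of_isPrimitiveRoot hη a) (mt (hη.zpow_eq_one_iff_dvd a).mp dvd)

theorem sum_zpow_pow_add_inv_of_odd {η : K} {h : ℕ} (hη : IsPrimitiveRoot η (2 * h + 1))
    (a : ℤ) :
    ∑ k ∈ Finset.Icc 1 h, ((η ^ a) ^ k + ((η ^ a) ^ k)⁻¹) =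
      (if ((2 * h + 1 : ℕ) : ℤ) ∣ a then (2 * h + 1 : K) else 0) - 1 := by
  split_ifs with dvd
  · simp [(hη.zpow_eq_one_iff_dvd a).mpr dvd]
    ring
  · linear_combination one_add_sum_pow_add_inv
      (zpow_pow_eq_one_of_isPrimitiveRoot hη a) (mt (hη.zpow_eq_one_iff_dvd a).mp dvd)

end RootsOfUnity

section SignCharacterValues

variable {G : Type*} [Group G] (f : G →* ℤˣ)

theorem signChar_mul (g h : G) : signChar f (g * h) = signChar f g * signChar f h := by
  simp [signChar_apply]

theorem signChar_zpow (g : G) (a : ℤ) : signChar f (g ^ a) = signChar f g ^ a :=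
  map_zpow (⟨⟨signChar f, signChar_one f⟩, signChar_mul f⟩ : G →* ℂ) g a

variable {B : Type*} {M : CoxeterMatrix B} {W : Type*} [Group W] (cs : CoxeterSystem M W)

theorem signChar_eq_neg_one_pow_length {f : W →* ℤˣ} (hf : ∀ b, f (cs.simple b) = -1) :
    signChar f = fun w => (-1) ^ cs.length w := by
  funext w
  obtain ⟨l, reduced, rfl⟩ := cs.exists_isReduced w
  have apply_wordProd (l : List B) : signChar f (cs.wordProd l) = (-1) ^ l.length := by
    induction l with
    | nil => simp [signChar_one]
    | cons b l ih => rw [cs.wordProd_cons, signChar_mul, ih, signChar_apply, hf, List.length_cons,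
        pow_succ', Units.val_neg, Units.val_one, Int.cast_neg, Int.cast_one]
  rw [apply_wordProd, reduced]

end SignCharacterValues

section EvenDihedral

variable {M : CoxeterMatrix (Fin 2)} {W : Type*} [Group W] (cs : CoxeterSystem M W)
  {i j : Fin 2}

theorem signChar_walk_two_mul (f : W →* ℤˣ) (a : ℤ) :
    signChar f (walk cs i j (2 * a)) =
      (signChar f (cs.simple i) * signChar f (cs.simple j)) ^ a := by
  rw [walk_two_mul, signChar_zpow, signChar_mul]

theorem signChar_walk_two_mul_add_one (f : W →* ℤˣ) (a : ℤ) :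
    signChar f (walk cs i j (2 * a + 1)) =
      (signChar f (cs.simple i) * signChar f (cs.simple j)) ^ a * signChar f (cs.simple i) := by
  rw [walk_two_mul_add_one, signChar_mul, signChar_zpow, signChar_mul]

variable {m : ℕ} {ω : ℂ} (hω : IsPrimitiveRoot ω (2 * m))

include hω

theorem dihedralChar_pow_eq_dihedralChar_pow_sub {k : ℕ} (hk : k ≤ 2 * m) :
    dihedralChar cs (ω ^ k) = dihedralChar cs (ω ^ (2 * m - k)) := by
  have inv : (ω ^ k)⁻¹ = ω ^ (2 * m - k) :=
    inv_eq_of_mul_eq_one_right (by rw [← pow_add, Nat.add_sub_cancel' hk, hω.pow_eq_one])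
  rw [← inv, dihedralChar_inv]

theorem image_dihedralChar_eq (hm : 0 < m) :
    dihedralChar cs '' {ζ | ζ ^ (2 * m) = 1 ∧ ζ ^ 2 ≠ 1} =
      (fun k : ℕ => dihedralChar cs (ω ^ k)) '' (Finset.Icc 1 (m - 1) : Set ℕ) := by
  have : NeZero (2 * m) := ⟨by omega⟩
  have sq_eq_one_iff (k : ℕ) : (ω ^ k) ^ 2 = 1 ↔ m ∣ k := by
    rw [← pow_mul, hω.pow_eq_one_iff_dvd, mul_comm k, Nat.mul_dvd_mul_iff_left two_pos]
  ext ψ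
  simp only [Set.mem_image, Set.mem_ofPred_eq, Finset.coe_Icc, Set.mem_Icc]
  constructor
  · rintro ⟨ζ, ⟨hζ, hζ'⟩, rfl⟩
    obtain ⟨k, hk, rfl⟩ := hω.eq_pow_of_pow_eq_one hζ
    rw [Ne, sq_eq_one_iff] at hζ'
    have k_ne : k ≠ 0 ∧ k ≠ m := ⟨fun h => hζ' (h ▸ dvd_zero m), fun h => hζ' (h ▸ dvd_refl k)⟩
    rcases lt_or_gt_of_ne k_ne.2 with lt | gt
    · exact ⟨k, by omega, rfl⟩
    · exact ⟨2 * m - k, by omega, (dihedralChar_pow_eq_dihedralChar_pow_sub cs hω hk.le).symm⟩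
  · rintro ⟨k, hk, rfl⟩
    refine ⟨ω ^ k, ⟨by rw [pow_right_comm, hω.pow_eq_one, one_pow], ?_⟩, rfl⟩
    rw [Ne, sq_eq_one_iff]
    exact fun dvd => by have := Nat.le_of_dvd (by omega) dvd; omega

variable (hij : i ≠ j) (hM : M i j = 2 * m) (hm : 0 < m)

include hij hM hm

theorem dihedralChar_pow_walk_two_mul (k : ℕ) (a : ℤ) :
    dihedralChar cs (ω ^ k) (walk cs i j (2 * a)) = (ω ^ a) ^ k + ((ω ^ a) ^ k)⁻¹ := by
  rw [dihedralChar_walk_two_mul cs hij hM (by omega) (by rw [pow_right_comm, hω.pow_eq_one,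
    one_pow]), zpow_neg, ← zpow_natCast, ← zpow_natCast, ← zpow_mul, ← zpow_mul, mul_comm a]

theorem injOn_dihedralChar_pow :
    Set.InjOn (fun k : ℕ => dihedralChar cs (ω ^ k)) (Finset.Icc 1 (m - 1) : Set ℕ) := by
  have pow_pow (k : ℕ) : (ω ^ k) ^ (2 * m) = 1 := by rw [pow_right_comm, hω.pow_eq_one, one_pow]
  intro k hk l hl heq
  rw [Finset.coe_Icc, Set.mem_Icc] at hk hl
  rcases (dihedralChar_walk_two_eq_iff cs hij hM (by omega) (pow_pow k) (pow_pow l)).mp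
    (congrFun heq _) with h | h
  · exact hω.pow_inj (by omega) (by omega) h
  · have ω_ne := hω.ne_zero (by omega)
    have product : ω ^ (k + l) = 1 := by
      rw [pow_add, h, inv_mul_cancel₀ (pow_ne_zero _ ω_ne)]
    have := Nat.le_of_dvd (by omega) ((hω.pow_eq_one_iff_dvd _).mp product)
    omega

end EvenDihedral

section DihedralSignCharacters

variable {M : CoxeterMatrix (Fin 2)} {W : Type*} [Group W] (cs : CoxeterSystem M W)
  {i j : Fin 2} (hij : i ≠ j) {n : ℕ} (hM : M i j = n) (hn : Even n)

include hij in
theorem hom_eq_of_apply_simple_eq {G : Type*} [MulOneClass G] {f g : W →* G}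
    (hi : f (cs.simple i) = g (cs.simple i)) (hj : f (cs.simple j) = g (cs.simple j)) : f = g :=
  cs.ext_simple fun b => by rcases eq_or_eq_of_ne hij b with rfl | rfl <;> assumption

include cs hij hM hn

theorem ncard_range_signChar : (Set.range (signChar : (W →* ℤˣ) → W → ℂ)).ncard = 4 := by
  have bijective : Function.Bijective fun f : W →* ℤˣ => (f (cs.simple i), f (cs.simple j)) :=
    ⟨fun f g h => hom_eq_of_apply_simple_eq cs hij (congrArg Prod.fst h) (congrArg Prod.snd h),
      fun ⟨α, β⟩ => (exists_hom_simple_eq cs hij hM hn α β).imp fun _ h => Prod.ext h.1 h.2⟩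
  rw [Set.ncard_range_of_injective signChar_injective, Nat.card_eq_of_bijective _ bijective,
    Nat.card_eq_fintype_card, Fintype.card_prod, Fintype.card_units_int]

theorem range_signChar_eq {f₁ f₂ : W →* ℤˣ}
    (hf₁ : f₁ (cs.simple i) = 1 ∧ f₁ (cs.simple j) = -1)
    (hf₂ : f₂ (cs.simple i) = -1 ∧ f₂ (cs.simple j) = 1) :
    Set.range signChar =
      {fun _ => 1, fun w => (-1) ^ cs.length w, signChar f₁, signChar f₂} := by
  obtain ⟨ε, hε⟩ := exists_hom_simple_eq cs hij hM hn (-1) (-1)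
  have ε_simple (b : Fin 2) : ε (cs.simple b) = -1 := by
    rcases eq_or_eq_of_ne hij b with rfl | rfl
    exacts [hε.1, hε.2]
  have signChar_trivial : signChar (1 : W →* ℤˣ) = fun _ => 1 := by
    funext w; simp [signChar_apply]
  rw [← signChar_trivial, ← signChar_eq_neg_one_pow_length cs ε_simple]
  ext ψ
  constructor
  · rintro ⟨f, rfl⟩
    simp only [Set.mem_insert_iff, Set.mem_singleton_iff, signChar_injective.eq_iff]
    have eq_of {g : W →* ℤˣ} := hom_eq_of_apply_simple_eq cs hij (f := f) (g := g)
    rcases Int.units_eq_one_or (f (cs.simple i)) with hi | hi <;>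
      rcases Int.units_eq_one_or (f (cs.simple j)) with hj | hj
    · exact Or.inl (eq_of (by simp [hi]) (by simp [hj]))
    · exact Or.inr (Or.inr (Or.inl (eq_of (by rw [hi, hf₁.1]) (by rw [hj, hf₁.2]))))
    · exact Or.inr (Or.inr (Or.inr (eq_of (by rw [hi, hf₂.1]) (by rw [hj, hf₂.2]))))
    · exact Or.inr (Or.inl (eq_of (by rw [hi, hε.1]) (by rw [hj, hε.2])))
  · rintro (rfl | rfl | rfl | rfl) <;> exact Set.mem_range_self _

end DihedralSignCharacters

section IrreducibleCharacters

variable {M : CoxeterMatrix (Fin 2)} {W : Type*} [Group W] (cs : CoxeterSystem M W)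
  {i j : Fin 2} (hij : i ≠ j)

include hij in
theorem eq_dihedralChar_of_mem_irrChars {n : ℕ} (hM : M i j = n) (hn : 0 < n) {ζ : ℂ}
    (hζ : ζ ^ n = 1) {ψ : W → ℂ} (hψ : ψ ∈ irrChars W) (degree : ψ 1 = 2)
    (rotation : ψ (walk cs i j 2) = dihedralChar cs ζ (walk cs i j 2)) :
    ψ = dihedralChar cs ζ := by
  rw [irrChars_eq_range_union cs hij hM hn] at hψ
  rcases hψ with ⟨f, rfl⟩ | ⟨ξ, ⟨hξ, -⟩, rfl⟩
  · norm_num [signChar_one] at degree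
  · rcases (dihedralChar_walk_two_eq_iff cs hij hM hn hξ hζ).mp rotation with rfl | rfl
    exacts [rfl, dihedralChar_inv cs ζ]

variable {m : ℕ} (hM : M i j = 2 * m) (hm : 0 < m)

theorem exp_pow_add_inv (m k : ℕ) :
    Complex.exp (2 * Real.pi * Complex.I / (2 * m : ℕ)) ^ k +
      (Complex.exp (2 * Real.pi * Complex.I / (2 * m : ℕ)) ^ k)⁻¹ =
        (2 * Real.cos (Real.pi * k / m) : ℝ) := by
  have angle : (k : ℂ) * (2 * Real.pi * Complex.I / (2 * m : ℕ)) =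
      (Real.pi * k / m : ℂ) * Complex.I := by
    push_cast
    rw [mul_assoc 2, mul_div_mul_left _ _ two_ne_zero]
    ring
  rw [← Complex.exp_nat_mul, angle, ← Complex.exp_neg, ← neg_mul, ← Complex.two_cos]
  push_cast
  rfl

include hij hM hm

theorem dihedralChar_exp_walk_two (k : ℕ) :
    dihedralChar cs (Complex.exp (2 * Real.pi * Complex.I / (2 * m : ℕ)) ^ k) (walk cs i j 2) =
      (2 * Real.cos (Real.pi * k / m) : ℝ) := by
  have rotation := dihedralChar_pow_walk_two_mul cs
    (Complex.isPrimitiveRoot_exp (2 * m) (by omega)) hij hM hm k 1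
  rwa [mul_one, zpow_one, exp_pow_add_inv] at rotation

theorem eq_dihedralChar_exp_of_mem_irrChars (k : ℕ) {ψ : W → ℂ} (hψ : ψ ∈ irrChars W)
    (degree : ψ 1 = 2) (rotation : ψ (walk cs i j 2) = (2 * Real.cos (Real.pi * k / m) : ℝ)) :
    ψ = dihedralChar cs (Complex.exp (2 * Real.pi * Complex.I / (2 * m : ℕ)) ^ k) := by
  have hω := Complex.isPrimitiveRoot_exp (2 * m) (by omega)
  refine eq_dihedralChar_of_mem_irrChars cs hij hM (by omega) ?_ hψ degree
    (rotation.trans (dihedralChar_exp_walk_two cs hij hM hm k).symm)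
  rw [pow_right_comm, hω.pow_eq_one, one_pow]

theorem irrChars_eq {ω : ℂ} (hω : IsPrimitiveRoot ω (2 * m)) {f₁ f₂ : W →* ℤˣ}
    (hf₁ : f₁ (cs.simple i) = 1 ∧ f₁ (cs.simple j) = -1)
    (hf₂ : f₂ (cs.simple i) = -1 ∧ f₂ (cs.simple j) = 1) :
    irrChars W = {fun _ => 1, fun w => (-1) ^ cs.length w, signChar f₁, signChar f₂} ∪
      (fun k : ℕ => dihedralChar cs (ω ^ k)) '' (Finset.Icc 1 (m - 1) : Set ℕ) := by
  rw [irrChars_eq_range_union cs hij hM (by omega), image_dihedralChar_eq cs hω hm,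
    range_signChar_eq cs hij hM (even_two_mul m) hf₁ hf₂]

include cs in
theorem ncard_irrChars : (irrChars W).ncard = m + 3 := by
  have hω := Complex.isPrimitiveRoot_exp (2 * m) (by omega)
  set ω := Complex.exp (2 * Real.pi * Complex.I / (2 * m : ℕ))
  have disjoint : Disjoint (Set.range (signChar : (W →* ℤˣ) → W → ℂ))
      ((fun k : ℕ => dihedralChar cs (ω ^ k)) '' (Finset.Icc 1 (m - 1) : Set ℕ)) := by
    rw [Set.disjoint_left]
    rintro _ ⟨f, rfl⟩ ⟨k, -, h⟩
    have degree := congrFun h 1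
    norm_num [dihedralChar_one, signChar_one] at degree
  have finite : (Set.range (signChar : (W →* ℤˣ) → W → ℂ)).Finite :=
    Set.finite_of_ncard_ne_zero (by rw [ncard_range_signChar cs hij hM (even_two_mul m)]; decide)
  rw [irrChars_eq_range_union cs hij hM (by omega), image_dihedralChar_eq cs hω hm,
    Set.ncard_union_eq disjoint finite, ncard_range_signChar cs hij hM (even_two_mul m),
    (injOn_dihedralChar_pow cs hω hij hM hm).ncard_image, Set.ncard_coe_finset, Nat.card_Icc]
  omega

end IrreducibleCharacters

section CellDecomposition

variable {M : CoxeterMatrix (Fin 2)} {W : Type*} [Group W] [Fintype W] (cs : CoxeterSystem M W)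
  {i j : Fin 2} (hij : i ≠ j) {m : ℕ} (hM : M i j = 2 * m) {ω : ℂ}
  (hω : IsPrimitiveRoot ω (2 * m))

include hij hM hω

theorem cellChar_descentClass_eq (hm : 0 < m) {f : W →* ℤˣ} (hfi : f (cs.simple i) = -1)
    (hfj : f (cs.simple j) = 1) :
    cellChar cs (descentClass cs {i}) =
      signChar f + ∑ k ∈ Finset.Icc 1 (m - 1), dihedralChar cs (ω ^ k) := by
  have signChar_i : signChar f (cs.simple i) = -1 := by rw [signChar_apply, hfi]; simp
  have signChar_j : signChar f (cs.simple j) = 1 := by rw [signChar_apply, hfj]; simp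
  refine funext_walk cs hij hM (by omega) (fun a => ?_) fun a => ?_
  · rw [cellChar_descentClass_walk_two_mul cs hij hM (by omega), Pi.add_apply, Finset.sum_apply,
      signChar_walk_two_mul, signChar_i, signChar_j, mul_one]
    simp only [dihedralChar_pow_walk_two_mul cs hω hij hM hm]
    rw [sum_zpow_pow_add_inv_of_even hm hω]
    push_cast
    ring
  · rw [cellChar_descentClass_walk_two_mul_add_one cs hij hM (by omega) (even_two_mul m),
      Pi.add_apply, Finset.sum_apply, signChar_walk_two_mul_add_one, signChar_i, signChar_j,
      mul_one]
    simp only [dihedralChar_walk_two_mul_add_one, Finset.sum_const_zero, add_zero]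
    rw [← zpow_add_one₀ (by norm_num)]
    split_ifs with ha
    · rw [ha.add_one.neg_one_zpow]
    · rw [(Int.not_even_iff_odd.mp ha).add_one.neg_one_zpow]

end CellDecomposition

section InducedDecomposition

variable {M : CoxeterMatrix (Fin 2)} {i j : Fin 2} (hij : i ≠ j) {m : ℕ} (hM : M i j = 2 * m)
  {W : Type*} [Group W] {cs : CoxeterSystem M W} (d : Diamond cs)
  (hd : d.toMulEquiv (cs.simple i) = cs.simple j) [Fintype W] (hm : 0 < m)

include hij hM hd hm

theorem Diamond.upsilon_walk_two_mul {w : W} (hw : w ∈ d.conjClass 1) (a : ℤ) :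
    d.upsilon w (walk cs i j (2 * a)) = if (m : ℤ) ∣ a then (2 * m : ℂ) else 0 := by
  have mem_iff := walk_mem_pair_iff cs hij hM (2 * a)
  rw [Set.mem_insert_iff, Set.mem_singleton_iff, Nat.cast_mul, Nat.cast_two,
    mul_dvd_mul_iff_left two_ne_zero] at mem_iff
  rw [d.upsilon_apply hij hM hd (by omega) (even_two_mul m) hw, Nat.cast_mul, Nat.cast_two]
  simp only [mem_iff, Nat.cast_mul, Nat.cast_two]

theorem Diamond.upsilon_walk_two_mul_add_one {w : W} (hw : w ∈ d.conjClass 1) (a : ℤ) :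
    d.upsilon w (walk cs i j (2 * a + 1)) = 0 := by
  have mem_iff := walk_mem_pair_iff cs hij hM (2 * a + 1)
  rw [d.upsilon_apply hij hM hd (by omega) (even_two_mul m) hw]
  refine if_neg fun h => ?_
  obtain ⟨c, hc⟩ := mem_iff.mp h
  push_cast at hc
  rw [mul_assoc] at hc
  omega

variable {ω : ℂ} (hω : IsPrimitiveRoot ω (2 * m)) {w : W} (hw : w ∈ d.conjClass 1)

include hω hw

theorem Diamond.upsilon_eq_of_even (heven : Even m) {f₁ f₂ : W →* ℤˣ}
    (hf₁ : f₁ (cs.simple i) = 1 ∧ f₁ (cs.simple j) = -1)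
    (hf₂ : f₂ (cs.simple i) = -1 ∧ f₂ (cs.simple j) = 1) :
    d.upsilon w = (fun _ => 1) + (fun w => (-1) ^ cs.length w) + signChar f₁ + signChar f₂ +
      ∑ k ∈ Finset.Icc 1 ((m - 2) / 2), (2 : ℂ) • dihedralChar cs (ω ^ (2 * k)) := by
  have values : signChar f₁ (cs.simple i) = 1 ∧ signChar f₁ (cs.simple j) = -1 ∧
      signChar f₂ (cs.simple i) = -1 ∧ signChar f₂ (cs.simple j) = 1 := by
    simp [signChar_apply, hf₁, hf₂]
  obtain ⟨h₁i, h₁j, h₂i, h₂j⟩ := values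
  refine funext_walk cs hij hM (by omega) (fun a => ?_) fun a => ?_
  · obtain ⟨h, rfl⟩ := heven.two_dvd
    have comm_pow : (ω ^ a) ^ 2 = (ω ^ 2) ^ a := by rw [← zpow_natCast, ← zpow_natCast, zpow_comm]
    have sum_eq := sum_zpow_pow_add_inv_of_even (by omega) (hω.pow (by omega) rfl) a
    simp only [d.upsilon_walk_two_mul hij hM hd hm hw, Pi.add_apply, Finset.sum_apply,
      Pi.smul_apply, dihedralChar_pow_walk_two_mul cs hω hij hM hm, signChar_walk_two_mul, h₁i, h₁j,
      h₂i, h₂j, neg_one_pow_length_walk, even_two_mul, if_true, smul_eq_mul, ← Finset.mul_sum,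
      pow_mul (ω ^ a), one_mul, mul_one]
    rw [show (2 * h - 2) / 2 = h - 1 by omega, comm_pow, sum_eq]
    split_ifs <;> push_cast <;> ring
  · simp only [d.upsilon_walk_two_mul_add_one hij hM hd hm hw, Pi.add_apply, Finset.sum_apply,
      Pi.smul_apply, dihedralChar_walk_two_mul_add_one, signChar_walk_two_mul_add_one, h₁i, h₁j,
      h₂i, h₂j, neg_one_pow_length_walk, smul_zero, Finset.sum_const_zero, one_mul, mul_one,
      if_neg (Int.not_even_iff_odd.mpr (odd_two_mul_add_one a))]
    ring

theorem Diamond.upsilon_eq_of_odd (hodd : Odd m) :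
    d.upsilon w = (fun _ => 1) + (fun w => (-1) ^ cs.length w) +
      ∑ k ∈ Finset.Icc 1 ((m - 1) / 2), (2 : ℂ) • dihedralChar cs (ω ^ (2 * k)) := by
  refine funext_walk cs hij hM (by omega) (fun a => ?_) fun a => ?_
  · obtain ⟨h, rfl⟩ := hodd
    have comm_pow : (ω ^ a) ^ 2 = (ω ^ 2) ^ a := by rw [← zpow_natCast, ← zpow_natCast, zpow_comm]
    have sum_eq := sum_zpow_pow_add_inv_of_odd (hω.pow (by omega) rfl) a
    simp only [d.upsilon_walk_two_mul hij hM hd hm hw, Pi.add_apply, Finset.sum_apply,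
      Pi.smul_apply, dihedralChar_pow_walk_two_mul cs hω hij hM hm, neg_one_pow_length_walk,
      even_two_mul, if_true, smul_eq_mul, ← Finset.mul_sum, pow_mul (ω ^ a)]
    rw [show (2 * h + 1 - 1) / 2 = h by omega, comm_pow, sum_eq]
    split_ifs <;> push_cast <;> ring
  · simp only [d.upsilon_walk_two_mul_add_one hij hM hd hm hw, Pi.add_apply, Finset.sum_apply,
      Pi.smul_apply, dihedralChar_walk_two_mul_add_one, neg_one_pow_length_walk, smul_zero,
      Finset.sum_const_zero, if_neg (Int.not_even_iff_odd.mpr (odd_two_mul_add_one a))]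
    ring

end InducedDecomposition

section Kottwitz

variable {M : CoxeterMatrix (Fin 2)} {i j : Fin 2} (hij : i ≠ j) {m : ℕ} (hM : M i j = 2 * m)
  {W : Type*} [Group W] {cs : CoxeterSystem M W} (d : Diamond cs)
  (hd : d.toMulEquiv (cs.simple i) = cs.simple j) [Fintype W] (hm : 0 < m)

include hij hM hd hm

theorem Diamond.classInner_upsilon_cellChar_one {w : W} (hw : w ∈ d.conjClass 1) :
    classInner (d.upsilon w) (cellChar cs {1}) = 1 := by
  rw [d.classInner_upsilon hij hM hd (by omega) (even_two_mul m) hw,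
    cellChar_singleton_one cs hij hM (by omega)]
  norm_num

theorem Diamond.classInner_upsilon_cellChar_longest {w : W} (hw : w ∈ d.conjClass 1) :
    classInner (d.upsilon w) (cellChar cs {walk cs i j (2 * m : ℕ)}) = 1 := by
  rw [d.classInner_upsilon hij hM hd (by omega) (even_two_mul m) hw,
    cellChar_singleton_longest cs hij hM (by omega)]
  simp [neg_one_pow_length_walk]

theorem Diamond.classInner_upsilon_cellChar_descentClass {w : W} (hw : w ∈ d.conjClass 1) :
    classInner (d.upsilon w) (cellChar cs (descentClass cs {i})) = m - 1 := by
  have apply_one := cellChar_descentClass_walk_two_mul cs hij hM (by omega) 0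
  have apply_longest := cellChar_descentClass_walk_two_mul cs hij hM (by omega) m
  have not_dvd : ¬ ((2 * m : ℕ) : ℤ) ∣ m := fun h => by
    have := Nat.le_of_dvd hm (Int.natCast_dvd_natCast.mp h)
    omega
  rw [mul_zero, walk_zero, if_pos (dvd_zero _)] at apply_one
  rw [if_neg not_dvd, zero_sub] at apply_longest
  rw [d.classInner_upsilon hij hM hd (by omega) (even_two_mul m) hw, apply_one, Nat.cast_mul,
    Nat.cast_mul, Nat.cast_two, Nat.cast_two, apply_longest]
  simp only [map_sub, map_mul, map_neg, map_one, map_natCast, map_ofNat]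
  ring

theorem Diamond.kottwitzConjecture : KottwitzConjecture cs d := by
  have hM' : M j i = 2 * m := matrix_eq_of_ne hij hM hij.symm
  have hd' : d.toMulEquiv (cs.simple j) = cs.simple i := by rw [← hd, d.involutive]
  intro w twisted Γ hΓ
  have hw := (d.isTwistedInvolution_iff hd hij hM (even_two_mul m) w).mp twisted
  rw [d.conjClass_eq hw]
  have cells := setOf_isLeftCell_eq cs hij hM (by omega) (by omega)
  rcases cells.subset hΓ with rfl | rfl | rfl | rfl
  · rw [d.classInner_upsilon_cellChar_one hij hM hd hm hw, d.ncard_conjClass_one_inter_one,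
      Nat.cast_one]
  · rw [d.classInner_upsilon_cellChar_descentClass hij hM hd hm hw,
      d.ncard_conjClass_one_inter hd hij hM hm, Nat.cast_pred hm]
  · rw [d.classInner_upsilon_cellChar_descentClass hij.symm hM' hd' hm hw,
      d.ncard_conjClass_one_inter hd' hij.symm hM' hm, Nat.cast_pred hm]
  · rw [d.classInner_upsilon_cellChar_longest hij hM hd hm hw,
      d.ncard_conjClass_one_inter_longest hd hij (even_two_mul m), Nat.cast_one]

end Kottwitz

section LongestElement

variable {M : CoxeterMatrix (Fin 2)} {W : Type*} [Group W] (cs : CoxeterSystem M W)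

theorem word1_eq_walk (k : ℕ) : word1 cs k = walk cs 0 1 k := altProd_eq_walk cs 0 1 k

theorem word2_eq_walk (k : ℕ) : word2 cs k = walk cs 1 0 k := altProd_eq_walk cs 1 0 k

theorem length_le_length_walk {i j : Fin 2} (hij : i ≠ j) {n : ℕ} (hM : M i j = n) (hn : 0 < n)
    (w : W) : cs.length w ≤ cs.length (walk cs i j n) := by
  rw [length_walk cs hij hM (Int.natAbs_natCast n).le, Int.natAbs_natCast]
  exact length_le cs hij hM hn w

end LongestElement

end

end TwistedInv

open TwistedInv in
theorem mainTheorem12 (m : ℕ) (hm : 2 ≤ m) {W : Type*} [Group W] [Fintype W]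
    {M : CoxeterMatrix (Fin 2)} (hM : M 0 1 = 2 * m) (cs : CoxeterSystem M W)
    (d : Diamond cs)
    (hd₁ : d.toMulEquiv (cs.simple 0) = cs.simple 1)
    (hd₂ : d.toMulEquiv (cs.simple 1) = cs.simple 0) :
    -- `1_{2m} = 2_{2m}` is the longest element
    (word1 cs (2 * m) = word2 cs (2 * m) ∧
      ∀ w, cs.length w ≤ cs.length (word1 cs (2 * m))) ∧
    -- up to `⋄`-conjugacy, `1` is the only `⋄`-twisted involution
    (d.IsTwistedInvolution 1 ∧ ∀ w, d.IsTwistedInvolution w → d.Conj 1 w) ∧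
    -- the `⋄`-centraliser of `1`, and the character `ε_w` for `w = 1`
    ((d.centralizer 1 : Set W) = {x | d.toMulEquiv x = x} ∧
      (d.centralizer 1 : Set W) = {1, word1 cs (2 * m)} ∧
      d.twistedRoots 1 = ∅ ∧ (∀ x, d.sign 1 x = 1) ∧
      d.upsilon 1 = induced (d.centralizer 1) (fun _ => 1)) ∧
    -- the left cells, and their intersections with the class of `1`
    ({Γ | IsLeftCell cs Γ} = {{1}, cell1 cs m, cell2 cs m, {word1 cs (2 * m)}} ∧
      {Γ | IsLeftCell cs Γ}.ncard = 4 ∧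
      (d.conjClass 1 ∩ {1}).ncard = 1 ∧
      (d.conjClass 1 ∩ cell1 cs m).ncard = m - 1 ∧
      (d.conjClass 1 ∩ cell2 cs m).ncard = m - 1 ∧
      (d.conjClass 1 ∩ {word1 cs (2 * m)}).ncard = 1) ∧
    -- the irreducible characters, and the decompositions
    (∃ (ε₁ ε₂ : W → ℂ) (χ : ℕ → W → ℂ),
      (ε₁ 1 = 1 ∧ ε₁ (cs.simple 0) = 1 ∧ ε₁ (cs.simple 1) = -1) ∧
      (ε₂ 1 = 1 ∧ ε₂ (cs.simple 0) = -1 ∧ ε₂ (cs.simple 1) = 1) ∧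
      (∀ j ∈ Finset.Icc 1 (m - 1), χ j 1 = 2 ∧
        χ j (word1 cs 2) = ((2 * Real.cos (Real.pi * j / m) : ℝ) : ℂ) ∧
        ∀ ψ ∈ irrChars W, ψ 1 = 2 →
          ψ (word1 cs 2) = ((2 * Real.cos (Real.pi * j / m) : ℝ) : ℂ) → ψ = χ j) ∧
      irrChars W = {(fun _ => 1), (fun w => (-1) ^ cs.length w), ε₁, ε₂} ∪
        χ '' (Finset.Icc 1 (m - 1) : Set ℕ) ∧
      (irrChars W).ncard = m + 3 ∧
      (Even m → d.upsilon 1 = (fun _ => 1) + (fun w => (-1) ^ cs.length w) + ε₁ + ε₂ +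
        ∑ j ∈ Finset.Icc 1 ((m - 2) / 2), (2 : ℂ) • χ (2 * j)) ∧
      (Odd m → d.upsilon 1 = (fun _ => 1) + (fun w => (-1) ^ cs.length w) +
        ∑ j ∈ Finset.Icc 1 ((m - 1) / 2), (2 : ℂ) • χ (2 * j)) ∧
      cellChar cs {1} = (fun _ => 1) ∧
      cellChar cs (cell1 cs m) = ε₂ + ∑ j ∈ Finset.Icc 1 (m - 1), χ j ∧
      cellChar cs (cell2 cs m) = ε₁ + ∑ j ∈ Finset.Icc 1 (m - 1), χ j ∧
      cellChar cs {word1 cs (2 * m)} = (fun w => (-1) ^ cs.length w)) ∧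
    -- the scalar products, and Kottwitz' conjecture
    (classInner (d.upsilon 1) (cellChar cs {1}) = 1 ∧
      classInner (d.upsilon 1) (cellChar cs (cell1 cs m)) = (m : ℂ) - 1 ∧
      classInner (d.upsilon 1) (cellChar cs (cell2 cs m)) = (m : ℂ) - 1 ∧
      classInner (d.upsilon 1) (cellChar cs {word1 cs (2 * m)}) = 1) ∧
    KottwitzConjecture cs d := by
  have hm₀ : 0 < m := by omega
  have h01 : (0 : Fin 2) ≠ 1 := zero_ne_one
  have hM' : M 1 0 = 2 * m := matrix_eq_of_ne h01 hM one_ne_zero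
  have hω := Complex.isPrimitiveRoot_exp (2 * m) (by omega)
  have even := even_two_mul m
  have mem_class := d.conj_refl 1
  have no_roots := d.twistedRoots_eq_empty h01 hM hd₁ (by omega) mem_class
  have twisted_iff := d.isTwistedInvolution_iff hd₁ h01 hM even
  obtain ⟨f₁, hf₁⟩ := exists_hom_simple_eq cs h01 hM even 1 (-1)
  obtain ⟨f₂, hf₂⟩ := exists_hom_simple_eq cs h01 hM even (-1) 1
  rw [cell1_eq_descentClass cs hM hm₀, cell2_eq_descentClass cs hM hm₀]
  simp only [word1_eq_walk, word2_eq_walk]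
  exact ⟨⟨(walk_swap_eq cs h01 hM).symm, length_le_length_walk cs h01 hM (by omega)⟩,
    ⟨(twisted_iff 1).mpr mem_class, fun w => (twisted_iff w).mp⟩,
    ⟨d.coe_centralizer_one, d.coe_centralizer hd₁ h01 hM even mem_class, no_roots,
      d.sign_eq_one no_roots, d.upsilon_eq_induced no_roots⟩,
    ⟨setOf_isLeftCell_eq cs h01 hM (by omega) (by omega),
      ncard_setOf_isLeftCell cs h01 hM (by omega) (by omega), d.ncard_conjClass_one_inter_one,
      d.ncard_conjClass_one_inter hd₁ h01 hM hm₀, d.ncard_conjClass_one_inter hd₂ h01.symm hM' hm₀,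
      d.ncard_conjClass_one_inter_longest hd₁ h01 even⟩,
    ⟨signChar f₁, signChar f₂, fun k => dihedralChar cs (_ ^ k),
      ⟨signChar_one f₁, by simp [signChar_apply, hf₁], by simp [signChar_apply, hf₁]⟩,
      ⟨signChar_one f₂, by simp [signChar_apply, hf₂], by simp [signChar_apply, hf₂]⟩,
      fun k _ => ⟨dihedralChar_one cs _, dihedralChar_exp_walk_two cs h01 hM hm₀ k,
        fun _ => eq_dihedralChar_exp_of_mem_irrChars cs h01 hM hm₀ k⟩,
      irrChars_eq cs h01 hM hm₀ hω hf₁ hf₂, ncard_irrChars cs h01 hM hm₀,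
      fun h => d.upsilon_eq_of_even h01 hM hd₁ hm₀ hω mem_class h hf₁ hf₂,
      d.upsilon_eq_of_odd h01 hM hd₁ hm₀ hω mem_class,
      cellChar_singleton_one cs h01 hM (by omega),
      cellChar_descentClass_eq cs h01 hM hω hm₀ hf₂.1 hf₂.2,
      cellChar_descentClass_eq cs h01.symm hM' hω hm₀ hf₁.2 hf₁.1,
      cellChar_singleton_longest cs h01 hM (by omega)⟩,
    ⟨d.classInner_upsilon_cellChar_one h01 hM hd₁ hm₀ mem_class,
      d.classInner_upsilon_cellChar_descentClass h01 hM hd₁ hm₀ mem_class,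
      d.classInner_upsilon_cellChar_descentClass h01.symm hM' hd₂ hm₀ mem_class,
      d.classInner_upsilon_cellChar_longest h01 hM hd₁ hm₀ mem_class⟩,
    d.kottwitzConjecture h01 hM hd₁ hm₀⟩
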